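/- Let $S$ be a connected smooth surface with non-empty boundary $\partial S$ (Hausdorff, second countable, not assumed compact, complete or orientable; the components of $\partial S$ may be non-compact), and let $g$ be a smooth Riemannian metric on $S$ (smooth up to the boundary) for which $\partial S$ is geodesic. Let $\bar S$ denote the double of $S$, obtained by gluing two copies of $S$ along $\partial S$ by the identity. A smooth double structure on $\bar S$ is a smooth structure (without boundary) for which the inclusions of the two copies of $S$ are smooth embeddings and the involution exchanging the two copies is smooth; such a structure is unique up to diffeomorphism. A metric on $S$ is said to lift to a smooth metric on $\bar S$ if there is a smooth Riemannian metric on $\bar S$ whose pullback to each of the two copies of $S$ is the given metric. For $\varepsilon>0$ let $N_\varepsilon(\partial S)$ be the set of points of $S$ whose $g$-distance to some point of $\partial S$ is less than $\varepsilon$. Let $K(\cdot)$ denote the Gaussian curvature. Then there is a smooth double structure on $\bar S$, depending only on $(S,g)$, such that the following holds. Suppose that $K(g)\le -1$ (resp. $K(g)\ge -1$, resp. $K(g)\le 1$) on $S$. Then for every $\varepsilon>0$ there is a smooth Riemannian metric $g^\varepsilon$ on $S$ such that 1. $g^\varepsilon$ lifts to a smooth metric on $\bar S$; 2. $K(g^\varepsilon)\le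 -1+\varepsilon$ (resp. $K(g^\varepsilon)\ge -1-\varepsilon$, resp. $K(g^\varepsilon)\le 1+\varepsilon$) on $S$; 3. $g^\varepsilon=g$ outside $N_\varepsilon(\partial S)$; 4. $|g(v,v)-g^\varepsilon(v,v)|\le\varepsilon$ for every $x\in N_\varepsilon(\partial S)$ and every $v\in T_xS$ with $g(v,v)=1$. -/

import Mathlib

open Set Bundle
open scoped Manifold ContDiff ENNReal Topology

noncomputable section

namespace RiemSurf

/-- The Euclidean plane. -/
abbrev Plane : Type := EuclideanSpace ℝ (Fin 2)

/-- The `i`-th standard basis vector of the plane. -/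
def stdVec (i : Fin 2) : Plane := EuclideanSpace.single i (1 : ℝ)

/-! ### Local Riemannian geometry of a matrix-valued function on a subset of the plane

`G y` is the matrix of the metric coefficients at `y`; all derivatives are taken within `s`
(a half-plane, in the case of a surface with boundary). -/

/-- The `i`-th partial derivative of `f` at `y` within `s`. -/
def partialWithin (s : Set Plane) (i : Fin 2) (f : Plane → ℝ) (y : Plane) : ℝ :=
  fderivWithin ℝ f s y (stdVec i)

/-- The Christoffel symbol `Γᵏᵢⱼ = ½ ∑ₗ gᵏˡ (∂ᵢ gⱼₗ + ∂ⱼ gᵢₗ - ∂ₗ gᵢⱼ)`. -/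
def christoffel (s : Set Plane) (G : Plane → Matrix (Fin 2) (Fin 2) ℝ)
    (k i j : Fin 2) (y : Plane) : ℝ :=
  (1 / 2 : ℝ) * ∑ l, (G y)⁻¹ k l *
    (partialWithin s i (fun z => G z j l) y + partialWithin s j (fun z => G z i l) y
      - partialWithin s l (fun z => G z i j) y)

/-- The component `l` of the Riemann tensor `R(∂ᵢ, ∂ⱼ) ∂ₖ = ∇ᵢ ∇ⱼ ∂ₖ - ∇ⱼ ∇ᵢ ∂ₖ`. -/
def riemannTensor (s : Set Plane) (G : Plane → Matrix (Fin 2) (Fin 2) ℝ)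
    (l i j k : Fin 2) (y : Plane) : ℝ :=
  partialWithin s i (christoffel s G l j k) y - partialWithin s j (christoffel s G l i k) y
    + ∑ m, (christoffel s G m j k y * christoffel s G l i m y
      - christoffel s G m i k y * christoffel s G l j m y)

/-- The Gaussian curvature `⟨R(∂₀, ∂₁) ∂₁, ∂₀⟩ / det g`. -/
def coordCurvature (s : Set Plane) (G : Plane → Matrix (Fin 2) (Fin 2) ℝ) (y : Plane) : ℝ :=
  (∑ l, riemannTensor s G l 0 1 1 y * G y l 0) / (G y).det

/-! ### Riemannian surfaces with boundary -/

section Surface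

variable {S : Type*} [TopologicalSpace S] [ChartedSpace (EuclideanHalfSpace 2) S]
  [IsManifold (𝓡∂ 2) ∞ S]

variable (S) in
/-- Smooth Riemannian metrics on a surface with boundary (smooth up to the boundary). -/
abbrev Metric : Type _ :=
  ContMDiffRiemannianMetric (𝓡∂ 2) ∞ Plane (fun x : S => TangentSpace (𝓡∂ 2) x)

/-- The `i`-th coordinate vector field of the chart at `p`, at the point of coordinates `y`. -/
def coordVec (p : S) (i : Fin 2) (y : Plane) :
    TangentSpace (𝓡∂ 2) ((extChartAt (𝓡∂ 2) p).symm y) :=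
  mfderivWithin 𝓘(ℝ, Plane) (𝓡∂ 2) (extChartAt (𝓡∂ 2) p).symm (range (𝓡∂ 2)) y (stdVec i)

/-- The matrix of `g` in the chart at `p`, at the point of coordinates `y`. -/
def metricCoeff (g : Metric S) (p : S) (y : Plane) : Matrix (Fin 2) (Fin 2) ℝ :=
  Matrix.of fun i j =>
    g.inner ((extChartAt (𝓡∂ 2) p).symm y) (coordVec p i y) (coordVec p j y)

/-- The Gaussian curvature of `g` at `p`, computed in the chart at `p`. -/
def gaussCurvature (g : Metric S) (p : S) : ℝ :=
  coordCurvature (range (𝓡∂ 2)) (metricCoeff g p) (extChartAt (𝓡∂ 2) p p)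

/-- The curve `γ` satisfies at time `t` the geodesic equation
`uₖ'' + ∑ᵢⱼ Γᵏᵢⱼ(u) uᵢ' uⱼ' = 0`, where `u` is the expression of `γ` in the chart at `γ t`. -/
def GeodesicEqAt (g : Metric S) (γ : ℝ → S) (t : ℝ) : Prop :=
  let u : ℝ → Plane := fun τ => extChartAt (𝓡∂ 2) (γ t) (γ τ)
  ∀ k : Fin 2, deriv (deriv u) t k
    + ∑ i, ∑ j, christoffel (range (𝓡∂ 2)) (metricCoeff g (γ t)) k i j (u t)
        * deriv u t i * deriv u t j = 0

/-- `γ` is a smooth unit-speed geodesic of `g` on the open set `J` of times. -/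
structure IsUnitGeodesicOn (g : Metric S) (γ : ℝ → S) (J : Set ℝ) : Prop where
  smooth : ContMDiffOn 𝓘(ℝ, ℝ) (𝓡∂ 2) ∞ γ J
  unitSpeed : ∀ t ∈ J, g.inner (γ t) (mfderiv 𝓘(ℝ, ℝ) (𝓡∂ 2) γ t (1 : ℝ))
    (mfderiv 𝓘(ℝ, ℝ) (𝓡∂ 2) γ t (1 : ℝ)) = 1
  geodesic : ∀ t ∈ J, GeodesicEqAt g γ t

/-- The boundary is geodesic: through every boundary point there passes a unit-speed geodesic
that is contained in the boundary. -/
def HasGeodesicBoundary (g : Metric S) : Prop :=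
  ∀ p ∈ (𝓡∂ 2).boundary S, ∃ (γ : ℝ → S) (δ : ℝ), 0 < δ ∧ γ 0 = p ∧
    IsUnitGeodesicOn g γ (Ioo (-δ) δ) ∧ ∀ t ∈ Ioo (-δ) δ, γ t ∈ (𝓡∂ 2).boundary S

/-- The distance of `g`: the infimum of the `g`-lengths of the `C¹` paths joining two points. -/
def edistOf (g : Metric S) (x y : S) : ℝ≥0∞ :=
  letI : RiemannianBundle (fun x : S => TangentSpace (𝓡∂ 2) x) := ⟨g.toRiemannianMetric⟩
  Manifold.riemannianEDist (𝓡∂ 2) x y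

/-- The (open) `ε`-neighbourhood of the boundary for `g`. -/
def boundaryNhd (g : Metric S) (ε : ℝ) : Set S :=
  {x | ∃ y ∈ (𝓡∂ 2).boundary S, edistOf g x y < ENNReal.ofReal ε}

end Surface

/-! ### The double -/

section Double

variable (S : Type*) [TopologicalSpace S] [ChartedSpace (EuclideanHalfSpace 2) S]

/-- Two points of the disjoint union `S × Bool` of two copies of `S` are identified when they are
equal, or when they are the two copies of one boundary point. -/
def doubleSetoid : Setoid (S × Bool) where
  r a b := a.1 = b.1 ∧ (a.2 = b.2 ∨ a.1 ∈ (𝓡∂ 2).boundary S)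
  iseqv :=
    { refl := fun _ => ⟨rfl, Or.inl rfl⟩
      symm := by
        rintro ⟨x, a⟩ ⟨y, b⟩ ⟨h, h'⟩
        dsimp only at h h' ⊢
        subst h
        exact ⟨rfl, h'.imp Eq.symm id⟩
      trans := by
        rintro ⟨x, a⟩ ⟨y, b⟩ ⟨z, c⟩ ⟨h1, h1'⟩ ⟨h2, h2'⟩
        dsimp only at h1 h1' h2 h2' ⊢
        subst h1
        subst h2
        refine ⟨rfl, ?_⟩
        rcases h1' with h | h
        · rcases h2' with k | k
          · exact Or.inl (h.trans k)
          · exact Or.inr k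
        · exact Or.inr h }

/-- The double of `S`, with the quotient topology. -/
def Double : Type _ := Quotient (doubleSetoid S)

instance : TopologicalSpace (Double S) :=
  inferInstanceAs (TopologicalSpace (Quotient (doubleSetoid S)))

variable {S}

/-- The inclusion of the copy of `S` with label `b` in the double. -/
def Double.incl (b : Bool) (x : S) : Double S := Quotient.mk (doubleSetoid S) (x, b)

/-- The involution of the double which exchanges the two copies of `S`. -/
def Double.swap : Double S → Double S :=
  Quotient.map (fun a : S × Bool => (a.1, !a.2)) (by
    rintro ⟨x, a⟩ ⟨y, b⟩ ⟨h, h'⟩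
    exact ⟨h, h'.imp (fun k => congrArg not k) id⟩)

variable (S) in
/-- A structure of smooth surface without boundary on the double of `S`, for which the two copies
of `S` are smoothly embedded and the involution is smooth. (The inclusions are topological
embeddings for the quotient topology, so only the smoothness and the injectivity of the
differential have to be required.) -/
structure SmoothDouble where
  charted : ChartedSpace Plane (Double S)
  isManifold : IsManifold (𝓡 2) ∞ (Double S)
  smooth_incl : ∀ b, ContMDiff (𝓡∂ 2) (𝓡 2) ∞ (Double.incl b : S → Double S)
  immersive_incl : ∀ b (x : S),
    Function.Injective (mfderiv (𝓡∂ 2) (𝓡 2) (Double.incl b : S → Double S) x)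
  smooth_swap : ContMDiff (𝓡 2) (𝓡 2) ∞ (Double.swap : Double S → Double S)

variable [IsManifold (𝓡∂ 2) ∞ S]

/-- `g` lifts to a smooth metric on the double: there is a smooth Riemannian metric on the double
whose pullback to each of the two copies of `S` is `g`. -/
def SmoothDouble.Lifts (D : SmoothDouble S) (g : Metric S) : Prop :=
  letI := D.charted
  haveI := D.isManifold
  ∃ h : ContMDiffRiemannianMetric (𝓡 2) ∞ Plane (fun z : Double S => TangentSpace (𝓡 2) z),
    ∀ (b : Bool) (x : S) (v w : TangentSpace (𝓡∂ 2) x),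
      h.inner (Double.incl b x) (mfderiv (𝓡∂ 2) (𝓡 2) (Double.incl b : S → Double S) x v)
        (mfderiv (𝓡∂ 2) (𝓡 2) (Double.incl b : S → Double S) x w) = g.inner x v w

/-- The metric `g'` lifts smoothly to the double, equals `g` outside the `ε`-neighbourhood of the
boundary, and satisfies `|g - g'| ≤ ε` on the `g`-unit tangent vectors over this neighbourhood. -/
structure IsDoublingApprox (D : SmoothDouble S) (g : Metric S) (ε : ℝ) (g' : Metric S) :
    Prop where
  lifts : D.Lifts g'
  eq_outside : ∀ x, x ∉ boundaryNhd g ε → g'.inner x = g.inner x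
  close : ∀ x ∈ boundaryNhd g ε, ∀ v : TangentSpace (𝓡∂ 2) x,
    g.inner x v v = 1 → |g.inner x v v - g'.inner x v v| ≤ ε

end Double

end RiemSurf

end

/-!
Near a boundary point choose a chart in which the metric is the identity matrix along `∂S`. Its
reflection in the boundary line is then a natural extension to the double, with coefficients
`M₀₀`, `M₁₁` extended as even and `M₀₁` as odd functions of the normal coordinate `y`; the metric
lifts to the double when these extensions are smooth. The coordinate `y = v 0` is normal to
the boundary and `x = v 1` runs along it.

*The smooth structure.* A plane-valued map is adapted to `g` if it sends `∂S` to the boundary line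
and its differential along `∂S` is an isometry. Two adapted maps differ along `∂S` by an isometry
`x ↦ ± x + c` of the line, and if they agree there, then they agree to first order. Convex
combinations of adapted maps that agree along `∂S` are therefore adapted, so a partition of unity
glues local adapted maps to a family whose members differ, near boundary points, exactly by
`(y, x) ↦ (y, ± x + c)` (`exists_compatible_adapted`). By an inverse function theorem at the edge of
the half-plane (`exists_halfPlane_diffeomorph`) these maps restrict to charts, which form a
`FlatAtlas` constructed from `(S, g)` only. Its coordinate changes near `∂S` commute with the reflection, so the
charts double to a smooth structure `FlatAtlas.double`, for which the reflection is smooth, and a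
metric that is Euclidean along `∂S` lifts if its coefficients extend smoothly by reflection
(`FlatAtlas.lifts`).

*The correction.* In these charts `∂S` is geodesic if and only if `∂₀ M₁₁ = 0` at `y = 0`
(`geodesicChart_coeffs`). Subtract from `M` the residue of the expansion
`M₀₀ = 1 + …`, `M₀₁ = y ∂₀M₀₁ + …`, `M₁₁ = 1 + y² ∂₀²M₁₁ / 2 + …`, cut off outside a strip of width
`δ`. Since `M₀₁` and `M₁₁` are approximated to first and second order, the cut-off residue has a
small jet as `δ → 0`, with the only exception of `∂₀ M₀₀`, which is merely bounded (`jet_corr`). But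
the curvature at the boundary does not involve `∂₀ M₀₀`, because there
`M₀₁ = ∂₁M₀₁ = ∂₀M₁₁ = 0` (`exists_curvJ_close`). So the curvature changes by an arbitrarily small
amount, and the metric becomes a polynomial in `y` of the right parity where the cutoff is one
(`GeodesicChart.exists_correction`). Residues of metrics that already extend smoothly by reflection
also do, so a correction does not destroy what previous ones achieved.

*Globalisation.* The boundary is covered by a locally finite sequence of compact sets, each in one
chart, and the `n`-th correction is made with error `ε / 2 ^ (n + 2)` near the `n`-th set
(`exists_step`, `FlatAtlas.exists_even_metric`). The limit satisfies `|K(g') - K(g)| ≤ ε` everywhere,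
so one metric serves for all three curvature bounds.
-/

open Set Bundle
open scoped Manifold ContDiff ENNReal Topology

set_option linter.unusedSectionVars false

noncomputable section

namespace RiemSurf

/-! ### Calculus on the closed half-plane -/

/-- The closed half-plane, on which a surface with boundary is modelled. -/
local notation "ℍ₂" => (range (𝓡∂ 2) : Set Plane)

lemma mem_half {v : Plane} : v ∈ ℍ₂ ↔ 0 ≤ v 0 := by
  rw [range_modelWithCornersEuclideanHalfSpace]; rfl

lemma uniqueDiffOn_half : UniqueDiffOn ℝ ℍ₂ := (𝓡∂ 2).uniqueDiffOn

lemma plane_eq_sum (v : Plane) : v = v 0 • stdVec 0 + v 1 • stdVec 1 := by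
  ext i; fin_cases i <;> simp [stdVec]

/-- `f` is smooth, within the half-plane, at all points of the half-plane near `v`. -/
def SmoothNear {E : Type*} [NormedAddCommGroup E] [NormedSpace ℝ E] (f : Plane → E) (v : Plane) :
    Prop :=
  ∀ᶠ w in 𝓝[ℍ₂] v, ContDiffWithinAt ℝ ∞ f ℍ₂ w

namespace SmoothNear

variable {E F : Type*} [NormedAddCommGroup E] [NormedSpace ℝ E] [NormedAddCommGroup F]
  [NormedSpace ℝ F] {f g : Plane → E} {v : Plane}

lemma self (h : SmoothNear f v) (hv : v ∈ ℍ₂) : ContDiffWithinAt ℝ ∞ f ℍ₂ v :=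
  h.self_of_nhdsWithin hv

lemma eventually (h : SmoothNear f v) : ∀ᶠ w in 𝓝[ℍ₂] v, SmoothNear f w :=
  eventually_eventually_nhdsWithin.2 h

lemma congr (h : SmoothNear f v) (hg : g =ᶠ[𝓝[ℍ₂] v] f) : SmoothNear g v := by
  filter_upwards [h, eventually_eventually_nhdsWithin.2 hg, self_mem_nhdsWithin] with w hw hw' hm
  exact hw.congr_of_eventuallyEq hw' (hw'.self_of_nhdsWithin hm)

lemma of_contDiffAt (h : ∀ᶠ w in 𝓝 v, ContDiffAt ℝ ∞ f w) : SmoothNear f v := by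
  filter_upwards [mem_nhdsWithin_of_mem_nhds h] with w hw
  exact hw.contDiffWithinAt

lemma of_contDiff (h : ContDiff ℝ ∞ f) : SmoothNear f v :=
  Filter.Eventually.of_forall fun _ => h.contDiffAt.contDiffWithinAt

lemma const (c : E) : SmoothNear (fun _ => c) v := of_contDiff contDiff_const

lemma add (hf : SmoothNear f v) (hg : SmoothNear g v) : SmoothNear (fun w => f w + g w) v := by
  filter_upwards [hf, hg] with w h1 h2 using h1.add h2

lemma sub (hf : SmoothNear f v) (hg : SmoothNear g v) : SmoothNear (fun w => f w - g w) v := by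
  filter_upwards [hf, hg] with w h1 h2 using h1.sub h2

lemma neg (hf : SmoothNear f v) : SmoothNear (fun w => -f w) v := by
  filter_upwards [hf] with w h1 using h1.neg

lemma mul {f g : Plane → ℝ} (hf : SmoothNear f v) (hg : SmoothNear g v) :
    SmoothNear (fun w => f w * g w) v := by
  filter_upwards [hf, hg] with w h1 h2 using h1.mul h2

lemma sum {ι : Type*} {s : Finset ι} {f : ι → Plane → E} (hf : ∀ i ∈ s, SmoothNear (f i) v) :
    SmoothNear (fun w => ∑ i ∈ s, f i w) v := by
  have : ∀ᶠ w in 𝓝[ℍ₂] v, ∀ i ∈ s, ContDiffWithinAt ℝ ∞ (f i) ℍ₂ w :=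
    (Filter.eventually_all_finset s).2 hf
  filter_upwards [this] with w hw
  exact ContDiffWithinAt.sum hw

lemma inv {f : Plane → ℝ} (hf : SmoothNear f v) (hv : v ∈ ℍ₂) (h0 : f v ≠ 0) :
    SmoothNear (fun w => (f w)⁻¹) v := by
  filter_upwards [hf, (hf.self hv).continuousWithinAt.eventually_ne h0] with w h1 h2
  exact h1.inv h2

lemma clm (L : E →L[ℝ] F) (hf : SmoothNear f v) : SmoothNear (fun w => L (f w)) v := by
  filter_upwards [hf] with w h1 using L.contDiff.contDiffAt.comp_contDiffWithinAt w h1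

lemma apply {f : Plane → Plane} (hf : SmoothNear f v) (i : Fin 2) : SmoothNear (fun w => f w i) v :=
  hf.clm (EuclideanSpace.proj i : Plane →L[ℝ] ℝ)

lemma coord (i : Fin 2) : SmoothNear (fun w : Plane => w i) v :=
  of_contDiff (EuclideanSpace.proj i : Plane →L[ℝ] ℝ).contDiff

lemma comp {θ : Plane → Plane} (hf : SmoothNear f (θ v)) (hθ : SmoothNear θ v) (hv : v ∈ ℍ₂)
    (hm : ∀ᶠ w in 𝓝[ℍ₂] v, θ w ∈ ℍ₂) : SmoothNear (fun w => f (θ w)) v := by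
  have ht : Filter.Tendsto θ (𝓝[ℍ₂] v) (𝓝[ℍ₂] (θ v)) :=
    tendsto_nhdsWithin_iff.2 ⟨(hθ.self hv).continuousWithinAt, hm⟩
  filter_upwards [ht.eventually hf, hθ, eventually_eventually_nhdsWithin.2 hm,
    self_mem_nhdsWithin] with w h1 h2 h3 hw
  have h1' : ContDiffWithinAt ℝ ∞ f (ℍ₂) (θ w) := h1
  exact (h1'.comp_inter w h2).mono_of_mem_nhdsWithin (Filter.inter_mem self_mem_nhdsWithin h3)

lemma partial_ {f : Plane → ℝ} (hf : SmoothNear f v) (i : Fin 2) :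
    SmoothNear (partialWithin ℍ₂ i f) v := by
  filter_upwards [hf, self_mem_nhdsWithin] with w h hw
  have : ContDiffWithinAt ℝ ∞ (fderivWithin ℝ f ℍ₂) ℍ₂ w :=
    h.fderivWithin_right uniqueDiffOn_half (by exact le_rfl) hw
  exact this.clm_apply contDiffWithinAt_const

lemma diff (h : SmoothNear f v) (hv : v ∈ ℍ₂) : DifferentiableWithinAt ℝ f ℍ₂ v :=
  (h.self hv).differentiableWithinAt (by simp)

lemma cont (h : SmoothNear f v) (hv : v ∈ ℍ₂) : ContinuousWithinAt f ℍ₂ v :=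
  (h.self hv).continuousWithinAt

end SmoothNear

/-- `f` is differentiable at the point `v` of the half-plane, with `i`-th partial derivative
`f'`. -/
structure HasPartial (i : Fin 2) (f : Plane → ℝ) (f' : ℝ) (v : Plane) : Prop where
  mem : v ∈ ℍ₂
  diff : DifferentiableWithinAt ℝ f ℍ₂ v
  eq : partialWithin ℍ₂ i f v = f'

lemma SmoothNear.hasPartial {f : Plane → ℝ} {v : Plane} (h : SmoothNear f v) (hv : v ∈ ℍ₂)
    (i : Fin 2) : HasPartial i f (partialWithin ℍ₂ i f v) v := ⟨hv, h.diff hv, rfl⟩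

namespace HasPartial

variable {i : Fin 2} {f g : Plane → ℝ} {a b : ℝ} {v : Plane}

lemma ud (h : HasPartial i f a v) : UniqueDiffWithinAt ℝ ℍ₂ v := uniqueDiffOn_half v h.mem

lemma congr (h : HasPartial i f a v) (hg : g =ᶠ[𝓝[ℍ₂] v] f) : HasPartial i g a v :=
  ⟨h.mem, h.diff.congr_of_eventuallyEq hg (hg.self_of_nhdsWithin h.mem), by
    rw [← h.eq, partialWithin, partialWithin, hg.fderivWithin_eq (hg.self_of_nhdsWithin h.mem)]⟩

lemma const (hv : v ∈ ℍ₂) (c : ℝ) : HasPartial i (fun _ => c) 0 v :=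
  ⟨hv, differentiableWithinAt_const c, by simp [partialWithin]⟩

lemma add (hf : HasPartial i f a v) (hg : HasPartial i g b v) :
    HasPartial i (fun w => f w + g w) (a + b) v :=
  ⟨hf.mem, hf.diff.add hg.diff, by
    rw [partialWithin, fderivWithin_fun_add hf.ud hf.diff hg.diff, ← hf.eq, ← hg.eq]; rfl⟩

lemma sub (hf : HasPartial i f a v) (hg : HasPartial i g b v) :
    HasPartial i (fun w => f w - g w) (a - b) v :=
  ⟨hf.mem, hf.diff.sub hg.diff, by
    rw [partialWithin, fderivWithin_fun_sub hf.ud hf.diff hg.diff, ← hf.eq, ← hg.eq]; rfl⟩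

lemma mul (hf : HasPartial i f a v) (hg : HasPartial i g b v) :
    HasPartial i (fun w => f w * g w) (a * g v + f v * b) v :=
  ⟨hf.mem, hf.diff.mul hg.diff, by
    rw [partialWithin, fderivWithin_fun_mul hf.ud hf.diff hg.diff, ← hf.eq, ← hg.eq]
    simp [partialWithin]; ring⟩

lemma const_mul (hf : HasPartial i f a v) (c : ℝ) :
    HasPartial i (fun w => c * f w) (c * a) v := by
  simpa using (const (i := i) hf.mem c).mul hf

lemma of_eq (hf : HasPartial i f a v) (h : a = b) : HasPartial i f b v := h ▸ hf

lemma coord (hv : v ∈ ℍ₂) (k : Fin 2) :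
    HasPartial i (fun w => w k) (if i = k then 1 else 0) v := by
  refine ⟨hv, (EuclideanSpace.proj k : Plane →L[ℝ] ℝ).differentiableAt.differentiableWithinAt, ?_⟩
  have : fderivWithin ℝ (fun w : Plane => w k) ℍ₂ v = (EuclideanSpace.proj k : Plane →L[ℝ] ℝ) :=
    (EuclideanSpace.proj k : Plane →L[ℝ] ℝ).fderivWithin (uniqueDiffOn_half v hv)
  rw [partialWithin, this]
  by_cases h : i = k
  · simp [stdVec, h]
  · simp [stdVec, h, Ne.symm h]

lemma uniq (hf : HasPartial i f a v) (hg : HasPartial i f b v) : a = b := by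
  rw [← hf.eq, hg.eq]

end HasPartial

/-- The chain rule in coordinates. -/
lemma HasPartial.comp {i : Fin 2} {f : Plane → ℝ} {θ : Plane → Plane} {v : Plane}
    (hf : DifferentiableWithinAt ℝ f ℍ₂ (θ v)) (hθ : DifferentiableWithinAt ℝ θ ℍ₂ v)
    (hv : v ∈ ℍ₂) (hm : ∀ᶠ w in 𝓝[ℍ₂] v, θ w ∈ ℍ₂) :
    HasPartial i (fun w => f (θ w))
      (partialWithin ℍ₂ 0 f (θ v) * partialWithin ℍ₂ i (fun w => θ w 0) v
        + partialWithin ℍ₂ 1 f (θ v) * partialWithin ℍ₂ i (fun w => θ w 1) v) v := by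
  have ht : Filter.Tendsto θ (𝓝[ℍ₂] v) (𝓝[ℍ₂] (θ v)) :=
    tendsto_nhdsWithin_iff.2 ⟨hθ.continuousWithinAt, hm⟩
  have hu := uniqueDiffOn_half v hv
  have h := hf.hasFDerivWithinAt.comp_of_tendsto v hθ.hasFDerivWithinAt ht
  have hk : ∀ k : Fin 2, partialWithin ℍ₂ i (fun w => θ w k) v
      = (fderivWithin ℝ θ ℍ₂ v (stdVec i)) k := by
    intro k
    have := ((EuclideanSpace.proj k : Plane →L[ℝ] ℝ).hasFDerivAt.comp_hasFDerivWithinAt v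
      hθ.hasFDerivWithinAt).fderivWithin hu
    have h2 : fderivWithin ℝ (fun w => θ w k) ℍ₂ v
      = (EuclideanSpace.proj k : Plane →L[ℝ] ℝ).comp (fderivWithin ℝ θ ℍ₂ v) := this
    rw [partialWithin, h2]; rfl
  refine ⟨hv, h.differentiableWithinAt, ?_⟩
  have h2 := h.fderivWithin hu
  have h3 : fderivWithin ℝ (fun w => f (θ w)) ℍ₂ v
    = (fderivWithin ℝ f ℍ₂ (θ v)).comp (fderivWithin ℝ θ ℍ₂ v) := h2
  rw [hk, hk, partialWithin, h3, ContinuousLinearMap.comp_apply,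
    plane_eq_sum (fderivWithin ℝ θ ℍ₂ v (stdVec i))]
  simp only [map_add, map_smul, smul_eq_mul, partialWithin]
  simp [stdVec]
  ring

/-- The second partial derivatives of a smooth function commute. -/
lemma SmoothNear.partial_comm {f : Plane → ℝ} {v : Plane} (hf : SmoothNear f v) (hv : v ∈ ℍ₂)
    (i j : Fin 2) : partialWithin ℍ₂ i (partialWithin ℍ₂ j f) v
      = partialWithin ℍ₂ j (partialWithin ℍ₂ i f) v := by
  have hu := uniqueDiffOn_half v hv
  have hs : IsSymmSndFDerivWithinAt ℝ f ℍ₂ v := by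
    refine (hf.self hv).isSymmSndFDerivWithinAt (n := ∞) ?_ uniqueDiffOn_half ?_ hv
    · simp [minSmoothness_of_isRCLikeNormedField]; exact ENat.LEInfty.out
    · have : v ∈ closure (interior ℍ₂) := by
        have h := (𝓡∂ 2).range_subset_closure_interior hv
        exact h
      exact this
  have hd : DifferentiableWithinAt ℝ (fderivWithin ℝ f ℍ₂) ℍ₂ v := by
    have : ContDiffWithinAt ℝ ∞ (fderivWithin ℝ f ℍ₂) ℍ₂ v :=
      (hf.self hv).fderivWithin_right uniqueDiffOn_half (by exact le_rfl) hv
    exact this.differentiableWithinAt (by simp)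
  have key : ∀ i j, partialWithin ℍ₂ i (partialWithin ℍ₂ j f) v
      = fderivWithin ℝ (fderivWithin ℝ f ℍ₂) ℍ₂ v (stdVec i) (stdVec j) := by
    intro i j
    have h : fderivWithin ℝ (fun w => fderivWithin ℝ f ℍ₂ w (stdVec j)) ℍ₂ v = _ :=
      fderivWithin_clm_apply hu hd (differentiableWithinAt_const (stdVec j))
    rw [partialWithin]
    change fderivWithin ℝ (fun w => fderivWithin ℝ f ℍ₂ w (stdVec j)) ℍ₂ v (stdVec i) = _
    rw [h]
    simp
  rw [key, key]
  exact hs _ _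

/-! ### The Gaussian curvature as a function of the jet of the metric -/

/-- A matrix-valued function is, near the point `v` of the half-plane, smooth, symmetric and
invertible. -/
structure MetricNear (M : Plane → Matrix (Fin 2) (Fin 2) ℝ) (v : Plane) : Prop where
  mem : v ∈ ℍ₂
  smooth : ∀ i j, SmoothNear (fun w => M w i j) v
  symm : ∀ᶠ w in 𝓝[ℍ₂] v, M w 1 0 = M w 0 1
  det : (M v).det ≠ 0

/-- The inverse of the symmetric form `[[a, b], [b, c]]`, times its determinant, applied to the
vectors `(p, q)` and `(r, s)`. -/
def adjForm (a b c p q r s : ℝ) : ℝ := c * p * r - b * (p * s + q * r) + a * q * s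

/-- The Gaussian curvature of the metric `[[a, b], [b, c]]` in terms of its derivatives: `a0` is
`∂₀ a`, and so on. -/
def curvOfJet (a b c a0 a1 b0 b1 c0 c1 b01 c00 a11 : ℝ) : ℝ :=
  (b01 - c00 / 2 - a11 / 2
    + (adjForm a b c (a1 / 2) (c0 / 2) (a1 / 2) (c0 / 2)
      - adjForm a b c (a0 / 2) (b0 - a1 / 2) (b1 - c0 / 2) (c1 / 2)) / (a * c - b ^ 2))
    / (a * c - b ^ 2)

/-- The Christoffel symbols of the first kind. -/
def christoffelLow (M : Plane → Matrix (Fin 2) (Fin 2) ℝ) (l i j : Fin 2) (y : Plane) : ℝ :=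
  (1 / 2 : ℝ) * (partialWithin ℍ₂ i (fun z => M z j l) y + partialWithin ℍ₂ j (fun z => M z i l) y
      - partialWithin ℍ₂ l (fun z => M z i j) y)

namespace MetricNear

variable {M : Plane → Matrix (Fin 2) (Fin 2) ℝ} {v : Plane}

lemma det_smooth (h : MetricNear M v) : SmoothNear (fun w => (M w).det) v := by
  simp only [Matrix.det_fin_two]
  exact ((h.smooth 0 0).mul (h.smooth 1 1)).sub ((h.smooth 0 1).mul (h.smooth 1 0))

lemma eventually (h : MetricNear M v) : ∀ᶠ w in 𝓝[ℍ₂] v, MetricNear M w := by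
  have h1 : ∀ᶠ w in 𝓝[ℍ₂] v, ∀ i j, SmoothNear (fun w => M w i j) w :=
    Filter.eventually_all.2 fun i => Filter.eventually_all.2 fun j => (h.smooth i j).eventually
  filter_upwards [h1, eventually_eventually_nhdsWithin.2 h.symm, self_mem_nhdsWithin,
    (h.det_smooth.cont h.mem).eventually_ne h.det] with w h1 h2 h3 h4
  exact ⟨h3, h1, h2, h4⟩

lemma symm_at (h : MetricNear M v) : M v 1 0 = M v 0 1 := h.symm.self_of_nhdsWithin h.mem

lemma det_eq (h : MetricNear M v) : (M v).det = M v 0 0 * M v 1 1 - M v 0 1 ^ 2 := by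
  rw [Matrix.det_fin_two, h.symm_at]; ring

lemma partial_symm (h : MetricNear M v) (i : Fin 2) :
    partialWithin ℍ₂ i (fun w => M w 1 0) v = partialWithin ℍ₂ i (fun w => M w 0 1) v := by
  have : (fun w => M w 1 0) =ᶠ[𝓝[ℍ₂] v] fun w => M w 0 1 := h.symm
  exact ((((h.smooth 0 1).hasPartial h.mem i)).congr this).eq

lemma christoffel_eq (h : MetricNear M v) (k i j : Fin 2) :
    christoffel ℍ₂ M k i j v = (if k = 0 then
        M v 1 1 * christoffelLow M 0 i j v - M v 0 1 * christoffelLow M 1 i j v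
      else - M v 0 1 * christoffelLow M 0 i j v + M v 0 0 * christoffelLow M 1 i j v)
      * ((M v).det)⁻¹ := by
  rw [christoffel, Matrix.inv_def, Matrix.adjugate_fin_two]
  simp only [Fin.sum_univ_two, christoffelLow]
  fin_cases k <;> simp [h.symm_at] <;> ring

/-- Lowering the index of the Christoffel symbols. -/
lemma low_christoffel (h : MetricNear M v) (k i j : Fin 2) :
    M v k 0 * christoffel ℍ₂ M 0 i j v + M v k 1 * christoffel ℍ₂ M 1 i j v
      = christoffelLow M k i j v := by
  rw [h.christoffel_eq, h.christoffel_eq]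
  have hd := h.det
  have hde := h.det_eq
  have hs := h.symm_at
  generalize (M v).det = D at hd hde
  fin_cases k <;> simp [hs] <;> field_simp <;> rw [hde] <;> ring

lemma christoffelLow_smooth (h : MetricNear M v) (l i j : Fin 2) :
    SmoothNear (christoffelLow M l i j) v :=
  (SmoothNear.const _).mul ((((h.smooth j l).partial_ i).add ((h.smooth i l).partial_ j)).sub
    ((h.smooth i j).partial_ l))

lemma christoffel_smooth (h : MetricNear M v) (k i j : Fin 2) :
    SmoothNear (christoffel ℍ₂ M k i j) v := by
  have hc := fun l => h.christoffelLow_smooth l i j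
  have hd := h.det_smooth.inv h.mem h.det
  fin_cases k
  · refine SmoothNear.congr ((((h.smooth 1 1).mul (hc 0)).sub ((h.smooth 0 1).mul (hc 1))).mul hd)
      ?_
    filter_upwards [h.eventually] with w hw using by simpa using hw.christoffel_eq 0 i j
  · refine SmoothNear.congr
      (((h.smooth 0 1).neg.mul (hc 0)).add ((h.smooth 0 0).mul (hc 1)) |>.mul hd) ?_
    filter_upwards [h.eventually] with w hw using by simpa using hw.christoffel_eq 1 i j

/-- The curvature `R(∂₀, ∂₁, ∂₁, ∂₀) / det` expressed by the jet of the metric. -/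
theorem coordCurvature_eq (h : MetricNear M v) :
    coordCurvature ℍ₂ M v = curvOfJet (M v 0 0) (M v 0 1) (M v 1 1)
      (partialWithin ℍ₂ 0 (fun w => M w 0 0) v) (partialWithin ℍ₂ 1 (fun w => M w 0 0) v)
      (partialWithin ℍ₂ 0 (fun w => M w 0 1) v) (partialWithin ℍ₂ 1 (fun w => M w 0 1) v)
      (partialWithin ℍ₂ 0 (fun w => M w 1 1) v) (partialWithin ℍ₂ 1 (fun w => M w 1 1) v)
      (partialWithin ℍ₂ 0 (partialWithin ℍ₂ 1 (fun w => M w 0 1)) v)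
      (partialWithin ℍ₂ 0 (partialWithin ℍ₂ 0 (fun w => M w 1 1)) v)
      (partialWithin ℍ₂ 1 (partialWithin ℍ₂ 1 (fun w => M w 0 0)) v) := by
  -- Differentiating `∑ M 0 l * Γ l i j = christoffelLow M 0 i j` avoids the derivatives of `M⁻¹`.
  have key : ∀ k i j, M v 0 0 * partialWithin ℍ₂ k (christoffel ℍ₂ M 0 i j) v
      + M v 0 1 * partialWithin ℍ₂ k (christoffel ℍ₂ M 1 i j) v
      = partialWithin ℍ₂ k (christoffelLow M 0 i j) v
        - partialWithin ℍ₂ k (fun w => M w 0 0) v * christoffel ℍ₂ M 0 i j v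
        - partialWithin ℍ₂ k (fun w => M w 0 1) v * christoffel ℍ₂ M 1 i j v := by
    intro k i j
    have h1 := (((h.smooth 0 0).hasPartial h.mem k).mul
        ((h.christoffel_smooth 0 i j).hasPartial h.mem k)).add
      (((h.smooth 0 1).hasPartial h.mem k).mul ((h.christoffel_smooth 1 i j).hasPartial h.mem k))
    have h2 := h1.congr (g := christoffelLow M 0 i j) (by
      filter_upwards [h.eventually] with w hw using (hw.low_christoffel 0 i j).symm)
    linarith [h2.eq]
  -- The two derivatives of Christoffel symbols of the first kind that occur in `R(∂₀, ∂₁, ∂₁, ∂₀)`.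
  have e1 : partialWithin ℍ₂ 0 (christoffelLow M 0 1 1) v
      = partialWithin ℍ₂ 0 (partialWithin ℍ₂ 1 (fun w => M w 0 1)) v
        - partialWithin ℍ₂ 0 (partialWithin ℍ₂ 0 (fun w => M w 1 1)) v / 2 := by
    have h1 := ((((h.smooth 0 1).partial_ 1).hasPartial h.mem 0)).sub
      (((((h.smooth 1 1).partial_ 0).hasPartial h.mem 0)).const_mul (1 / 2))
    have h2 := h1.congr (g := christoffelLow M 0 1 1) (by
      filter_upwards [h.eventually] with w hw
      have := hw.partial_symm 1
      simp only [christoffelLow, this]; ring)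
    rw [h2.eq]; ring
  have e2 : partialWithin ℍ₂ 1 (christoffelLow M 0 0 1) v
      = partialWithin ℍ₂ 1 (partialWithin ℍ₂ 1 (fun w => M w 0 0)) v / 2 := by
    have h1 := (((((h.smooth 0 0).partial_ 1).hasPartial h.mem 1)).const_mul (1 / 2))
    have h2 := h1.congr (g := christoffelLow M 0 0 1) (by
      filter_upwards [h.eventually] with w hw
      have := hw.partial_symm 0
      simp only [christoffelLow, this]; ring)
    rw [h2.eq]; ring
  have k1 := key 0 1 1
  have k2 := key 1 0 1
  rw [e1] at k1
  rw [e2] at k2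
  have hd := h.det
  have hde := h.det_eq
  have lows : ∀ l i j, christoffelLow M l i j v = (1 / 2 : ℝ) *
    (partialWithin ℍ₂ i (fun z => M z j l) v + partialWithin ℍ₂ j (fun z => M z i l) v
      - partialWithin ℍ₂ l (fun z => M z i j) v) := fun _ _ _ => rfl
  have s0 := h.partial_symm 0
  have s1 := h.partial_symm 1
  -- Lowering the index of the curvature tensor also lowers one Christoffel symbol in each quadratic
  -- term.
  have hsum : ∑ l, riemannTensor ℍ₂ M l 0 1 1 v * M v l 0
      = (M v 0 0 * partialWithin ℍ₂ 0 (christoffel ℍ₂ M 0 1 1) v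
        + M v 0 1 * partialWithin ℍ₂ 0 (christoffel ℍ₂ M 1 1 1) v)
        - (M v 0 0 * partialWithin ℍ₂ 1 (christoffel ℍ₂ M 0 0 1) v
        + M v 0 1 * partialWithin ℍ₂ 1 (christoffel ℍ₂ M 1 0 1) v)
        + (christoffel ℍ₂ M 0 1 1 v * christoffelLow M 0 0 0 v
          + christoffel ℍ₂ M 1 1 1 v * christoffelLow M 0 0 1 v
          - christoffel ℍ₂ M 0 0 1 v * christoffelLow M 0 1 0 v
          - christoffel ℍ₂ M 1 0 1 v * christoffelLow M 0 1 1 v) := by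
    rw [← h.low_christoffel 0 0 0, ← h.low_christoffel 0 0 1, ← h.low_christoffel 0 1 0,
      ← h.low_christoffel 0 1 1]
    simp only [Fin.sum_univ_two, riemannTensor, h.symm_at]
    ring
  rw [coordCurvature, hsum, k1, k2]
  simp only [h.christoffel_eq, lows, curvOfJet, adjForm, s0, s1, if_true, one_ne_zero, if_false,
    ← hde]
  generalize (M v).det = D at hd hde ⊢
  field_simp
  ring

end MetricNear

/-! ### Change of coordinates -/

/-- Near `v`, the matrix-valued function `M'` is the pullback of the metric `M` under the smooth
map `θ` of the half-plane. -/
structure PullbackNear (M M' : Plane → Matrix (Fin 2) (Fin 2) ℝ) (θ : Plane → Plane) (v : Plane) :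
    Prop where
  smooth : SmoothNear θ v
  maps : ∀ᶠ w in 𝓝[ℍ₂] v, θ w ∈ ℍ₂
  base : MetricNear M (θ v)
  pull : MetricNear M' v
  eq : ∀ᶠ w in 𝓝[ℍ₂] v, ∀ i j, M' w i j = ∑ k, ∑ l, partialWithin ℍ₂ i (fun z => θ z k) w
    * partialWithin ℍ₂ j (fun z => θ z l) w * M (θ w) k l

namespace PullbackNear

variable {M M' : Plane → Matrix (Fin 2) (Fin 2) ℝ} {θ : Plane → Plane} {v : Plane}

lemma tendsto (h : PullbackNear M M' θ v) : Filter.Tendsto θ (𝓝[ℍ₂] v) (𝓝[ℍ₂] (θ v)) :=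
  tendsto_nhdsWithin_iff.2 ⟨h.smooth.cont h.pull.mem, h.maps⟩

lemma eventually (h : PullbackNear M M' θ v) : ∀ᶠ w in 𝓝[ℍ₂] v, PullbackNear M M' θ w := by
  filter_upwards [h.smooth.eventually, eventually_eventually_nhdsWithin.2 h.maps,
    h.tendsto.eventually h.base.eventually, h.pull.eventually,
    eventually_eventually_nhdsWithin.2 h.eq] with w h1 h2 h3 h4 h5
  exact ⟨h1, h2, h3, h4, h5⟩

lemma eq_at (h : PullbackNear M M' θ v) (i j : Fin 2) : M' v i j =
    ∑ k, ∑ l, partialWithin ℍ₂ i (fun z => θ z k) v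
    * partialWithin ℍ₂ j (fun z => θ z l) v * M (θ v) k l :=
  h.eq.self_of_nhdsWithin h.pull.mem i j

lemma hasPartial_comp (h : PullbackNear M M' θ v) {f : Plane → ℝ} (hf : SmoothNear f (θ v))
    (c : Fin 2) : HasPartial c (fun w => f (θ w))
      (partialWithin ℍ₂ 0 f (θ v) * partialWithin ℍ₂ c (fun w => θ w 0) v
        + partialWithin ℍ₂ 1 f (θ v) * partialWithin ℍ₂ c (fun w => θ w 1) v) v :=
  HasPartial.comp (hf.diff h.base.mem) (h.smooth.diff h.pull.mem) h.pull.mem h.maps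

lemma hasPartial_jac (h : PullbackNear M M' θ v) (c i k : Fin 2) :
    HasPartial c (partialWithin ℍ₂ i (fun z => θ z k))
      (partialWithin ℍ₂ c (partialWithin ℍ₂ i (fun z => θ z k)) v) v :=
  ((h.smooth.apply k).partial_ i).hasPartial h.pull.mem c

lemma hasPartial_jac₂ (h : PullbackNear M M' θ v) (d c i k : Fin 2) :
    HasPartial d (partialWithin ℍ₂ c (partialWithin ℍ₂ i (fun z => θ z k)))
      (partialWithin ℍ₂ d (partialWithin ℍ₂ c (partialWithin ℍ₂ i (fun z => θ z k))) v) v :=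
  (((h.smooth.apply k).partial_ i).partial_ c).hasPartial h.pull.mem d

/-- The first derivatives of the pulled back metric. -/
lemma partial_eq (h : PullbackNear M M' θ v) (c i j : Fin 2) :
    partialWithin ℍ₂ c (fun w => M' w i j) v = ∑ k, ∑ l,
      ((partialWithin ℍ₂ c (partialWithin ℍ₂ i (fun z => θ z k)) v
          * partialWithin ℍ₂ j (fun z => θ z l) v
        + partialWithin ℍ₂ i (fun z => θ z k) v
          * partialWithin ℍ₂ c (partialWithin ℍ₂ j (fun z => θ z l)) v) * M (θ v) k l
        + partialWithin ℍ₂ i (fun z => θ z k) v * partialWithin ℍ₂ j (fun z => θ z l) v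
          * (partialWithin ℍ₂ 0 (fun w => M w k l) (θ v) * partialWithin ℍ₂ c (fun w => θ w 0) v
        + partialWithin ℍ₂ 1 (fun w => M w k l) (θ v) * partialWithin ℍ₂ c (fun w => θ w 1) v)) :=
            by
  have t := fun k l => ((h.hasPartial_jac c i k).mul (h.hasPartial_jac c j l)).mul
    (h.hasPartial_comp (h.base.smooth k l) c)
  have := (((t 0 0).add (t 0 1)).add ((t 1 0).add (t 1 1))).congr (g := fun w => M' w i j) (by
    filter_upwards [h.eq] with w hw
    rw [hw]; simp only [Fin.sum_univ_two])
  rw [this.eq]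
  simp only [Fin.sum_univ_two]

/-- The second derivatives of the pulled back metric. -/
lemma partial_partial_eq (h : PullbackNear M M' θ v) (d c i j : Fin 2) :
    partialWithin ℍ₂ d (partialWithin ℍ₂ c (fun w => M' w i j)) v = ∑ k, ∑ l,
      (((partialWithin ℍ₂ d (partialWithin ℍ₂ c (partialWithin ℍ₂ i (fun z => θ z k))) v
          * partialWithin ℍ₂ j (fun z => θ z l) v
        + partialWithin ℍ₂ c (partialWithin ℍ₂ i (fun z => θ z k)) v
          * partialWithin ℍ₂ d (partialWithin ℍ₂ j (fun z => θ z l)) v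
        + (partialWithin ℍ₂ d (partialWithin ℍ₂ i (fun z => θ z k)) v
          * partialWithin ℍ₂ c (partialWithin ℍ₂ j (fun z => θ z l)) v
          + partialWithin ℍ₂ i (fun z => θ z k) v
          * partialWithin ℍ₂ d (partialWithin ℍ₂ c (partialWithin ℍ₂ j (fun z => θ z l))) v))
          * M (θ v) k l
        + (partialWithin ℍ₂ c (partialWithin ℍ₂ i (fun z => θ z k)) v
          * partialWithin ℍ₂ j (fun z => θ z l) v
        + partialWithin ℍ₂ i (fun z => θ z k) v
          * partialWithin ℍ₂ c (partialWithin ℍ₂ j (fun z => θ z l)) v) *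
         (partialWithin ℍ₂ 0 (fun w => M w k l) (θ v) * partialWithin ℍ₂ d (fun w => θ w 0) v
        + partialWithin ℍ₂ 1 (fun w => M w k l) (θ v) * partialWithin ℍ₂ d (fun w => θ w 1) v))
        + ((partialWithin ℍ₂ d (partialWithin ℍ₂ i (fun z => θ z k)) v
          * partialWithin ℍ₂ j (fun z => θ z l) v
          + partialWithin ℍ₂ i (fun z => θ z k) v
          * partialWithin ℍ₂ d (partialWithin ℍ₂ j (fun z => θ z l)) v)
          * (partialWithin ℍ₂ 0 (fun w => M w k l) (θ v) * partialWithin ℍ₂ c (fun w => θ w 0) v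
        + partialWithin ℍ₂ 1 (fun w => M w k l) (θ v) * partialWithin ℍ₂ c (fun w => θ w 1) v)
        + partialWithin ℍ₂ i (fun z => θ z k) v * partialWithin ℍ₂ j (fun z => θ z l) v
          * (((partialWithin ℍ₂ 0 (partialWithin ℍ₂ 0 (fun w => M w k l)) (θ v)
              * partialWithin ℍ₂ d (fun w => θ w 0) v
            + partialWithin ℍ₂ 1 (partialWithin ℍ₂ 0 (fun w => M w k l)) (θ v)
              * partialWithin ℍ₂ d (fun w => θ w 1) v) * partialWithin ℍ₂ c (fun w => θ w 0) v
            + partialWithin ℍ₂ 0 (fun w => M w k l) (θ v)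
              * partialWithin ℍ₂ d (partialWithin ℍ₂ c (fun w => θ w 0)) v)
          + ((partialWithin ℍ₂ 0 (partialWithin ℍ₂ 1 (fun w => M w k l)) (θ v)
              * partialWithin ℍ₂ d (fun w => θ w 0) v
            + partialWithin ℍ₂ 1 (partialWithin ℍ₂ 1 (fun w => M w k l)) (θ v)
              * partialWithin ℍ₂ d (fun w => θ w 1) v) * partialWithin ℍ₂ c (fun w => θ w 1) v
            + partialWithin ℍ₂ 1 (fun w => M w k l) (θ v)
              * partialWithin ℍ₂ d (partialWithin ℍ₂ c (fun w => θ w 1)) v)))) := by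
  have t := fun k l =>
    ((((h.hasPartial_jac₂ d c i k).mul (h.hasPartial_jac d j l)).add
      ((h.hasPartial_jac d i k).mul (h.hasPartial_jac₂ d c j l))).mul
      (h.hasPartial_comp (h.base.smooth k l) d)).add
    (((h.hasPartial_jac d i k).mul (h.hasPartial_jac d j l)).mul
      (((h.hasPartial_comp ((h.base.smooth k l).partial_ 0) d).mul (h.hasPartial_jac d c 0)).add
      ((h.hasPartial_comp ((h.base.smooth k l).partial_ 1) d).mul (h.hasPartial_jac d c 1))))
  have := (((t 0 0).add (t 0 1)).add ((t 1 0).add (t 1 1))).congr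
    (g := partialWithin ℍ₂ c (fun w => M' w i j)) (by
      filter_upwards [h.eventually] with w hw
      rw [hw.partial_eq]; simp only [Fin.sum_univ_two])
  rw [this.eq]
  simp only [Fin.sum_univ_two]

end PullbackNear

/-- If a metric and two covectors are pulled back by a linear map, then `adjForm` is multiplied by
the square of the determinant. -/
lemma adjForm_congruence (a b c p q r s x y z w : ℝ) :
    adjForm (p * p * a + 2 * (p * q * b) + q * q * c)
        (p * r * a + (p * s + q * r) * b + q * s * c)
        (r * r * a + 2 * (r * s * b) + s * s * c)
        (p * x + q * y) (r * x + s * y) (p * z + q * w) (r * z + s * w)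
      = (p * s - q * r) ^ 2 * adjForm a b c x y z w := by
  simp only [adjForm]; ring

/-- The effect on `adjForm` of the second derivatives of a coordinate change, which contribute to
the lowered Christoffel symbols a vector in the image of the metric. -/
lemma adjForm_add (a b c x y z w t0 t1 u0 u1 : ℝ) :
    adjForm a b c (x + (a * t0 + b * t1)) (y + (b * t0 + c * t1))
        (z + (a * u0 + b * u1)) (w + (b * u0 + c * u1))
      = adjForm a b c x y z w + (a * c - b ^ 2) *
        (x * u0 + y * u1 + (z * t0 + w * t1)
          + (a * t0 * u0 + b * (t0 * u1 + t1 * u0) + c * t1 * u1)) := by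
  simp only [adjForm]; ring

/-- The combination `|Γ₀₁|² - ⟨Γ₀₀, Γ₁₁⟩` which enters the curvature is a `2 × 2` minor, so a linear
coordinate change multiplies it by the square of the Jacobian determinant. -/
lemma adjForm_minor (a b c x0 x1 y0 y1 z0 z1 p q r s : ℝ) :
    adjForm a b c (p * r * x0 + (p * s + q * r) * y0 + q * s * z0)
        (p * r * x1 + (p * s + q * r) * y1 + q * s * z1)
        (p * r * x0 + (p * s + q * r) * y0 + q * s * z0)
        (p * r * x1 + (p * s + q * r) * y1 + q * s * z1)
      - adjForm a b c (p * p * x0 + 2 * (p * q * y0) + q * q * z0)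
        (p * p * x1 + 2 * (p * q * y1) + q * q * z1)
        (r * r * x0 + 2 * (r * s * y0) + s * s * z0)
        (r * r * x1 + 2 * (r * s * y1) + s * s * z1)
      = (p * s - q * r) ^ 2 * (adjForm a b c y0 y1 y0 y1 - adjForm a b c x0 x1 z0 z1) := by
  simp only [adjForm]; ring

/-- The algebraic identity behind the invariance of the curvature: `p, q, r, s` is the Jacobian
matrix of the change of coordinates, `x, y, z` are its second and `α, β` its third derivatives. -/
lemma curvOfJet_pullback (a b c a0 a1 b0 b1 c0 c1 a00 a01 a11 b00 b01 b11 c00 c01 c11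
    p q r s x0 x1 y0 y1 z0 z1 α0 α1 β0 β1
    a' b' c' a0' a1' b0' b1' c0' c1' b01' c00' a11' : ℝ)
    (hD : a * c - b ^ 2 ≠ 0) (hΔ : p * s - q * r ≠ 0)
    (ha : a' = p * p * a + 2 * (p * q * b) + q * q * c)
    (hb : b' = p * r * a + (p * s + q * r) * b + q * s * c)
    (hc : c' = r * r * a + 2 * (r * s * b) + s * s * c)
    (ha0 : a0' = 2 * (x0 * p * a + (x0 * q + x1 * p) * b + x1 * q * c)
      + p * p * (a0 * p + a1 * q) + 2 * (p * q * (b0 * p + b1 * q)) + q * q * (c0 * p + c1 * q))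
    (ha1 : a1' = 2 * (y0 * p * a + (y0 * q + y1 * p) * b + y1 * q * c)
      + p * p * (a0 * r + a1 * s) + 2 * (p * q * (b0 * r + b1 * s)) + q * q * (c0 * r + c1 * s))
    (hb0 : b0' = (x0 * r + p * y0) * a + (x0 * s + x1 * r + p * y1 + q * y0) * b
      + (x1 * s + q * y1) * c
      + p * r * (a0 * p + a1 * q) + (p * s + q * r) * (b0 * p + b1 * q) + q * s * (c0 * p + c1 * q))
    (hb1 : b1' = (y0 * r + p * z0) * a + (y0 * s + y1 * r + p * z1 + q * z0) * b
      + (y1 * s + q * z1) * c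
      + p * r * (a0 * r + a1 * s) + (p * s + q * r) * (b0 * r + b1 * s) + q * s * (c0 * r + c1 * s))
    (hc0 : c0' = 2 * (y0 * r * a + (y0 * s + y1 * r) * b + y1 * s * c)
      + r * r * (a0 * p + a1 * q) + 2 * (r * s * (b0 * p + b1 * q)) + s * s * (c0 * p + c1 * q))
    (hc1 : c1' = 2 * (z0 * r * a + (z0 * s + z1 * r) * b + z1 * s * c)
      + r * r * (a0 * r + a1 * s) + 2 * (r * s * (b0 * r + b1 * s)) + s * s * (c0 * r + c1 * s))
    (hb01 : b01' = (α0 * r + y0 * y0 + x0 * z0 + p * β0) * a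
      + (α0 * s + α1 * r + 2 * (y0 * y1) + x0 * z1 + x1 * z0 + p * β1 + q * β0) * b
      + (α1 * s + y1 * y1 + x1 * z1 + q * β1) * c
      + (y0 * r + p * z0) * (a0 * p + a1 * q)
      + (y0 * s + y1 * r + p * z1 + q * z0) * (b0 * p + b1 * q)
      + (y1 * s + q * z1) * (c0 * p + c1 * q)
      + (x0 * r + p * y0) * (a0 * r + a1 * s)
      + (x0 * s + x1 * r + p * y1 + q * y0) * (b0 * r + b1 * s)
      + (x1 * s + q * y1) * (c0 * r + c1 * s)
      + p * r * (a00 * p * r + a01 * (p * s + q * r) + a11 * q * s + a0 * y0 + a1 * y1)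
      + (p * s + q * r) * (b00 * p * r + b01 * (p * s + q * r) + b11 * q * s + b0 * y0 + b1 * y1)
      + q * s * (c00 * p * r + c01 * (p * s + q * r) + c11 * q * s + c0 * y0 + c1 * y1))
    (hc00 : c00' = 2 * ((α0 * r + y0 * y0) * a + (α0 * s + α1 * r + 2 * (y0 * y1)) * b
        + (α1 * s + y1 * y1) * c)
      + 4 * (y0 * r * (a0 * p + a1 * q) + (y0 * s + y1 * r) * (b0 * p + b1 * q)
        + y1 * s * (c0 * p + c1 * q))
      + r * r * (a00 * p * p + 2 * (a01 * p * q) + a11 * q * q + a0 * x0 + a1 * x1)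
      + 2 * (r * s * (b00 * p * p + 2 * (b01 * p * q) + b11 * q * q + b0 * x0 + b1 * x1))
      + s * s * (c00 * p * p + 2 * (c01 * p * q) + c11 * q * q + c0 * x0 + c1 * x1))
    (ha11 : a11' = 2 * ((β0 * p + y0 * y0) * a + (β0 * q + β1 * p + 2 * (y0 * y1)) * b
        + (β1 * q + y1 * y1) * c)
      + 4 * (y0 * p * (a0 * r + a1 * s) + (y0 * q + y1 * p) * (b0 * r + b1 * s)
        + y1 * q * (c0 * r + c1 * s))
      + p * p * (a00 * r * r + 2 * (a01 * r * s) + a11 * s * s + a0 * z0 + a1 * z1)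
      + 2 * (p * q * (b00 * r * r + 2 * (b01 * r * s) + b11 * s * s + b0 * z0 + b1 * z1))
      + q * q * (c00 * r * r + 2 * (c01 * r * s) + c11 * s * s + c0 * z0 + c1 * z1)) :
    curvOfJet a' b' c' a0' a1' b0' b1' c0' c1' b01' c00' a11'
      = curvOfJet a b c a0 a1 b0 b1 c0 c1 b01 c00 a11 := by
  have hD' : a' * c' - b' ^ 2 = (p * s - q * r) ^ 2 * (a * c - b ^ 2) := by
    rw [ha, hb, hc]; ring
  -- The tensorial part of the Christoffel symbols of the first kind: `u`, `v`, `w` belong to the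
  -- index pairs `00`, `01`, `11`.
  set u0 := p * p * (a0 / 2) + 2 * (p * q * (a1 / 2)) + q * q * (b1 - c0 / 2) with hu0
  set u1 := p * p * (b0 - a1 / 2) + 2 * (p * q * (c0 / 2)) + q * q * (c1 / 2) with hu1
  set v0 := p * r * (a0 / 2) + (p * s + q * r) * (a1 / 2) + q * s * (b1 - c0 / 2) with hv0
  set v1 := p * r * (b0 - a1 / 2) + (p * s + q * r) * (c0 / 2) + q * s * (c1 / 2) with hv1
  set w0 := r * r * (a0 / 2) + 2 * (r * s * (a1 / 2)) + s * s * (b1 - c0 / 2) with hw0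
  set w1 := r * r * (b0 - a1 / 2) + 2 * (r * s * (c0 / 2)) + s * s * (c1 / 2) with hw1
  -- The Christoffel symbols of the new metric are the tensorial part plus the metric applied to the
  -- second derivatives of the coordinate change.
  have e1 : a1' / 2 = p * (v0 + (a * y0 + b * y1)) + q * (v1 + (b * y0 + c * y1)) := by
    rw [ha1, hv0, hv1]; ring
  have e2 : c0' / 2 = r * (v0 + (a * y0 + b * y1)) + s * (v1 + (b * y0 + c * y1)) := by
    rw [hc0, hv0, hv1]; ring
  have e3 : a0' / 2 = p * (u0 + (a * x0 + b * x1)) + q * (u1 + (b * x0 + c * x1)) := by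
    rw [ha0, hu0, hu1]; ring
  have e4 : b0' - a1' / 2 = r * (u0 + (a * x0 + b * x1)) + s * (u1 + (b * x0 + c * x1)) := by
    rw [hb0, ha1, hu0, hu1]; ring
  have e5 : b1' - c0' / 2 = p * (w0 + (a * z0 + b * z1)) + q * (w1 + (b * z0 + c * z1)) := by
    rw [hb1, hc0, hw0, hw1]; ring
  have e6 : c1' / 2 = r * (w0 + (a * z0 + b * z1)) + s * (w1 + (b * z0 + c * z1)) := by
    rw [hc1, hw0, hw1]; ring
  have hmin := adjForm_minor a b c (a0 / 2) (b0 - a1 / 2) (a1 / 2) (c0 / 2) (b1 - c0 / 2) (c1 / 2)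
    p q r s
  rw [← hu0, ← hu1, ← hv0, ← hv1, ← hw0, ← hw1] at hmin
  -- The third derivatives of the coordinate change cancel in the terms of second order.
  have hlin : b01' - c00' / 2 - a11' / 2
      + ((2 * (v0 * y0 + v1 * y1) + (a * y0 * y0 + 2 * (b * (y0 * y1)) + c * y1 * y1))
        - (u0 * z0 + u1 * z1 + (w0 * x0 + w1 * x1)
          + (a * x0 * z0 + b * (x0 * z1 + x1 * z0) + c * x1 * z1)))
      = (p * s - q * r) ^ 2 * (b01 - c00 / 2 - a11 / 2) := by
    rw [hb01, hc00, ha11, hu0, hu1, hv0, hv1, hw0, hw1]; ring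
  simp only [curvOfJet, hD', e4, e5]
  simp only [e1, e2, e3, e6]
  rw [ha, hb, hc, adjForm_congruence, adjForm_congruence, adjForm_add, adjForm_add, ← mul_sub,
    mul_div_mul_left _ _ (pow_ne_zero 2 hΔ)]
  rw [div_eq_div_iff (mul_ne_zero (pow_ne_zero 2 hΔ) hD) hD]
  have hlin' : b01' - c00' / 2 - a11' / 2 = (p * s - q * r) ^ 2 * (b01 - c00 / 2 - a11 / 2)
      - ((2 * (v0 * y0 + v1 * y1) + (a * y0 * y0 + 2 * (b * (y0 * y1)) + c * y1 * y1))
        - (u0 * z0 + u1 * z1 + (w0 * x0 + w1 * x1)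
          + (a * x0 * z0 + b * (x0 * z1 + x1 * z0) + c * x1 * z1))) := by linarith
  have hmin' : adjForm a b c v0 v1 v0 v1 = (p * s - q * r) ^ 2 *
      (adjForm a b c (a1 / 2) (c0 / 2) (a1 / 2) (c0 / 2)
        - adjForm a b c (a0 / 2) (b0 - a1 / 2) (b1 - c0 / 2) (c1 / 2))
      + adjForm a b c u0 u1 w0 w1 := by linarith
  rw [hlin', hmin']
  generalize adjForm a b c u0 u1 w0 w1 = X
  generalize adjForm a b c (a1 / 2) (c0 / 2) (a1 / 2) (c0 / 2) = Y
  generalize adjForm a b c (a0 / 2) (b0 - a1 / 2) (b1 - c0 / 2) (c1 / 2) = Z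
  field_simp
  ring

namespace PullbackNear

variable {M M' : Plane → Matrix (Fin 2) (Fin 2) ℝ} {θ : Plane → Plane} {v : Plane}

lemma jac_ne_zero (h : PullbackNear M M' θ v) :
    partialWithin ℍ₂ 0 (fun z => θ z 0) v * partialWithin ℍ₂ 1 (fun z => θ z 1) v
      - partialWithin ℍ₂ 0 (fun z => θ z 1) v * partialWithin ℍ₂ 1 (fun z => θ z 0) v ≠ 0 := by
  intro h0
  apply h.pull.det
  rw [h.pull.det_eq]
  simp only [h.eq_at, Fin.sum_univ_two, h.base.symm_at]
  linear_combination (M (θ v) 0 0 * M (θ v) 1 1 - M (θ v) 0 1 ^ 2) *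
    (partialWithin ℍ₂ 0 (fun z => θ z 0) v * partialWithin ℍ₂ 1 (fun z => θ z 1) v
      - partialWithin ℍ₂ 0 (fun z => θ z 1) v * partialWithin ℍ₂ 1 (fun z => θ z 0) v) * h0

/-- The Gaussian curvature does not depend on the coordinates. -/
theorem coordCurvature_eq (h : PullbackNear M M' θ v) :
    coordCurvature ℍ₂ M' v = coordCurvature ℍ₂ M (θ v) := by
  have hd := h.base.det
  rw [h.base.det_eq] at hd
  -- The partial derivatives of `θ` and `M` are brought to a common order.
  have c1 := fun k => (h.smooth.apply k).partial_comm h.pull.mem 1 0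
  have c2 : ∀ k, partialWithin ℍ₂ 0 (partialWithin ℍ₂ 1 (partialWithin ℍ₂ 0 (fun z => θ z k))) v
      = partialWithin ℍ₂ 0 (partialWithin ℍ₂ 0 (partialWithin ℍ₂ 1 (fun z => θ z k))) v := by
    intro k
    refine (h.hasPartial_jac₂ 0 0 1 k).congr ?_ |>.eq
    filter_upwards [h.eventually] with w hw
    exact (hw.smooth.apply k).partial_comm hw.pull.mem 1 0
  have c3 : ∀ k, partialWithin ℍ₂ 1 (partialWithin ℍ₂ 1 (partialWithin ℍ₂ 0 (fun z => θ z k))) v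
      = partialWithin ℍ₂ 0 (partialWithin ℍ₂ 1 (partialWithin ℍ₂ 1 (fun z => θ z k))) v := by
    intro k
    rw [((h.smooth.apply k).partial_ 1).partial_comm h.pull.mem 0 1]
    refine (h.hasPartial_jac₂ 1 0 1 k).congr ?_ |>.eq
    filter_upwards [h.eventually] with w hw
    exact (hw.smooth.apply k).partial_comm hw.pull.mem 1 0
  have m1 := fun k l => (h.base.smooth k l).partial_comm h.base.mem 1 0
  have s0 := h.base.partial_symm 0
  have s1 := h.base.partial_symm 1
  have s2 : ∀ d c, partialWithin ℍ₂ d (partialWithin ℍ₂ c (fun w => M w 1 0)) (θ v)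
      = partialWithin ℍ₂ d (partialWithin ℍ₂ c (fun w => M w 0 1)) (θ v) := by
    intro d c
    refine (((h.base.smooth 0 1).partial_ c).hasPartial h.base.mem d).congr ?_ |>.eq
    filter_upwards [h.base.eventually] with w hw using hw.partial_symm c
  rw [h.pull.coordCurvature_eq, h.base.coordCurvature_eq]
  refine curvOfJet_pullback _ _ _ _ _ _ _ _ _
    (partialWithin ℍ₂ 0 (partialWithin ℍ₂ 0 (fun w => M w 0 0)) (θ v))
    (partialWithin ℍ₂ 0 (partialWithin ℍ₂ 1 (fun w => M w 0 0)) (θ v)) _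
    (partialWithin ℍ₂ 0 (partialWithin ℍ₂ 0 (fun w => M w 0 1)) (θ v)) _
    (partialWithin ℍ₂ 1 (partialWithin ℍ₂ 1 (fun w => M w 0 1)) (θ v)) _
    (partialWithin ℍ₂ 0 (partialWithin ℍ₂ 1 (fun w => M w 1 1)) (θ v))
    (partialWithin ℍ₂ 1 (partialWithin ℍ₂ 1 (fun w => M w 1 1)) (θ v))
    (partialWithin ℍ₂ 0 (fun z => θ z 0) v) (partialWithin ℍ₂ 0 (fun z => θ z 1) v)
    (partialWithin ℍ₂ 1 (fun z => θ z 0) v) (partialWithin ℍ₂ 1 (fun z => θ z 1) v)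
    (partialWithin ℍ₂ 0 (partialWithin ℍ₂ 0 (fun z => θ z 0)) v)
    (partialWithin ℍ₂ 0 (partialWithin ℍ₂ 0 (fun z => θ z 1)) v)
    (partialWithin ℍ₂ 0 (partialWithin ℍ₂ 1 (fun z => θ z 0)) v)
    (partialWithin ℍ₂ 0 (partialWithin ℍ₂ 1 (fun z => θ z 1)) v)
    (partialWithin ℍ₂ 1 (partialWithin ℍ₂ 1 (fun z => θ z 0)) v)
    (partialWithin ℍ₂ 1 (partialWithin ℍ₂ 1 (fun z => θ z 1)) v)
    (partialWithin ℍ₂ 0 (partialWithin ℍ₂ 0 (partialWithin ℍ₂ 1 (fun z => θ z 0))) v)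
    (partialWithin ℍ₂ 0 (partialWithin ℍ₂ 0 (partialWithin ℍ₂ 1 (fun z => θ z 1))) v)
    (partialWithin ℍ₂ 0 (partialWithin ℍ₂ 1 (partialWithin ℍ₂ 1 (fun z => θ z 0))) v)
    (partialWithin ℍ₂ 0 (partialWithin ℍ₂ 1 (partialWithin ℍ₂ 1 (fun z => θ z 1))) v)
    _ _ _ _ _ _ _ _ _ _ _ _ hd h.jac_ne_zero ?_ ?_ ?_ ?_ ?_ ?_ ?_ ?_ ?_ ?_ ?_ ?_
  · simp only [h.eq_at, Fin.sum_univ_two, h.base.symm_at]; ring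
  · simp only [h.eq_at, Fin.sum_univ_two, h.base.symm_at]; ring
  · simp only [h.eq_at, Fin.sum_univ_two, h.base.symm_at]; ring
  · simp only [h.partial_eq, Fin.sum_univ_two, h.base.symm_at, s0, s1]; ring
  · simp only [h.partial_eq, Fin.sum_univ_two, h.base.symm_at, s0, s1, c1]; ring
  · simp only [h.partial_eq, Fin.sum_univ_two, h.base.symm_at, s0, s1]; ring
  · simp only [h.partial_eq, Fin.sum_univ_two, h.base.symm_at, s0, s1, c1]; ring
  · simp only [h.partial_eq, Fin.sum_univ_two, h.base.symm_at, s0, s1]; ring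
  · simp only [h.partial_eq, Fin.sum_univ_two, h.base.symm_at, s0, s1]; ring
  · simp only [h.partial_partial_eq, Fin.sum_univ_two, h.base.symm_at, s0, s1, s2, c1, c2, m1]
    ring
  · simp only [h.partial_partial_eq, Fin.sum_univ_two, h.base.symm_at, s0, s1, s2, m1]
    ring
  · simp only [h.partial_partial_eq, Fin.sum_univ_two, h.base.symm_at, s0, s1, s2, c1, c3, m1]
    ring

/-- A coordinate change which preserves the boundary to second order in the tangential direction
preserves the vanishing of the normal part of `∇_∂₁ ∂₁`. -/
theorem christoffel_boundary (h : PullbackNear M M' θ v)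
    (h1 : partialWithin ℍ₂ 1 (fun z => θ z 0) v = 0)
    (h2 : partialWithin ℍ₂ 1 (partialWithin ℍ₂ 1 (fun z => θ z 0)) v = 0)
    (hΓ : christoffel ℍ₂ M 0 1 1 (θ v) = 0) : christoffel ℍ₂ M' 0 1 1 v = 0 := by
  have c1 := fun k => (h.smooth.apply k).partial_comm h.pull.mem 1 0
  have s0 := h.base.partial_symm 0
  have s1 := h.base.partial_symm 1
  rw [h.base.christoffel_eq] at hΓ
  rw [h.pull.christoffel_eq]
  simp only [if_true, mul_eq_zero, inv_eq_zero, h.base.det, h.pull.det, or_false] at hΓ ⊢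
  simp only [christoffelLow, s1] at hΓ
  simp only [christoffelLow, h.partial_eq, h.eq_at, Fin.sum_univ_two, h.base.symm_at, s0, s1, c1,
    h1, h2]
  linear_combination (partialWithin ℍ₂ 1 (fun z => θ z 1) v ^ 4
    * partialWithin ℍ₂ 0 (fun z => θ z 0) v) * hΓ

end PullbackNear

/-! ### Taylor expansion at the boundary of the half-plane -/

/-- The point of the plane with coordinates `y` (normal to the boundary) and `x` (along the
boundary). -/
def pt (y x : ℝ) : Plane := !₂[y, x]

@[simp] lemma pt_apply_zero (y x : ℝ) : pt y x 0 = y := rfl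
@[simp] lemma pt_apply_one (y x : ℝ) : pt y x 1 = x := rfl

lemma pt_eta (v : Plane) : pt (v 0) (v 1) = v := by
  ext i; fin_cases i <;> rfl

lemma pt_mem_half {y x : ℝ} : pt y x ∈ ℍ₂ ↔ 0 ≤ y := mem_half

lemma pt_eq (y x : ℝ) : pt y x = y • stdVec 0 + x • stdVec 1 := plane_eq_sum (pt y x)

lemma contDiff_pt {n : WithTop ℕ∞} {E : Type*} [NormedAddCommGroup E] [NormedSpace ℝ E]
    {f g : E → ℝ} (hf : ContDiff ℝ n f) (hg : ContDiff ℝ n g) :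
    ContDiff ℝ n (fun z => pt (f z) (g z)) := by
  simp only [pt_eq]
  exact (hf.smul contDiff_const).add (hg.smul contDiff_const)

lemma continuous_pt {E : Type*} [TopologicalSpace E] {f g : E → ℝ} (hf : Continuous f)
    (hg : Continuous g) : Continuous (fun z => pt (f z) (g z)) := by
  simp only [pt_eq]
  exact (hf.smul continuous_const).add (hg.smul continuous_const)

lemma contDiff_coord {n : WithTop ℕ∞} (i : Fin 2) : ContDiff ℝ n (fun v : Plane => v i) :=
  (EuclideanSpace.proj i : Plane →L[ℝ] ℝ).contDiff

lemma continuous_coord (i : Fin 2) : Continuous (fun v : Plane => v i) :=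
  (EuclideanSpace.proj i : Plane →L[ℝ] ℝ).continuous

lemma dist_pt (v : Plane) (hv : 0 ≤ v 0) : dist v (pt 0 (v 1)) = v 0 := by
  rw [EuclideanSpace.dist_eq]
  simp [Fin.sum_univ_two, Real.dist_eq, Real.sqrt_sq_eq_abs, abs_of_nonneg hv]

lemma hasDerivWithinAt_normal {f : Plane → ℝ} {y x : ℝ}
    (hf : DifferentiableWithinAt ℝ f ℍ₂ (pt y x)) :
    HasDerivWithinAt (fun t => f (pt t x)) (partialWithin ℍ₂ 0 f (pt y x)) (Ici 0) y := by
  have h : HasDerivWithinAt (fun t => pt t x) (stdVec 0) (Ici 0) y := by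
    simp only [pt_eq]
    simpa using (((hasDerivAt_id y).smul_const (stdVec 0)).add_const (x • stdVec
        1)).hasDerivWithinAt
  exact hf.hasFDerivWithinAt.comp_hasDerivWithinAt y h fun t ht => pt_mem_half.2 ht

lemma hasDerivAt_tangential {f : Plane → ℝ} {x : ℝ}
    (hf : DifferentiableWithinAt ℝ f ℍ₂ (pt 0 x)) :
    HasDerivAt (fun t => f (pt 0 t)) (partialWithin ℍ₂ 1 f (pt 0 x)) x := by
  have h : HasDerivWithinAt (fun t => pt 0 t) (stdVec 1) univ x := by
    have := ((hasDerivAt_id x).smul_const (stdVec 1)).const_add ((0 : ℝ) • stdVec 0)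
    rw [one_smul] at this
    simp only [pt_eq]
    exact this.hasDerivWithinAt
  exact hasDerivWithinAt_univ.1
    (hf.hasFDerivWithinAt.comp_hasDerivWithinAt x h fun t _ => pt_mem_half.2 le_rfl)

/-- A function which vanishes along the boundary has zero tangential derivative there. -/
lemma partial_one_eq_zero {f : Plane → ℝ} {x : ℝ}
    (hf : DifferentiableWithinAt ℝ f ℍ₂ (pt 0 x)) (h0 : ∀ᶠ t in 𝓝 x, f (pt 0 t) = 0) :
    partialWithin ℍ₂ 1 f (pt 0 x) = 0 :=
  (hasDerivAt_tangential hf).unique ((hasDerivAt_const x (0 : ℝ)).congr_of_eventuallyEq h0)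

lemma HasPartial.of_coord {i k : Fin 2} {φ : ℝ → ℝ} {v : Plane} (hv : v ∈ ℍ₂)
    (hφ : DifferentiableAt ℝ φ (v k)) :
    HasPartial i (fun w => φ (w k)) (if i = k then deriv φ (v k) else 0) v := by
  have hc := (EuclideanSpace.proj k : Plane →L[ℝ] ℝ).hasFDerivAt (x := v)
  have h : HasFDerivAt (fun w : Plane => φ (w k)) _ v := hφ.hasDerivAt.hasFDerivAt.comp v hc
  refine ⟨hv, h.differentiableAt.differentiableWithinAt, ?_⟩
  rw [partialWithin, h.hasFDerivWithinAt.fderivWithin (uniqueDiffOn_half v hv)]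
  by_cases e : i = k
  · simp [stdVec, e]
  · simp [stdVec, e, Ne.symm e]

/-- The points of the half-plane over `K` at height at most `δ`. -/
def strip (K : Set ℝ) (δ : ℝ) : Set Plane := {v | 0 ≤ v 0 ∧ v 0 ≤ δ ∧ v 1 ∈ K}

lemma strip_mono {K : Set ℝ} {δ δ' : ℝ} (h : δ ≤ δ') : strip K δ ⊆ strip K δ' :=
  fun _ hv => ⟨hv.1, hv.2.1.trans h, hv.2.2⟩

lemma strip_eq (K : Set ℝ) (δ : ℝ) : strip K δ = (fun p : ℝ × ℝ => pt p.1 p.2) '' (Icc 0 δ ×ˢ K)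
    := by
  ext v
  constructor
  · intro h
    exact ⟨(v 0, v 1), ⟨⟨h.1, h.2.1⟩, h.2.2⟩, pt_eta v⟩
  · rintro ⟨p, hp, rfl⟩
    exact ⟨hp.1.1, hp.1.2, hp.2⟩

lemma isCompact_strip {K : Set ℝ} (hK : IsCompact K) (δ : ℝ) : IsCompact (strip K δ) := by
  rw [strip_eq]
  exact (isCompact_Icc.prod hK).image (continuous_pt continuous_fst continuous_snd)

lemma strip_subset_half (K : Set ℝ) (δ : ℝ) : strip K δ ⊆ ℍ₂ := fun _ hv => mem_half.2 hv.1

lemma exists_strip_subset {K : Set ℝ} (hK : IsCompact K) {B : Set Plane} (hB : IsOpen B)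
    (h : ∀ x ∈ K, pt 0 x ∈ B) : ∃ δ > 0, strip K δ ⊆ B := by
  have hc : IsCompact ((fun x => pt 0 x) '' K) :=
    hK.image (continuous_pt continuous_const continuous_id)
  obtain ⟨δ, hδ, hs⟩ := hc.exists_thickening_subset_open hB (by rintro _ ⟨x, hx, rfl⟩; exact h x hx)
  refine ⟨δ / 2, by positivity, fun v hv => hs ?_⟩
  rw [Metric.mem_thickening_iff]
  exact ⟨_, ⟨v 1, hv.2.2, rfl⟩, by rw [dist_pt v hv.1]; linarith [hv.2.1]⟩

/-- Near a compact part of the boundary, a continuous function is uniformly close to its boundary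
values. -/
lemma exists_strip_close {F : Type*} [PseudoMetricSpace F] {K : Set ℝ} (hK : IsCompact K) {δ₀ : ℝ}
    {f : Plane → F} (hf : ContinuousOn f (strip K δ₀)) (hδ₀ : 0 < δ₀) {η : ℝ} (hη : 0 < η) :
    ∃ δ > 0, δ ≤ δ₀ ∧ ∀ v ∈ strip K δ, dist (f v) (f (pt 0 (v 1))) ≤ η := by
  have hu := (isCompact_strip hK δ₀).uniformContinuousOn_of_continuous hf
  obtain ⟨δ, hδ, h⟩ := Metric.uniformContinuousOn_iff.1 hu η hη
  refine ⟨min δ₀ (δ / 2), lt_min hδ₀ (by positivity), min_le_left _ _, fun v hv => ?_⟩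
  refine (h v (strip_mono (min_le_left _ _) hv) (pt 0 (v 1)) ⟨le_rfl, hδ₀.le, hv.2.2⟩ ?_).le
  rw [dist_pt v hv.1]
  have := hv.2.1.trans (min_le_right _ _)
  linarith

lemma exists_strip_small {K : Set ℝ} (hK : IsCompact K) {δ₀ : ℝ}
    {f : Plane → ℝ} (hf : ContinuousOn f (strip K δ₀)) (hδ₀ : 0 < δ₀)
    (h0 : ∀ x ∈ K, f (pt 0 x) = 0) {η : ℝ} (hη : 0 < η) :
    ∃ δ > 0, δ ≤ δ₀ ∧ ∀ v ∈ strip K δ, |f v| ≤ η := by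
  obtain ⟨δ, hδ, h1, h⟩ := exists_strip_close hK hf hδ₀ hη
  refine ⟨δ, hδ, h1, fun v hv => ?_⟩
  have := h v hv
  rwa [h0 _ hv.2.2, dist_zero_right] at this

/-- Integration of a bound on the normal derivative from the boundary. -/
lemma abs_le_of_partial_zero {K : Set ℝ} {δ η : ℝ} {f : Plane → ℝ} (k : ℕ)
    (hf : ∀ v ∈ strip K δ, DifferentiableWithinAt ℝ f ℍ₂ v) (h0 : ∀ x ∈ K, f (pt 0 x) = 0)
    (hη : 0 ≤ η) (h : ∀ v ∈ strip K δ, |partialWithin ℍ₂ 0 f v| ≤ η * v 0 ^ k) :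
    ∀ v ∈ strip K δ, |f v| ≤ η * v 0 ^ (k + 1) := by
  intro v hv
  have hm : ∀ t ∈ Icc 0 (v 0), pt t (v 1) ∈ strip K δ := fun t ht =>
    ⟨ht.1, ht.2.trans hv.2.1, hv.2.2⟩
  have := norm_image_sub_le_of_norm_deriv_le_segment' (f := fun t => f (pt t (v 1)))
    (f' := fun t => partialWithin ℍ₂ 0 f (pt t (v 1))) (a := 0) (b := v 0) (C := η * v 0 ^ k)
    (fun t ht => (hasDerivWithinAt_normal (hf _ (hm t ht))).mono Icc_subset_Ici_self)
    (fun t ht => (h _ (hm t (Ico_subset_Icc_self ht))).trans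
      (mul_le_mul_of_nonneg_left (pow_le_pow_left₀ ht.1 ht.2.le k) hη))
    (v 0) ⟨hv.1, le_rfl⟩
  simp only [h0 _ hv.2.2, sub_zero, pt_eta, Real.norm_eq_abs] at this
  rw [pow_succ, ← mul_assoc]
  exact this

/-! ### Continuity of the curvature -/

/-- The curvature as a function on the space of jets; the entry `3` is the derivative `∂₀ M₀₀`. -/
def curvJ (j : Fin 12 → ℝ) : ℝ :=
  curvOfJet (j 0) (j 1) (j 2) (j 3) (j 4) (j 5) (j 6) (j 7) (j 8) (j 9) (j 10) (j 11)

/-- The second order jet of a metric, without the derivatives that do not enter the curvature. -/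
def jetOf (M : Plane → Matrix (Fin 2) (Fin 2) ℝ) (v : Plane) : Fin 12 → ℝ :=
  ![M v 0 0, M v 0 1, M v 1 1,
    partialWithin ℍ₂ 0 (fun w => M w 0 0) v, partialWithin ℍ₂ 1 (fun w => M w 0 0) v,
    partialWithin ℍ₂ 0 (fun w => M w 0 1) v, partialWithin ℍ₂ 1 (fun w => M w 0 1) v,
    partialWithin ℍ₂ 0 (fun w => M w 1 1) v, partialWithin ℍ₂ 1 (fun w => M w 1 1) v,
    partialWithin ℍ₂ 0 (partialWithin ℍ₂ 1 (fun w => M w 0 1)) v,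
    partialWithin ℍ₂ 0 (partialWithin ℍ₂ 0 (fun w => M w 1 1)) v,
    partialWithin ℍ₂ 1 (partialWithin ℍ₂ 1 (fun w => M w 0 0)) v]

lemma MetricNear.coordCurvature_eq_curvJ {M : Plane → Matrix (Fin 2) (Fin 2) ℝ} {v : Plane}
    (h : MetricNear M v) : coordCurvature ℍ₂ M v = curvJ (jetOf M v) := h.coordCurvature_eq

lemma continuousAt_curvJ {j : Fin 12 → ℝ} (h : j 0 * j 2 - j 1 ^ 2 ≠ 0) : ContinuousAt curvJ j := by
  unfold curvJ curvOfJet adjForm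
  have hc : ∀ k, ContinuousAt (fun j : Fin 12 → ℝ => j k) j := fun k => (continuous_apply
      k).continuousAt
  refine ContinuousAt.div (ContinuousAt.add (by fun_prop) (ContinuousAt.div (by fun_prop) (by
      fun_prop) h))
    (by fun_prop) h

/-- At the jets of metrics for which the boundary is geodesic, the curvature does not depend on
`∂₀ M₀₀`. Hence it is stable under perturbations of the jet which are small except for this
entry. -/
lemma exists_curvJ_close {K : Set (Fin 12 → ℝ)} (hK : IsCompact K)
    (h : ∀ j ∈ K, j 0 * j 2 - j 1 ^ 2 ≠ 0 ∧ j 1 = 0 ∧ j 6 = 0 ∧ j 7 = 0) (A : ℝ) {ε : ℝ}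
    (hε : 0 < ε) : ∃ η > 0, ∀ j ∈ K, ∀ d d' : Fin 12 → ℝ, ∀ t : ℝ, ‖d‖ ≤ η → ‖d'‖ ≤ η → |t| ≤ A →
      |curvJ (j + d + d' + Pi.single 3 t) - curvJ (j + d)| ≤ ε := by
  have hind : ∀ j ∈ K, ∀ t, curvJ (j + Pi.single 3 t) = curvJ j := by
    intro j hj t
    obtain ⟨-, h1, h6, h7⟩ := h j hj
    have e : ∀ k : Fin 12, k ≠ 3 → (j + Pi.single 3 t : Fin 12 → ℝ) k = j k := fun k hk => by
      simp [hk]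
    unfold curvJ
    rw [e 0 (by decide), e 1 (by decide), e 2 (by decide), e 4 (by decide), e 5 (by decide),
      e 6 (by decide), e 7 (by decide), e 8 (by decide), e 9 (by decide), e 10 (by decide),
      e 11 (by decide)]
    simp only [curvOfJet, adjForm, h1, h6, h7]
    ring
  -- On the compact set `K'` of jets obtained by changing the entry `3` by at most `A`, continuity
  -- is uniform; both jets are compared with jets of `K'` that differ only in this entry.
  set K' : Set (Fin 12 → ℝ) := (fun p : (Fin 12 → ℝ) × ℝ => p.1 + Pi.single 3 p.2) ''
    (K ×ˢ Icc (-|A|) |A|) with hK'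
  have hK'c : IsCompact K' := (hK.prod isCompact_Icc).image (continuous_fst.add
    ((continuous_single (3 : Fin 12)).comp continuous_snd))
  have hcont : ∀ j ∈ K', ContinuousAt curvJ j := by
    rintro _ ⟨⟨j, t⟩, ⟨hj, -⟩, rfl⟩
    apply continuousAt_curvJ
    have := (h j hj).1
    simpa using this
  have hu := hK'c.uniformContinuousAt_of_continuousAt curvJ hcont
    (Metric.dist_mem_uniformity (half_pos hε))
  obtain ⟨η, hη, hη'⟩ := Metric.mem_uniformity_dist.1 hu
  have hη'' : ∀ a b, a ∈ K' → dist a b < η → dist (curvJ a) (curvJ b) < ε / 2 :=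
    fun a b ha hab => hη' hab ha
  have hmem : ∀ j ∈ K, ∀ t, |t| ≤ A → j + Pi.single 3 t ∈ K' := fun j hj t ht =>
    ⟨(j, t), ⟨hj, abs_le.1 (ht.trans (le_abs_self A))⟩, rfl⟩
  have hmem0 : ∀ j ∈ K, j ∈ K' := fun j hj => ⟨(j, 0), ⟨hj, by simp⟩, by
    change j + Pi.single 3 0 = j
    rw [Pi.single_zero, add_zero]⟩
  refine ⟨η / 3, by positivity, fun j hj d d' t hd hd' ht => ?_⟩
  have h1 : dist (curvJ (j + Pi.single 3 t)) (curvJ (j + d + d' + Pi.single 3 t)) < ε / 2 := by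
    refine hη'' _ _ (hmem j hj t ht) ?_
    rw [dist_eq_norm]
    have : j + Pi.single 3 t - (j + d + d' + Pi.single 3 t) = -(d + d') := by abel
    rw [this, norm_neg]
    exact (norm_add_le _ _).trans_lt (by linarith)
  have h2 : dist (curvJ j) (curvJ (j + d)) < ε / 2 := by
    refine hη'' _ _ (hmem0 j hj) ?_
    rw [dist_eq_norm]
    have : j - (j + d) = -d := by abel
    rw [this, norm_neg]
    linarith
  rw [hind j hj, Real.dist_eq] at h1
  rw [Real.dist_eq] at h2
  rw [abs_lt] at h1 h2
  rw [abs_le]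
  constructor <;> linarith [h1.1, h1.2, h2.1, h2.2]

/-! ### Making a metric even near a part of the boundary -/

/-- A smooth cutoff function of one variable, with bounded derivatives. -/
lemma exists_cutoff {C U : Set ℝ} (hC : IsCompact C) (hU : IsOpen U) (hCU : C ⊆ U) :
    ∃ χ : ℝ → ℝ, ContDiff ℝ ∞ χ ∧ (∀ x ∈ C, ∀ᶠ t in 𝓝 x, χ t = 1) ∧ IsCompact (tsupport χ) ∧
      tsupport χ ⊆ U ∧ ∃ c ≥ 1, ∀ x, |χ x| ≤ c ∧ |deriv χ x| ≤ c ∧ |deriv (deriv χ) x| ≤ c := by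
  obtain ⟨t, ht, hCt, htU⟩ := exists_compact_between hC hU hCU
  obtain ⟨f, h1, h0, -⟩ := exists_contMDiffMap_one_nhds_of_subset_interior (n := (⊤ : ℕ∞)) 𝓘(ℝ, ℝ)
    hC.isClosed hCt
  have hts : tsupport f ⊆ t := closure_minimal (fun x hx => by
    by_contra h; exact hx (h0 x h)) ht.isClosed
  have hcs : HasCompactSupport (f : ℝ → ℝ) := ht.of_isClosed_subset (isClosed_tsupport _) hts
  have hf : ContDiff ℝ ∞ (f : ℝ → ℝ) := contMDiff_iff_contDiff.1 f.contMDiff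
  have hf1 : ContDiff ℝ ∞ (deriv (f : ℝ → ℝ)) := (contDiff_infty_iff_deriv.1 hf).2
  have hf2 : ContDiff ℝ ∞ (deriv (deriv (f : ℝ → ℝ))) := (contDiff_infty_iff_deriv.1 hf1).2
  obtain ⟨c0, b0⟩ := hf.continuous.bounded_above_of_compact_support hcs
  obtain ⟨c1, b1⟩ := hf1.continuous.bounded_above_of_compact_support hcs.deriv
  obtain ⟨c2, b2⟩ := hf2.continuous.bounded_above_of_compact_support hcs.deriv.deriv
  refine ⟨f, hf, fun x hx => ?_, hcs, hts.trans htU, max 1 (max c0 (max c1 c2)), le_max_left _ _,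
    fun x => ⟨(b0 x).trans ?_, (b1 x).trans ?_, (b2 x).trans ?_⟩⟩
  · exact (mem_nhdsSet_iff_forall.1 h1) x hx
  all_goals simp

/-- The reflection of the plane onto the half-plane. -/
def foldPt (v : Plane) : Plane := pt |v 0| (v 1)

/-- The side of the boundary line on which a point of the plane lies. -/
def side (v : Plane) : ℝ := if 0 ≤ v 0 then 1 else -1

lemma side_mul_abs (v : Plane) : side v * |v 0| = v 0 := by
  unfold side
  split_ifs with h
  · rw [abs_of_nonneg h, one_mul]
  · rw [abs_of_neg (not_le.1 h)]; ring

lemma continuous_foldPt : Continuous foldPt :=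
  continuous_pt (continuous_coord 0).abs (continuous_coord 1)

@[simp] lemma foldPt_bdry (x : ℝ) : foldPt (pt 0 x) = pt 0 x := by simp [foldPt]

lemma foldPt_of_nonneg {v : Plane} (h : 0 ≤ v 0) : foldPt v = v := by
  rw [foldPt, abs_of_nonneg h, pt_eta]

lemma foldPt_mem (v : Plane) : foldPt v ∈ ℍ₂ := mem_half.2 (abs_nonneg (v 0))

/-- The extension of the metric `M` on the half-plane to the plane, for which the reflection in the
boundary line is an isometry, is smooth at `v`. -/
def EvenAt (M : Plane → Matrix (Fin 2) (Fin 2) ℝ) (v : Plane) : Prop :=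
  ContDiffAt ℝ ∞ (fun w => M (foldPt w) 0 0) v ∧
  ContDiffAt ℝ ∞ (fun w => side w * M (foldPt w) 0 1) v ∧
  ContDiffAt ℝ ∞ (fun w => M (foldPt w) 1 1) v

/-- The set `B` is open, and `M` is a metric on the part of `B` in the half-plane, which is the
identity matrix along the boundary and for which the boundary is geodesic. -/
structure GeodesicChart (M : Plane → Matrix (Fin 2) (Fin 2) ℝ) (B : Set Plane) : Prop where
  isOpen : IsOpen B
  metric : ∀ v ∈ ℍ₂ ∩ B, MetricNear M v
  bdry : ∀ x, pt 0 x ∈ B → M (pt 0 x) = 1 ∧ partialWithin ℍ₂ 0 (fun w => M w 1 1) (pt 0 x) = 0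

/-- The difference between a metric and the even part of its Taylor expansion at the boundary. -/
def resid (M : Plane → Matrix (Fin 2) (Fin 2) ℝ) (v : Plane) : Matrix (Fin 2) (Fin 2) ℝ :=
  !![M v 0 0 - 1, M v 0 1 - v 0 * partialWithin ℍ₂ 0 (fun w => M w 0 1) (pt 0 (v 1));
    M v 0 1 - v 0 * partialWithin ℍ₂ 0 (fun w => M w 0 1) (pt 0 (v 1)),
    M v 1 1 - (1 + v 0 * v 0 * (1 / 2 *
      partialWithin ℍ₂ 0 (partialWithin ℍ₂ 0 (fun w => M w 1 1)) (pt 0 (v 1))))]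

lemma SmoothNear.trace {f : Plane → ℝ} {v : Plane} (hf : SmoothNear f (pt 0 (v 1)))
    (hv : v ∈ ℍ₂) : SmoothNear (fun w => f (pt 0 (w 1))) v :=
  SmoothNear.comp (θ := fun w => pt 0 (w 1)) hf
    (.of_contDiff (contDiff_pt contDiff_const (contDiff_coord 1))) hv
    (Filter.Eventually.of_forall fun _ => pt_mem_half.2 le_rfl)

lemma HasPartial.trace {f : Plane → ℝ} {v : Plane} (hf : SmoothNear f (pt 0 (v 1)))
    (hv : v ∈ ℍ₂) : HasPartial 0 (fun w => f (pt 0 (w 1))) 0 v := by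
  have hp : ContDiff ℝ ∞ (fun w : Plane => pt 0 (w 1)) := contDiff_pt contDiff_const
      (contDiff_coord 1)
  have h := HasPartial.comp (i := 0) (θ := fun w => pt 0 (w 1)) (hf.diff (pt_mem_half.2 le_rfl))
    ((hp.differentiable (by simp)).differentiableAt.differentiableWithinAt) hv
    (Filter.Eventually.of_forall fun _ => pt_mem_half.2 le_rfl)
  refine h.of_eq ?_
  have h0 : partialWithin ℍ₂ 0 (fun w => pt 0 (w 1) 0) v = 0 := (HasPartial.const hv 0).eq
  have h1 : partialWithin ℍ₂ 0 (fun w => pt 0 (w 1) 1) v = 0 := by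
    simpa using (HasPartial.coord (i := 0) hv 1).eq
  rw [h0, h1]; ring

/-- The restriction of a smooth function to the boundary, extended to the plane as a function which
is constant in the normal direction, is smooth. -/
lemma SmoothNear.contDiffAt_trace {f : Plane → ℝ} {v : Plane} (hf : SmoothNear f (pt 0 (v 1))) :
    ContDiffAt ℝ ∞ (fun w : Plane => f (pt 0 (w 1))) v := by
  have h := hf.self (pt_mem_half.2 le_rfl)
  have hp : ContDiff ℝ ∞ (fun w : Plane => pt 0 (w 1)) := contDiff_pt contDiff_const
      (contDiff_coord 1)
  rw [← contDiffWithinAt_univ]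
  exact h.comp v (t := ℍ₂) hp.contDiffAt.contDiffWithinAt fun w _ => pt_mem_half.2 le_rfl

namespace GeodesicChart

variable {M : Plane → Matrix (Fin 2) (Fin 2) ℝ} {B : Set Plane}

lemma metric_bdry (h : GeodesicChart M B) {x : ℝ} (hx : pt 0 x ∈ B) : MetricNear M (pt 0 x) :=
  h.metric _ ⟨pt_mem_half.2 le_rfl, hx⟩

lemma isOpen_trace (h : GeodesicChart M B) : IsOpen {x : ℝ | pt 0 x ∈ B} :=
  h.isOpen.preimage (continuous_pt continuous_const continuous_id)

lemma resid_smooth (h : GeodesicChart M B) {v : Plane} (hv : v ∈ ℍ₂ ∩ B) (hb : pt 0 (v 1) ∈ B) :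
    SmoothNear (fun w => resid M w 0 0) v ∧ SmoothNear (fun w => resid M w 0 1) v ∧
      SmoothNear (fun w => resid M w 1 1) v := by
  have hm := (h.metric v hv).smooth
  have hb' := (h.metric_bdry hb).smooth
  refine ⟨(hm 0 0).sub (.const 1), (hm 0 1).sub ((SmoothNear.coord 0).mul ?_),
    (hm 1 1).sub ((SmoothNear.const 1).add (((SmoothNear.coord 0).mul (.coord 0)).mul
      ((SmoothNear.const _).mul ?_)))⟩
  · exact ((hb' 0 1).partial_ 0).trace hv.1
  · exact (((hb' 1 1).partial_ 0).partial_ 0).trace hv.1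

lemma resid_bdry (h : GeodesicChart M B) {x : ℝ} (hx : pt 0 x ∈ B) :
    resid M (pt 0 x) = 0 := by
  ext i j; fin_cases i <;> fin_cases j <;> simp [resid, (h.bdry x hx).1]

lemma resid_normal_zero_one (h : GeodesicChart M B) {x : ℝ} (hx : pt 0 x ∈ B) :
    partialWithin ℍ₂ 0 (fun w => resid M w 0 1) (pt 0 x) = 0 := by
  have hm := h.metric_bdry hx
  have := ((hm.smooth 0 1).hasPartial hm.mem 0).sub ((HasPartial.coord hm.mem 0).mul
    (HasPartial.trace ((hm.smooth 0 1).partial_ 0) hm.mem))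
  exact (this.of_eq (by simp)).eq

lemma resid_normal_one_one (h : GeodesicChart M B) {v : Plane} (hv : v ∈ ℍ₂ ∩ B)
    (hb : pt 0 (v 1) ∈ B) : partialWithin ℍ₂ 0 (fun w => resid M w 1 1) v
      = partialWithin ℍ₂ 0 (fun w => M w 1 1) v
        - v 0 * partialWithin ℍ₂ 0 (partialWithin ℍ₂ 0 (fun w => M w 1 1)) (pt 0 (v 1)) := by
  have hm := h.metric v hv
  have := ((hm.smooth 1 1).hasPartial hm.mem 0).sub ((HasPartial.const hm.mem 1).add
    (((HasPartial.coord hm.mem 0).mul (HasPartial.coord hm.mem 0)).mul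
    ((HasPartial.trace ((((h.metric_bdry hb).smooth 1 1).partial_ 0).partial_ 0) hm.mem).const_mul
      (1 / 2))))
  refine (this.of_eq ?_).eq
  simp; ring

lemma resid_normal_one_one_bdry (h : GeodesicChart M B) {x : ℝ} (hx : pt 0 x ∈ B) :
    partialWithin ℍ₂ 0 (fun w => resid M w 1 1) (pt 0 x) = 0 := by
  rw [h.resid_normal_one_one ⟨pt_mem_half.2 le_rfl, hx⟩ hx, (h.bdry x hx).2]; simp

lemma resid_normal₂_one_one (h : GeodesicChart M B) {x : ℝ} (hx : pt 0 x ∈ B) :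
    partialWithin ℍ₂ 0 (partialWithin ℍ₂ 0 (fun w => resid M w 1 1)) (pt 0 x) = 0 := by
  have hm := h.metric_bdry hx
  have h2 := (((hm.smooth 1 1).partial_ 0).hasPartial hm.mem 0).sub ((HasPartial.coord hm.mem 0).mul
    (HasPartial.trace (((hm.smooth 1 1).partial_ 0).partial_ 0) hm.mem))
  refine ((h2.of_eq (by simp)).congr ?_).eq
  have hB := h.isOpen.inter (h.isOpen_trace.preimage (continuous_coord 1))
  filter_upwards [self_mem_nhdsWithin, mem_nhdsWithin_of_mem_nhds (hB.mem_nhds ⟨hx, hx⟩)] with w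
      hw hw'
  exact h.resid_normal_one_one ⟨hw, hw'.1⟩ hw'.2

end GeodesicChart

/-- The correction of a metric: the residue of the Taylor expansion, cut off outside a small
neighbourhood of a part of the boundary. -/
def corr (χ ζ : ℝ → ℝ) (δ : ℝ) (M : Plane → Matrix (Fin 2) (Fin 2) ℝ) (v : Plane) :
    Matrix (Fin 2) (Fin 2) ℝ := (χ (v 1) * ζ (v 0 / δ)) • resid M v

section Partials

variable {χ ζ : ℝ → ℝ} {δ : ℝ} {v : Plane} {r : Plane → ℝ}

lemma hasPartial_chi (hχ : ContDiff ℝ ∞ χ) (hv : v ∈ ℍ₂) (i : Fin 2) :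
    HasPartial i (fun w => χ (w 1)) (if i = 1 then deriv χ (v 1) else 0) v :=
  HasPartial.of_coord hv ((hχ.differentiable (by simp)).differentiableAt)

lemma hasPartial_zeta (hζ : ContDiff ℝ ∞ ζ) (hv : v ∈ ℍ₂) (i : Fin 2) :
    HasPartial i (fun w => ζ (w 0 / δ)) (if i = 0 then deriv ζ (v 0 / δ) / δ else 0) v := by
  have hd : HasDerivAt (fun t => ζ (t / δ)) (deriv ζ (v 0 / δ) / δ) (v 0) := by
    have h1 : HasDerivAt (fun t : ℝ => t / δ) (1 / δ) (v 0) := (hasDerivAt_id (v 0)).div_const δ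
    have h2 := ((hζ.differentiable (by simp)).differentiableAt (x := v 0 / δ)).hasDerivAt
    exact (HasDerivAt.comp (v 0) h2 h1).congr_deriv (by ring)
  have := HasPartial.of_coord (i := i) (k := 0) (φ := fun t => ζ (t / δ)) hv hd.differentiableAt
  rwa [hd.deriv] at this

lemma hasPartial_cut_zero (hχ : ContDiff ℝ ∞ χ) (hζ : ContDiff ℝ ∞ ζ) (hr : SmoothNear r v)
    (hv : v ∈ ℍ₂) : HasPartial 0 (fun w => χ (w 1) * ζ (w 0 / δ) * r w)
      (χ (v 1) * (deriv ζ (v 0 / δ) / δ) * r v + χ (v 1) * ζ (v 0 / δ) * partialWithin ℍ₂ 0 r v)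
      v :=
  ((((hasPartial_chi hχ hv 0).mul (hasPartial_zeta hζ hv 0))).mul (hr.hasPartial hv 0)).of_eq
    (by simp)

lemma hasPartial_cut_one (hχ : ContDiff ℝ ∞ χ) (hζ : ContDiff ℝ ∞ ζ) (hr : SmoothNear r v)
    (hv : v ∈ ℍ₂) : HasPartial 1 (fun w => χ (w 1) * ζ (w 0 / δ) * r w)
      (deriv χ (v 1) * ζ (v 0 / δ) * r v + χ (v 1) * ζ (v 0 / δ) * partialWithin ℍ₂ 1 r v)
      v :=
  ((((hasPartial_chi hχ hv 1).mul (hasPartial_zeta hζ hv 1))).mul (hr.hasPartial hv 1)).of_eq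
    (by simp)

lemma contDiff_deriv (hχ : ContDiff ℝ ∞ χ) : ContDiff ℝ ∞ (deriv χ) :=
  (contDiff_infty_iff_deriv.1 hχ).2

lemma hasPartial_cut_zero_one (hχ : ContDiff ℝ ∞ χ) (hζ : ContDiff ℝ ∞ ζ) (hr : SmoothNear r v)
    (hv : v ∈ ℍ₂) : HasPartial 0 (partialWithin ℍ₂ 1 (fun w => χ (w 1) * ζ (w 0 / δ) * r w))
      (deriv χ (v 1) * (deriv ζ (v 0 / δ) / δ) * r v
        + deriv χ (v 1) * ζ (v 0 / δ) * partialWithin ℍ₂ 0 r v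
        + (χ (v 1) * (deriv ζ (v 0 / δ) / δ) * partialWithin ℍ₂ 1 r v
          + χ (v 1) * ζ (v 0 / δ) * partialWithin ℍ₂ 0 (partialWithin ℍ₂ 1 r) v)) v := by
  refine HasPartial.congr ((hasPartial_cut_zero (contDiff_deriv hχ) hζ hr hv).add
    (hasPartial_cut_zero hχ hζ (hr.partial_ 1) hv)) ?_
  filter_upwards [hr.eventually, self_mem_nhdsWithin] with w hw hm
  exact (hasPartial_cut_one hχ hζ hw hm).eq

lemma hasPartial_cut_one_one (hχ : ContDiff ℝ ∞ χ) (hζ : ContDiff ℝ ∞ ζ) (hr : SmoothNear r v)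
    (hv : v ∈ ℍ₂) : HasPartial 1 (partialWithin ℍ₂ 1 (fun w => χ (w 1) * ζ (w 0 / δ) * r w))
      (deriv (deriv χ) (v 1) * ζ (v 0 / δ) * r v
        + deriv χ (v 1) * ζ (v 0 / δ) * partialWithin ℍ₂ 1 r v
        + (deriv χ (v 1) * ζ (v 0 / δ) * partialWithin ℍ₂ 1 r v
          + χ (v 1) * ζ (v 0 / δ) * partialWithin ℍ₂ 1 (partialWithin ℍ₂ 1 r) v)) v := by
  refine HasPartial.congr ((hasPartial_cut_one (contDiff_deriv hχ) hζ hr hv).add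
    (hasPartial_cut_one hχ hζ (hr.partial_ 1) hv)) ?_
  filter_upwards [hr.eventually, self_mem_nhdsWithin] with w hw hm
  exact (hasPartial_cut_one hχ hζ hw hm).eq

lemma hasPartial_cut_zero_zero (hχ : ContDiff ℝ ∞ χ) (hζ : ContDiff ℝ ∞ ζ) (hr : SmoothNear r v)
    (hv : v ∈ ℍ₂) : HasPartial 0 (partialWithin ℍ₂ 0 (fun w => χ (w 1) * ζ (w 0 / δ) * r w))
      (χ (v 1) * (deriv (deriv ζ) (v 0 / δ) / δ) * (r v / δ)
        + χ (v 1) * deriv ζ (v 0 / δ) * (partialWithin ℍ₂ 0 r v / δ)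
        + (χ (v 1) * (deriv ζ (v 0 / δ) / δ) * partialWithin ℍ₂ 0 r v
          + χ (v 1) * ζ (v 0 / δ) * partialWithin ℍ₂ 0 (partialWithin ℍ₂ 0 r) v)) v := by
  have h1 : SmoothNear (fun w => δ⁻¹ * r w) v := (SmoothNear.const _).mul hr
  refine HasPartial.congr (((hasPartial_cut_zero (δ := δ) hχ (contDiff_deriv hζ) h1 hv).of_eq
      ?_).add
    (hasPartial_cut_zero hχ hζ (hr.partial_ 0) hv)) ?_
  · rw [((hr.hasPartial hv 0).const_mul δ⁻¹).eq]
    simp only [div_eq_mul_inv]; ring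
  filter_upwards [hr.eventually, self_mem_nhdsWithin] with w hw hm
  rw [(hasPartial_cut_zero hχ hζ hw hm).eq]
  simp only [div_eq_mul_inv]; ring

end Partials

lemma abs_mul₃_le {x z r c η : ℝ} (hx : |x| ≤ c) (hz : |z| ≤ c) (hr : |r| ≤ η) :
    |x * z * r| ≤ c ^ 2 * η := by
  have hc : 0 ≤ c := (abs_nonneg x).trans hx
  rw [abs_mul, abs_mul, pow_two]
  exact mul_le_mul (mul_le_mul hx hz (abs_nonneg _) hc) hr (abs_nonneg _) (by positivity)

lemma abs_mul₃_div_le {x z r c η δ : ℝ} (hδ : 0 < δ) (hx : |x| ≤ c) (hz : |z| ≤ c)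
    (hr : |r| ≤ η * δ) : |x * (z / δ) * r| ≤ c ^ 2 * η := by
  have : x * (z / δ) * r = x * z * (r / δ) := by ring
  rw [this]
  refine abs_mul₃_le hx hz ?_
  rwa [abs_div, abs_of_pos hδ, div_le_iff₀ hδ]

lemma partialWithin_congr {f g : Plane → ℝ} {v : Plane} (h : f =ᶠ[𝓝[ℍ₂] v] g) (i : Fin 2) :
    partialWithin ℍ₂ i f =ᶠ[𝓝[ℍ₂] v] partialWithin ℍ₂ i g := by
  filter_upwards [eventually_eventually_nhdsWithin.2 h, self_mem_nhdsWithin] with w hw hm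
  have hw' : f =ᶠ[𝓝[ℍ₂] w] g := hw
  rw [partialWithin, partialWithin, hw'.fderivWithin_eq (hw'.self_of_nhdsWithin hm)]

lemma jetOf_congr {M M' : Plane → Matrix (Fin 2) (Fin 2) ℝ} {v : Plane} (hv : v ∈ ℍ₂)
    (h : ∀ᶠ w in 𝓝[ℍ₂] v, M' w = M w) : jetOf M' v = jetOf M v := by
  have e : ∀ i j, (fun w => M' w i j) =ᶠ[𝓝[ℍ₂] v] fun w => M w i j := fun i j => by
    filter_upwards [h] with w hw; rw [hw]
  have e0 : M' v = M v := h.self_of_nhdsWithin hv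
  have e1 := fun k i j => (partialWithin_congr (e i j) k).self_of_nhdsWithin hv
  have e2 := fun l k i j => (partialWithin_congr (partialWithin_congr (e i j) k)
      l).self_of_nhdsWithin hv
  simp only [jetOf, e1, e2, e0]

lemma MetricNear.congr {M M' : Plane → Matrix (Fin 2) (Fin 2) ℝ} {v : Plane} (hM : MetricNear M v)
    (h : ∀ᶠ w in 𝓝[ℍ₂] v, M' w = M w) : MetricNear M' v where
  mem := hM.mem
  smooth i j := (hM.smooth i j).congr (by filter_upwards [h] with w hw; rw [hw])
  symm := by filter_upwards [h, hM.symm] with w hw hw'; rw [hw, hw']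
  det := by rw [h.self_of_nhdsWithin hM.mem]; exact hM.det

lemma corr_apply (χ ζ : ℝ → ℝ) (δ : ℝ) (M : Plane → Matrix (Fin 2) (Fin 2) ℝ) (v : Plane)
    (i j : Fin 2) : corr χ ζ δ M v i j = χ (v 1) * ζ (v 0 / δ) * resid M v i j := rfl

lemma corr_eq_zero {χ ζ : ℝ → ℝ} {δ : ℝ} {M : Plane → Matrix (Fin 2) (Fin 2) ℝ} {K : Set ℝ}
    (hχ : tsupport χ ⊆ K) (hζ : tsupport ζ ⊆ Ioo (-1) 1) (hδ : 0 < δ) {v : Plane} (hv : v ∈ ℍ₂)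
    (h : v ∉ strip K δ) : corr χ ζ δ M v = 0 := by
  have h0 : 0 ≤ v 0 := mem_half.1 hv
  have : χ (v 1) = 0 ∨ ζ (v 0 / δ) = 0 := by
    by_contra! hc
    refine h ⟨h0, ?_, hχ (subset_tsupport _ hc.1)⟩
    have := (hζ (subset_tsupport _ hc.2)).2
    rw [div_lt_one hδ] at this
    exact this.le
  rcases this with h | h <;> simp [corr, h]

namespace GeodesicChart

variable {M : Plane → Matrix (Fin 2) (Fin 2) ℝ} {B : Set Plane}

/-- The bounds on the Taylor residue, in a thin strip along the boundary. -/
lemma resid_bounds (h : GeodesicChart M B) {K : Set ℝ} (hK : IsCompact K) {δ₀ : ℝ}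
    (hδ₀ : 0 < δ₀) (hs : strip K δ₀ ⊆ B) :
    ∃ A ≥ 0, ∀ η > 0, ∀ δ₁ > 0, ∃ δ > 0, δ ≤ δ₀ ∧ δ ≤ δ₁ ∧ δ ≤ 1 ∧ ∀ v ∈ strip K δ,
      (|resid M v 0 0| ≤ η ∧ |partialWithin ℍ₂ 1 (fun w => resid M w 0 0) v| ≤ η ∧
      |partialWithin ℍ₂ 1 (partialWithin ℍ₂ 1 (fun w => resid M w 0 0)) v| ≤ η ∧
      |resid M v 0 0| ≤ A * v 0 ∧ |partialWithin ℍ₂ 0 (fun w => resid M w 0 0) v| ≤ A) ∧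
      (|resid M v 0 1| ≤ η * v 0 ∧ |partialWithin ℍ₂ 0 (fun w => resid M w 0 1) v| ≤ η ∧
      |partialWithin ℍ₂ 1 (fun w => resid M w 0 1) v| ≤ η * v 0 ∧
      |partialWithin ℍ₂ 0 (partialWithin ℍ₂ 1 (fun w => resid M w 0 1)) v| ≤ η) ∧
      (|resid M v 1 1| ≤ η * v 0 ^ 2 ∧ |partialWithin ℍ₂ 0 (fun w => resid M w 1 1) v| ≤ η * v 0 ∧
      |partialWithin ℍ₂ 1 (fun w => resid M w 1 1) v| ≤ η ∧
      |partialWithin ℍ₂ 0 (partialWithin ℍ₂ 0 (fun w => resid M w 1 1)) v| ≤ η) := by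
  have hKB : ∀ x ∈ K, pt 0 x ∈ B := fun x hx => hs ⟨le_rfl, hδ₀.le, hx⟩
  have hsm : ∀ v ∈ strip K δ₀, _ := fun v hv =>
    h.resid_smooth ⟨strip_subset_half _ _ hv, hs hv⟩ (hKB _ hv.2.2)
  have hcont : ∀ {f : Plane → ℝ}, (∀ v ∈ strip K δ₀, SmoothNear f v) → ContinuousOn f (strip K δ₀)
      :=
    fun hf v hv => ((hf v hv).cont (strip_subset_half _ _ hv)).mono (strip_subset_half _ _)
  have hev : ∀ x ∈ K, ∀ᶠ t in 𝓝 x, pt 0 t ∈ B := fun x hx => h.isOpen_trace.mem_nhds (hKB x hx)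
  have m0 : ∀ x, pt 0 x ∈ ℍ₂ := fun x => pt_mem_half.2 le_rfl
  have hsb : ∀ x, pt 0 x ∈ B → _ := fun x hx => h.resid_smooth (v := pt 0 x) ⟨m0 x, hx⟩ hx
  -- The entries of the residue vanish along the boundary, hence so do their tangential derivatives.
  have z00 : ∀ x, pt 0 x ∈ B → resid M (pt 0 x) 0 0 = 0 := fun x hx => by rw [h.resid_bdry hx]; rfl
  have z01 : ∀ x, pt 0 x ∈ B → resid M (pt 0 x) 0 1 = 0 := fun x hx => by rw [h.resid_bdry hx]; rfl
  have z11 : ∀ x, pt 0 x ∈ B → resid M (pt 0 x) 1 1 = 0 := fun x hx => by rw [h.resid_bdry hx]; rfl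
  have hev' : ∀ x, pt 0 x ∈ B → ∀ᶠ t in 𝓝 x, pt 0 t ∈ B := fun x hx => h.isOpen_trace.mem_nhds hx
  have z00' : ∀ x, pt 0 x ∈ B → partialWithin ℍ₂ 1 (fun w => resid M w 0 0) (pt 0 x) = 0 :=
    fun x hx => partial_one_eq_zero ((hsb x hx).1.diff (m0 x)) ((hev' x hx).mono z00)
  have z00'' : ∀ x ∈ K,
      partialWithin ℍ₂ 1 (partialWithin ℍ₂ 1 (fun w => resid M w 0 0)) (pt 0 x) = 0 :=
    fun x hx => partial_one_eq_zero (((hsb x (hKB x hx)).1.partial_ 1).diff (m0 x))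
      ((hev x hx).mono z00')
  have z01' : ∀ x ∈ K, partialWithin ℍ₂ 1 (fun w => resid M w 0 1) (pt 0 x) = 0 :=
    fun x hx => partial_one_eq_zero ((hsb x (hKB x hx)).2.1.diff (m0 x)) ((hev x hx).mono z01)
  have z01'' : ∀ x ∈ K,
      partialWithin ℍ₂ 0 (partialWithin ℍ₂ 1 (fun w => resid M w 0 1)) (pt 0 x) = 0 := by
    intro x hx
    rw [(hsb x (hKB x hx)).2.1.partial_comm (m0 x)]
    exact partial_one_eq_zero (((hsb x (hKB x hx)).2.1.partial_ 0).diff (m0 x))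
      ((hev x hx).mono fun t ht => h.resid_normal_zero_one ht)
  have z11' : ∀ x ∈ K, partialWithin ℍ₂ 1 (fun w => resid M w 1 1) (pt 0 x) = 0 :=
    fun x hx => partial_one_eq_zero ((hsb x (hKB x hx)).2.2.diff (m0 x)) ((hev x hx).mono z11)
  -- The normal derivative of the entry `00` need not vanish on the boundary: it is only bounded.
  obtain ⟨A, hA⟩ := (isCompact_strip hK δ₀).exists_bound_of_continuousOn
    (hcont fun v hv => (hsm v hv).1.partial_ 0)
  refine ⟨max A 0, le_max_right _ _, fun η hη δ₁ hδ₁ => ?_⟩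
  -- By continuity, quantities vanishing on the boundary are small in a thin strip.
  obtain ⟨d1, p1, q1, b1⟩ := exists_strip_small hK (hcont fun v hv => (hsm v hv).1) hδ₀
    (fun x hx => z00 x (hKB x hx)) hη
  obtain ⟨d2, p2, q2, b2⟩ := exists_strip_small hK (hcont fun v hv => (hsm v hv).1.partial_ 1) hδ₀
    (fun x hx => z00' x (hKB x hx)) hη
  obtain ⟨d3, p3, q3, b3⟩ := exists_strip_small hK
    (hcont fun v hv => ((hsm v hv).1.partial_ 1).partial_ 1) hδ₀ z00'' hη
  obtain ⟨d4, p4, q4, b4⟩ := exists_strip_small hK (hcont fun v hv => (hsm v hv).2.1.partial_ 0) hδ₀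
    (fun x hx => h.resid_normal_zero_one (hKB x hx)) hη
  obtain ⟨d5, p5, q5, b5⟩ := exists_strip_small hK
    (hcont fun v hv => ((hsm v hv).2.1.partial_ 1).partial_ 0) hδ₀ z01'' hη
  obtain ⟨d6, p6, q6, b6⟩ := exists_strip_small hK (hcont fun v hv => (hsm v hv).2.2.partial_ 1) hδ₀
    z11' hη
  obtain ⟨d7, p7, q7, b7⟩ := exists_strip_small hK
    (hcont fun v hv => ((hsm v hv).2.2.partial_ 0).partial_ 0) hδ₀
    (fun x hx => h.resid_normal₂_one_one (hKB x hx)) hη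
  set δ := min 1 (min d1 (min δ₁ (min d2 (min d3 (min d4 (min d5 (min d6 d7))))))) with hδ
  have l1 : δ ≤ 1 := min_le_left _ _
  have e1 : δ ≤ d1 := (min_le_right _ _).trans (min_le_left _ _)
  have e2 : δ ≤ d2 := by simp [hδ]
  have e8 : δ ≤ δ₁ := by simp [hδ]
  have e3 : δ ≤ d3 := by simp [hδ]
  have e4 : δ ≤ d4 := by simp [hδ]
  have e5 : δ ≤ d5 := by simp [hδ]
  have e6 : δ ≤ d6 := by simp [hδ]
  have e7 : δ ≤ d7 := by simp [hδ]
  have hle : δ ≤ δ₀ := e1.trans q1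
  have hdf : ∀ {f : Plane → ℝ}, (∀ v ∈ strip K δ₀, SmoothNear f v) →
      ∀ v ∈ strip K δ, DifferentiableWithinAt ℝ f ℍ₂ v := fun hf v hv =>
    (hf v (strip_mono hle hv)).diff (strip_subset_half _ _ hv)
  have hAδ : ∀ v ∈ strip K δ, |partialWithin ℍ₂ 0 (fun w => resid M w 0 0) v| ≤ max A 0 :=
    fun v hv => (hA v (strip_mono hle hv)).trans (le_max_left _ _)
  -- Bounds on normal derivatives are integrated to bounds by powers of the distance to the
  -- boundary.
  have i1 := abs_le_of_partial_zero 0 (hdf fun v hv => (hsm v hv).1) (fun x hx => z00 x (hKB x hx))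
    (le_max_right A 0) (by simpa using hAδ)
  have i2 := abs_le_of_partial_zero 0 (hdf fun v hv => (hsm v hv).2.1)
    (fun x hx => z01 x (hKB x hx)) hη.le (by simpa using fun v hv => b4 v (strip_mono e4 hv))
  have i3 := abs_le_of_partial_zero 0 (hdf fun v hv => (hsm v hv).2.1.partial_ 1)
    z01' hη.le (by simpa using fun v hv => b5 v (strip_mono e5 hv))
  have i4 := abs_le_of_partial_zero 0 (hdf fun v hv => (hsm v hv).2.2.partial_ 0)
    (fun x hx => h.resid_normal_one_one_bdry (hKB x hx)) hη.le
    (by simpa using fun v hv => b7 v (strip_mono e7 hv))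
  have i5 := abs_le_of_partial_zero 1 (hdf fun v hv => (hsm v hv).2.2)
    (fun x hx => z11 x (hKB x hx)) hη.le (by simpa using i4)
  simp only [zero_add, pow_one] at i1 i2 i3 i4
  refine ⟨δ, by positivity, hle, e8, l1, fun v hv => ⟨⟨b1 v (strip_mono e1 hv), b2 v (strip_mono
      e2 hv),
    b3 v (strip_mono e3 hv), i1 v hv, hAδ v hv⟩, ⟨i2 v hv, b4 v (strip_mono e4 hv), i3 v hv,
    b5 v (strip_mono e5 hv)⟩, ⟨i5 v hv, i4 v hv, b6 v (strip_mono e6 hv), b7 v (strip_mono e7 hv)⟩⟩⟩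

/-- The jet of the correction is small, except for the entry `∂₀ M₀₀` which is bounded. Each normal
derivative of the cutoff function costs a factor `1 / δ`, which the order of vanishing of the
residue compensates: two normal derivatives occur in the entry `11` only, and none beyond the first
in the entry `00`. -/
lemma jet_corr (h : GeodesicChart M B) {χ ζ : ℝ → ℝ} (hχ : ContDiff ℝ ∞ χ) (hζ : ContDiff ℝ ∞ ζ)
    {c : ℝ} (hcχ : ∀ x, |χ x| ≤ c ∧ |deriv χ x| ≤ c ∧ |deriv (deriv χ) x| ≤ c)
    (hcζ : ∀ x, |ζ x| ≤ c ∧ |deriv ζ x| ≤ c ∧ |deriv (deriv ζ) x| ≤ c)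
    {K : Set ℝ} (hK : IsCompact K) {δ₀ : ℝ} (hδ₀ : 0 < δ₀) (hs : strip K δ₀ ⊆ B) :
    ∃ A, ∀ η > 0, ∀ δ₁ > 0, ∃ δ > 0, δ ≤ δ₀ ∧ δ ≤ δ₁ ∧ ∀ v ∈ strip K δ,
      |jetOf (corr χ ζ δ M) v 3| ≤ A ∧ ∀ k, k ≠ 3 → |jetOf (corr χ ζ δ M) v k| ≤ η := by
  obtain ⟨A, hA, H⟩ := h.resid_bounds hK hδ₀ hs
  refine ⟨c ^ 2 * A + c ^ 2 * A, fun η hη δ₁ hδ₁ => ?_⟩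
  have hη' : 0 < η / (4 * (c ^ 2 + 1)) := by positivity
  obtain ⟨δ, hδ, hδδ₀, hδδ₁, hδ1, Hδ⟩ := H _ hη' δ₁ hδ₁
  set η' := η / (4 * (c ^ 2 + 1)) with hη'd
  have h4 : 4 * (c ^ 2 * η') ≤ η := by
    have : 4 * (c ^ 2 + 1) * η' = η := by rw [hη'd]; field_simp
    nlinarith
  have hcη : 0 ≤ c ^ 2 * η' := by positivity
  have hKB : ∀ x ∈ K, pt 0 x ∈ B := fun x hx => hs ⟨le_rfl, hδ₀.le, hx⟩
  refine ⟨δ, hδ, hδδ₀, hδδ₁, fun v hv => ?_⟩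
  have hv' : v ∈ ℍ₂ := strip_subset_half _ _ hv
  obtain ⟨s0, s1, s2⟩ := h.resid_smooth ⟨hv', hs (strip_mono hδδ₀ hv)⟩ (hKB _ hv.2.2)
  obtain ⟨⟨a1, a2, a3, a4, a5⟩, ⟨b1, b2, b3, b4⟩, ⟨c1, c2, c3, c4⟩⟩ := Hδ v hv
  obtain ⟨x0, x1, x2⟩ := hcχ (v 1)
  obtain ⟨y0, y1, y2⟩ := hcζ (v 0 / δ)
  have v0 : 0 ≤ v 0 := hv.1
  have vδ : v 0 ≤ δ := hv.2.1
  have v1 : v 0 ≤ 1 := vδ.trans hδ1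
  -- In the strip `v 0 ≤ δ ≤ 1`.
  have w1 : η' * v 0 ≤ η' := mul_le_of_le_one_right hη'.le v1
  have w2 : η' * v 0 ≤ η' * δ := by gcongr
  have w3 : η' * v 0 ^ 2 ≤ η' := mul_le_of_le_one_right hη'.le (pow_le_one₀ v0 v1)
  have w4 : η' * v 0 ^ 2 ≤ η' * δ := by
    have : v 0 ^ 2 ≤ δ := by nlinarith
    gcongr
  have w5 : A * v 0 ≤ A * δ := by gcongr
  have w6 : |resid M v 1 1 / δ| ≤ η' * δ := by
    rw [abs_div, abs_of_pos hδ, div_le_iff₀ hδ]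
    refine c1.trans ?_
    have : v 0 ^ 2 ≤ δ * δ := by nlinarith
    calc η' * v 0 ^ 2 ≤ η' * (δ * δ) := by gcongr
      _ = _ := by ring
  have w7 : |partialWithin ℍ₂ 0 (fun w => resid M w 1 1) v / δ| ≤ η' := by
    rw [abs_div, abs_of_pos hδ, div_le_iff₀ hδ]
    exact c2.trans w2
  have t2 : ∀ {p q : ℝ}, |p| ≤ c ^ 2 * η' → |q| ≤ c ^ 2 * η' → |p + q| ≤ η := fun hp hq =>
    (abs_add_le _ _).trans (by linarith)
  have t4 : ∀ {p q r s : ℝ}, |p| ≤ c ^ 2 * η' → |q| ≤ c ^ 2 * η' → |r| ≤ c ^ 2 * η' →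
      |s| ≤ c ^ 2 * η' → |p + q + (r + s)| ≤ η := fun hp hq hr hs' =>
    (abs_add_le _ _).trans ((add_le_add (abs_add_le _ _) (abs_add_le _ _)).trans (by linarith))
  have t1 : ∀ {p : ℝ}, |p| ≤ c ^ 2 * η' → |p| ≤ η := fun hp => hp.trans (by linarith)
  constructor
  · have e := (hasPartial_cut_zero (δ := δ) hχ hζ s0 hv').eq
    change |partialWithin ℍ₂ 0 (fun w => χ (w 1) * ζ (w 0 / δ) * resid M w 0 0) v| ≤ _
    rw [e]
    exact (abs_add_le _ _).trans (add_le_add (abs_mul₃_div_le hδ x0 y1 (a4.trans w5))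
      (abs_mul₃_le x0 y0 a5))
  intro k hk
  -- The entries are listed in the order of `jetOf`, and their derivatives computed by the Leibniz
  -- rule.
  fin_cases k
  · exact t1 (abs_mul₃_le x0 y0 a1)
  · exact t1 (abs_mul₃_le x0 y0 (b1.trans w1))
  · exact t1 (abs_mul₃_le x0 y0 (c1.trans w3))
  · exact absurd rfl hk
  · change |partialWithin ℍ₂ 1 (fun w => χ (w 1) * ζ (w 0 / δ) * resid M w 0 0) v| ≤ _
    rw [(hasPartial_cut_one (δ := δ) hχ hζ s0 hv').eq]
    exact t2 (abs_mul₃_le x1 y0 a1) (abs_mul₃_le x0 y0 a2)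
  · change |partialWithin ℍ₂ 0 (fun w => χ (w 1) * ζ (w 0 / δ) * resid M w 0 1) v| ≤ _
    rw [(hasPartial_cut_zero (δ := δ) hχ hζ s1 hv').eq]
    exact t2 (abs_mul₃_div_le hδ x0 y1 (b1.trans w2)) (abs_mul₃_le x0 y0 b2)
  · change |partialWithin ℍ₂ 1 (fun w => χ (w 1) * ζ (w 0 / δ) * resid M w 0 1) v| ≤ _
    rw [(hasPartial_cut_one (δ := δ) hχ hζ s1 hv').eq]
    exact t2 (abs_mul₃_le x1 y0 (b1.trans w1)) (abs_mul₃_le x0 y0 (b3.trans w1))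
  · change |partialWithin ℍ₂ 0 (fun w => χ (w 1) * ζ (w 0 / δ) * resid M w 1 1) v| ≤ _
    rw [(hasPartial_cut_zero (δ := δ) hχ hζ s2 hv').eq]
    exact t2 (abs_mul₃_div_le hδ x0 y1 (c1.trans w4)) (abs_mul₃_le x0 y0 (c2.trans w1))
  · change |partialWithin ℍ₂ 1 (fun w => χ (w 1) * ζ (w 0 / δ) * resid M w 1 1) v| ≤ _
    rw [(hasPartial_cut_one (δ := δ) hχ hζ s2 hv').eq]
    exact t2 (abs_mul₃_le x1 y0 (c1.trans w3)) (abs_mul₃_le x0 y0 c3)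
  · change |partialWithin ℍ₂ 0 (partialWithin ℍ₂ 1
      (fun w => χ (w 1) * ζ (w 0 / δ) * resid M w 0 1)) v| ≤ _
    rw [(hasPartial_cut_zero_one (δ := δ) hχ hζ s1 hv').eq]
    exact t4 (abs_mul₃_div_le hδ x1 y1 (b1.trans w2)) (abs_mul₃_le x1 y0 b2)
      (abs_mul₃_div_le hδ x0 y1 (b3.trans w2)) (abs_mul₃_le x0 y0 b4)
  · change |partialWithin ℍ₂ 0 (partialWithin ℍ₂ 0
      (fun w => χ (w 1) * ζ (w 0 / δ) * resid M w 1 1)) v| ≤ _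
    rw [(hasPartial_cut_zero_zero (δ := δ) hχ hζ s2 hv').eq]
    exact t4 (abs_mul₃_div_le hδ x0 y2 w6) (abs_mul₃_le x0 y1 w7)
      (abs_mul₃_div_le hδ x0 y1 (c2.trans w2)) (abs_mul₃_le x0 y0 c4)
  · change |partialWithin ℍ₂ 1 (partialWithin ℍ₂ 1
      (fun w => χ (w 1) * ζ (w 0 / δ) * resid M w 0 0)) v| ≤ _
    rw [(hasPartial_cut_one_one (δ := δ) hχ hζ s0 hv').eq]
    exact t4 (abs_mul₃_le x2 y0 a1) (abs_mul₃_le x1 y0 a2) (abs_mul₃_le x1 y0 a2)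
      (abs_mul₃_le x0 y0 a3)

end GeodesicChart

lemma jetOf_sub {M N : Plane → Matrix (Fin 2) (Fin 2) ℝ} {v : Plane} (hv : v ∈ ℍ₂)
    (hM : ∀ i j, SmoothNear (fun w => M w i j) v) (hN : ∀ i j, SmoothNear (fun w => N w i j) v) :
    jetOf (fun w => M w - N w) v = jetOf M v - jetOf N v := by
  have e1 : ∀ k i j, partialWithin ℍ₂ k (fun w => (M w - N w) i j) v
      = partialWithin ℍ₂ k (fun w => M w i j) v - partialWithin ℍ₂ k (fun w => N w i j) v :=
    fun k i j => (((hM i j).hasPartial hv k).sub ((hN i j).hasPartial hv k)).eq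
  have e2 : ∀ l k i j, partialWithin ℍ₂ l (partialWithin ℍ₂ k (fun w => (M w - N w) i j)) v
      = partialWithin ℍ₂ l (partialWithin ℍ₂ k (fun w => M w i j)) v
        - partialWithin ℍ₂ l (partialWithin ℍ₂ k (fun w => N w i j)) v := by
    intro l k i j
    refine (((((hM i j).partial_ k).hasPartial hv l).sub
      (((hN i j).partial_ k).hasPartial hv l)).congr ?_).eq
    filter_upwards [(hM i j).eventually, (hN i j).eventually, self_mem_nhdsWithin] with w h1 h2 hw
    exact ((h1.hasPartial hw k).sub (h2.hasPartial hw k)).eq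
  ext k
  fin_cases k
  exacts [rfl, rfl, rfl, e1 _ _ _, e1 _ _ _, e1 _ _ _, e1 _ _ _, e1 _ _ _, e1 _ _ _, e2 _ _ _ _,
    e2 _ _ _ _, e2 _ _ _ _]

lemma continuousOn_jetOf {M : Plane → Matrix (Fin 2) (Fin 2) ℝ} {s : Set Plane} (hs : s ⊆ ℍ₂)
    (hM : ∀ v ∈ s, MetricNear M v) : ContinuousOn (jetOf M) s := by
  refine continuousOn_pi.2 fun k v hv => ?_
  have h := (hM v hv).smooth
  have c : ∀ {f : Plane → ℝ}, SmoothNear f v → ContinuousWithinAt f s v := fun hf =>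
    (hf.cont (hs hv)).mono hs
  fin_cases k
  · exact c (h 0 0)
  · exact c (h 0 1)
  · exact c (h 1 1)
  · exact c ((h 0 0).partial_ 0)
  · exact c ((h 0 0).partial_ 1)
  · exact c ((h 0 1).partial_ 0)
  · exact c ((h 0 1).partial_ 1)
  · exact c ((h 1 1).partial_ 0)
  · exact c ((h 1 1).partial_ 1)
  · exact c (((h 0 1).partial_ 1).partial_ 0)
  · exact c (((h 1 1).partial_ 0).partial_ 0)
  · exact c (((h 0 0).partial_ 1).partial_ 1)

namespace GeodesicChart

variable {M : Plane → Matrix (Fin 2) (Fin 2) ℝ} {B : Set Plane}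

lemma corr_smooth (h : GeodesicChart M B) {χ ζ : ℝ → ℝ} (hχ : ContDiff ℝ ∞ χ)
    (hζ : ContDiff ℝ ∞ ζ) (hB : ∀ x ∈ tsupport χ, pt 0 x ∈ B) (δ : ℝ) {v : Plane}
    (hv : v ∈ ℍ₂ ∩ B) (i j : Fin 2) : SmoothNear (fun w => corr χ ζ δ M w i j) v := by
  by_cases hx : v 1 ∈ tsupport χ
  · obtain ⟨h0, h1, h2⟩ := h.resid_smooth hv (hB _ hx)
    have hc : SmoothNear (fun w => χ (w 1) * ζ (w 0 / δ)) v :=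
      (SmoothNear.of_contDiff (hχ.comp (contDiff_coord 1))).mul
        (SmoothNear.of_contDiff (hζ.comp ((contDiff_coord 0).div_const δ)))
    fin_cases i <;> fin_cases j
    · exact hc.mul h0
    · exact hc.mul h1
    · exact hc.mul h1
    · exact hc.mul h2
  · refine (SmoothNear.const 0).congr ?_
    have : ∀ᶠ w : Plane in 𝓝 v, w 1 ∉ tsupport χ :=
      (continuous_coord 1).continuousAt.eventually ((isClosed_tsupport χ).isOpen_compl.mem_nhds hx)
    filter_upwards [mem_nhdsWithin_of_mem_nhds this] with w hw
    simp [corr, image_eq_zero_of_notMem_tsupport hw]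

/-- Where the cutoff functions are equal to one, the corrected metric is the even part of the
Taylor expansion of the metric. -/
lemma contDiffAt_even_part (h : GeodesicChart M B) {x : ℝ} (hx : pt 0 x ∈ B) :
    ContDiffAt ℝ ∞ (fun w => M (foldPt w) 0 0 - resid M (foldPt w) 0 0) (pt 0 x) ∧
    ContDiffAt ℝ ∞ (fun w => side w * (M (foldPt w) 0 1 - resid M (foldPt w) 0 1)) (pt 0 x) ∧
    ContDiffAt ℝ ∞ (fun w => M (foldPt w) 1 1 - resid M (foldPt w) 1 1) (pt 0 x) := by
  have hb := (h.metric_bdry hx).smooth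
  have t1 := ((hb 0 1).partial_ 0).contDiffAt_trace (v := pt 0 x)
  have t2 := (((hb 1 1).partial_ 0).partial_ 0).contDiffAt_trace (v := pt 0 x)
  have c0 : ContDiffAt ℝ ∞ (fun w : Plane => w 0) (pt 0 x) := (contDiff_coord 0).contDiffAt
  refine ⟨?_, ?_, ?_⟩
  · simpa [resid] using contDiffAt_const
  · refine (c0.mul t1).congr_of_eventuallyEq (Filter.Eventually.of_forall fun w => ?_)
    simp only [resid, foldPt]
    simp [← mul_assoc, side_mul_abs]
  · refine (contDiffAt_const (c := (1 : ℝ)).add ((c0.mul c0).mul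
      ((contDiffAt_const (c := (1 / 2 : ℝ))).mul t2))).congr_of_eventuallyEq
      (Filter.Eventually.of_forall fun w => ?_)
    simp [resid, foldPt]

/-- A metric for which the boundary is geodesic can be changed in a small neighbourhood of a given
compact part of the boundary, into a metric which is even there, with a small change of the
curvature. -/
theorem exists_correction (h : GeodesicChart M B) {C : Set ℝ} (hC : IsCompact C)
    {W : Set Plane} (hW : IsOpen W) (hCW : ∀ x ∈ C, pt 0 x ∈ B ∩ W) {ε : ℝ} (hε : 0 < ε) :
    ∃ (N : Plane → Matrix (Fin 2) (Fin 2) ℝ) (Q : Set Plane), IsCompact Q ∧ Q ⊆ ℍ₂ ∩ (B ∩ W) ∧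
      (∀ v ∈ ℍ₂, v ∉ Q → N v = 0) ∧ (∀ v, N v 1 0 = N v 0 1) ∧
      (∀ v ∈ ℍ₂ ∩ B, ∀ i j, SmoothNear (fun w => N w i j) v) ∧
      (∀ v ∈ Q, ∀ s t : ℝ, |N v 0 0 * s ^ 2 + 2 * N v 0 1 * (s * t) + N v 1 1 * t ^ 2|
        ≤ ε * (M v 0 0 * s ^ 2 + 2 * M v 0 1 * (s * t) + M v 1 1 * t ^ 2)) ∧
      GeodesicChart (fun w => M w - N w) B ∧
      (∀ v ∈ ℍ₂ ∩ B, |coordCurvature ℍ₂ (fun w => M w - N w) v - coordCurvature ℍ₂ M v| ≤ ε) ∧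
      (∀ x ∈ C, EvenAt (fun w => M w - N w) (pt 0 x)) ∧
      (∀ x, pt 0 x ∈ B → EvenAt M (pt 0 x) → EvenAt (fun w => M w - N w) (pt 0 x)) := by
  -- Tangential and normal cutoff functions; `c` bounds their derivatives up to order two.
  obtain ⟨χ, hχ, hχ1, hχc, hχU, cχ, hcχ, bχ⟩ := exists_cutoff hC
    (U := {x | pt 0 x ∈ B ∩ W})
    ((h.isOpen.inter hW).preimage (continuous_pt continuous_const continuous_id)) hCW
  obtain ⟨ζ, hζ, hζ1, -, hζU, cζ, hcζ, bζ⟩ := exists_cutoff (isCompact_singleton (x := (0 : ℝ)))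
    (U := Ioo (-1) 1) isOpen_Ioo (by simp)
  have hζ1 := hζ1 0 rfl
  set c := max cχ cζ
  have bχ' : ∀ x, |χ x| ≤ c ∧ |deriv χ x| ≤ c ∧ |deriv (deriv χ) x| ≤ c := fun x =>
    ⟨(bχ x).1.trans (le_max_left _ _), (bχ x).2.1.trans (le_max_left _ _),
      (bχ x).2.2.trans (le_max_left _ _)⟩
  have bζ' : ∀ x, |ζ x| ≤ c ∧ |deriv ζ x| ≤ c ∧ |deriv (deriv ζ) x| ≤ c := fun x =>
    ⟨(bζ x).1.trans (le_max_right _ _), (bζ x).2.1.trans (le_max_right _ _),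
      (bζ x).2.2.trans (le_max_right _ _)⟩
  set K := tsupport χ with hKd
  have hKB : ∀ x ∈ K, pt 0 x ∈ B := fun x hx => (hχU hx).1
  obtain ⟨δ₀, hδ₀, hs⟩ := exists_strip_subset hχc (h.isOpen.inter hW) hχU
  have hsB : strip K δ₀ ⊆ B := hs.trans inter_subset_left
  have hmet : ∀ v ∈ strip K δ₀, MetricNear M v := fun v hv =>
    h.metric v ⟨strip_subset_half _ _ hv, hsB hv⟩
  have hjc := continuousOn_jetOf (strip_subset_half K δ₀) hmet
  -- The jets of the metric along the boundary form a compact set.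
  have hJc : IsCompact ((fun x => jetOf M (pt 0 x)) '' K) := by
    refine hχc.image_of_continuousOn (hjc.comp
      (continuous_pt continuous_const continuous_id).continuousOn fun x hx => ⟨le_rfl, hδ₀.le, hx⟩)
  have hJ : ∀ x ∈ K, jetOf M (pt 0 x) 0 = 1 ∧ jetOf M (pt 0 x) 1 = 0 ∧ jetOf M (pt 0 x) 2 = 1 ∧
      jetOf M (pt 0 x) 6 = 0 ∧ jetOf M (pt 0 x) 7 = 0 := by
    intro x hx
    obtain ⟨e1, e2⟩ := h.bdry x (hKB x hx)
    refine ⟨?_, ?_, ?_, ?_, e2⟩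
    · change M (pt 0 x) 0 0 = 1; rw [e1]; rfl
    · change M (pt 0 x) 0 1 = 0; rw [e1]; rfl
    · change M (pt 0 x) 1 1 = 1; rw [e1]; rfl
    · refine partial_one_eq_zero (((h.metric_bdry (hKB x hx)).smooth 0 1).diff
        (pt_mem_half.2 le_rfl)) ?_
      filter_upwards [h.isOpen_trace.mem_nhds (hKB x hx)] with t ht
      rw [(h.bdry t ht).1]; rfl
  obtain ⟨A, HA⟩ := h.jet_corr hχ hζ bχ' bζ' hχc hδ₀ hsB
  obtain ⟨η, hη, Hη⟩ := exists_curvJ_close hJc (by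
    rintro _ ⟨x, hx, rfl⟩
    obtain ⟨e0, e1, e2, e6, e7⟩ := hJ x hx
    refine ⟨?_, e1, e6, e7⟩
    beta_reduce
    rw [e0, e1, e2]; norm_num) A hε
  -- The bound `η` controls the curvature, and `1 / 8` and `ε / 8` the metric itself.
  set η' := min η (min (1 / 8) (ε / 8)) with hη'
  have hη'0 : 0 < η' := by positivity
  have hη'8 : η' ≤ 1 / 8 := (min_le_right _ _).trans (min_le_left _ _)
  have hη'ε : η' ≤ ε / 8 := (min_le_right _ _).trans (min_le_right _ _)
  obtain ⟨δ₁, hδ₁, hδ₁₀, Hδ₁⟩ := exists_strip_close hχc hjc hδ₀ hη'0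
  have hjc1 : ∀ δ ≤ δ₁, ∀ v ∈ strip K δ, ‖jetOf M v - jetOf M (pt 0 (v 1))‖ ≤ η' := by
    intro δ hδ v hv
    rw [← dist_eq_norm]; exact Hδ₁ v (strip_mono hδ hv)
  obtain ⟨δ, hδ, hδδ₀, hδδ₁, Hδ⟩ := HA η' hη'0 δ₁ hδ₁
  set N := corr χ ζ δ M with hN
  have hNsm : ∀ v ∈ ℍ₂ ∩ B, ∀ i j, SmoothNear (fun w => N w i j) v := fun v hv i j =>
    h.corr_smooth hχ hζ hKB δ hv i j
  have hNsymm : ∀ v, N v 1 0 = N v 0 1 := fun v => rfl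
  have hN0 : ∀ v ∈ ℍ₂, v ∉ strip K δ → N v = 0 := fun v hv hvs =>
    corr_eq_zero subset_rfl hζU hδ hv hvs
  have hN0' : ∀ v ∈ ℍ₂, v ∉ strip K δ → ∀ᶠ w in 𝓝[ℍ₂] v, M w - N w = M w := fun v hv hvs => by
    filter_upwards [self_mem_nhdsWithin, mem_nhdsWithin_of_mem_nhds
      ((isCompact_strip hχc δ).isClosed.isOpen_compl.mem_nhds hvs)] with w hw hw'
    rw [hN0 w hw hw', sub_zero]
  -- In the strip the metric is close to the identity matrix.
  have hM8 : ∀ v ∈ strip K δ, |M v 0 0 - 1| ≤ 1 / 8 ∧ |M v 0 1| ≤ 1 / 8 ∧ |M v 1 1 - 1| ≤ 1 / 8 :=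
      by
    intro v hv
    have hv1 := (pi_norm_le_iff_of_nonneg hη'0.le).1 (hjc1 δ hδδ₁ v hv)
    obtain ⟨e0, e1, e2, -, -⟩ := hJ _ hv.2.2
    refine ⟨?_, ?_, ?_⟩
    · have := hv1 0
      rw [Pi.sub_apply, e0] at this
      exact this.trans hη'8
    · have := hv1 1
      rw [Pi.sub_apply, e1, sub_zero] at this
      exact this.trans hη'8
    · have := hv1 2
      rw [Pi.sub_apply, e2] at this
      exact this.trans hη'8
  have hN8 : ∀ v ∈ strip K δ, |N v 0 0| ≤ η' ∧ |N v 0 1| ≤ η' ∧ |N v 1 1| ≤ η' := fun v hv =>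
    ⟨(Hδ v hv).2 0 (by decide), (Hδ v hv).2 1 (by decide), (Hδ v hv).2 2 (by decide)⟩
  have hmet' : ∀ v ∈ ℍ₂ ∩ B, MetricNear (fun w => M w - N w) v := by
    intro v hv
    by_cases hvs : v ∈ strip K δ
    · refine ⟨hv.1, fun i j => ((h.metric v hv).smooth i j).sub (hNsm v hv i j), ?_, ?_⟩
      · filter_upwards [(h.metric v hv).symm] with w hw
        rw [Matrix.sub_apply, Matrix.sub_apply, hw, hNsymm]
      · obtain ⟨m0, m1, m2⟩ := hM8 v hvs
        obtain ⟨n0, n1, n2⟩ := hN8 v hvs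
        rw [Matrix.det_fin_two]
        simp only [Matrix.sub_apply, hNsymm, (h.metric v hv).symm_at]
        rw [abs_le] at m0 m1 m2 n0 n1 n2
        have a1 : 3 / 4 ≤ M v 0 0 - N v 0 0 := by linarith [m0.1, n0.2]
        have a2 : 3 / 4 ≤ M v 1 1 - N v 1 1 := by linarith [m2.1, n2.2]
        have a3 : |M v 0 1 - N v 0 1| ≤ 1 / 4 := by
          rw [abs_le]; constructor <;> linarith [m1.1, m1.2, n1.1, n1.2]
        have a4 := abs_mul_abs_self (M v 0 1 - N v 0 1)
        have := abs_nonneg (M v 0 1 - N v 0 1)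
        nlinarith
    · exact (h.metric v hv).congr (hN0' v hv.1 hvs)
  refine ⟨N, strip K δ, isCompact_strip hχc δ, fun v hv => ⟨strip_subset_half _ _ hv,
    hs (strip_mono hδδ₀ hv)⟩, hN0, hNsymm, hNsm, ?_, ⟨h.isOpen, hmet', ?_⟩, ?_, ?_, ?_⟩
  -- The correction is small relative to the metric: compare both with `s ^ 2 + t ^ 2`.
  · intro v hv s t
    obtain ⟨m0, m1, m2⟩ := hM8 v hv
    obtain ⟨n0, n1, n2⟩ := hN8 v hv
    rw [abs_le] at m0 m1 m2 n0 n1 n2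
    have p := sq_nonneg s
    have q := sq_nonneg t
    have st : |s * t| ≤ (s ^ 2 + t ^ 2) / 2 := by
      rw [abs_le]; constructor <;> nlinarith [sq_nonneg (s + t), sq_nonneg (s - t)]
    rw [abs_le] at st
    have low : (s ^ 2 + t ^ 2) / 2 ≤ M v 0 0 * s ^ 2 + 2 * M v 0 1 * (s * t) + M v 1 1 * t ^ 2 := by
      nlinarith [mul_nonneg (sub_nonneg.2 m1.2) (sub_nonneg.2 st.2),
        mul_nonneg (sub_nonneg.2 m1.1) (sub_nonneg.2 st.2),
        mul_nonneg (sub_nonneg.2 m1.2) (sub_nonneg.2 st.1),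
        mul_nonneg (sub_nonneg.2 m1.1) (sub_nonneg.2 st.1)]
    have up : |N v 0 0 * s ^ 2 + 2 * N v 0 1 * (s * t) + N v 1 1 * t ^ 2|
        ≤ 2 * η' * (s ^ 2 + t ^ 2) := by
      rw [abs_le]
      constructor <;> nlinarith [mul_nonneg (sub_nonneg.2 n1.2) (sub_nonneg.2 st.2),
        mul_nonneg (sub_nonneg.2 n1.1) (sub_nonneg.2 st.2),
        mul_nonneg (sub_nonneg.2 n1.2) (sub_nonneg.2 st.1),
        mul_nonneg (sub_nonneg.2 n1.1) (sub_nonneg.2 st.1)]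
    refine up.trans ?_
    have : 2 * η' * (s ^ 2 + t ^ 2) ≤ ε * ((s ^ 2 + t ^ 2) / 2) := by nlinarith
    exact this.trans (mul_le_mul_of_nonneg_left low hε.le)
  -- The correction does not change the first order data along the boundary.
  · intro x hx
    by_cases hxs : x ∈ K
    · have hm := h.metric_bdry hx
      obtain ⟨-, -, s2⟩ := h.resid_smooth (v := pt 0 x) ⟨hm.mem, hx⟩ hx
      have e := (hasPartial_cut_zero (δ := δ) hχ hζ s2 hm.mem).eq
      have e0 : N (pt 0 x) = 0 := by rw [hN, corr, h.resid_bdry hx, smul_zero]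
      refine ⟨by rw [e0, sub_zero, (h.bdry x hx).1], ?_⟩
      have := ((hm.smooth 1 1).hasPartial hm.mem 0).sub
        (hasPartial_cut_zero (δ := δ) hχ hζ s2 hm.mem)
      refine (this.of_eq ?_).eq
      rw [(h.bdry x hx).2, h.resid_normal_one_one_bdry hx, h.resid_bdry hx]
      simp
    · have hv := pt_mem_half (x := x).2 le_rfl
      have hev := hN0' (pt 0 x) hv fun hc => hxs hc.2.2
      refine ⟨by rw [hev.self_of_nhdsWithin hv, (h.bdry x hx).1], ?_⟩
      refine Eq.trans ?_ (h.bdry x hx).2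
      refine (partialWithin_congr ?_ 0).self_of_nhdsWithin hv
      filter_upwards [hev] with w hw
      rw [hw]
  -- The jet of the correction is split into its entry `3`, which is bounded, and a small part.
  · intro v hv
    rw [(hmet' v hv).coordCurvature_eq_curvJ, (h.metric v hv).coordCurvature_eq_curvJ]
    by_cases hvs : v ∈ strip K δ
    · rw [jetOf_sub hv.1 (h.metric v hv).smooth (hNsm v hv)]
      set j := jetOf M (pt 0 (v 1)) with hj
      set n := jetOf N v with hn
      have hd' : ‖-(Function.update n 3 0)‖ ≤ η := by
        rw [norm_neg, pi_norm_le_iff_of_nonneg hη.le]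
        intro k
        by_cases hk : k = 3
        · subst hk; simp [hη.le]
        · rw [Function.update_of_ne hk]
          exact ((Hδ v hvs).2 k hk).trans (min_le_left _ _)
      have := Hη j ⟨v 1, hvs.2.2, rfl⟩ (jetOf M v - j) (-(Function.update n 3 0)) (-(n 3))
        ((hjc1 δ hδδ₁ v hvs).trans (min_le_left _ _)) hd' (by
          rw [abs_neg]; exact (Hδ v hvs).1)
      have e1 : j + (jetOf M v - j) = jetOf M v := by abel
      have e2 : jetOf M v + -(Function.update n 3 0) + Pi.single 3 (-(n 3)) = jetOf M v - n := by
        ext k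
        by_cases hk : k = 3
        · subst hk; simp; ring
        · simp [hk]; ring
      rwa [e1, e2] at this
    · rw [jetOf_congr hv.1 (hN0' v hv.1 hvs), sub_self, abs_zero]
      exact hε.le
  -- Near `C` both cutoff functions are one, and only the even part of the expansion is left.
  · intro x hx
    have hxB := (hCW x hx).1
    obtain ⟨t0, t1, t2⟩ := h.contDiffAt_even_part hxB
    have hev : ∀ᶠ w in 𝓝 (pt 0 x), ∀ i j, N (foldPt w) i j = resid M (foldPt w) i j := by
      have c1 : Filter.Tendsto (fun w : Plane => foldPt w 1) (𝓝 (pt 0 x)) (𝓝 x) :=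
        (continuous_coord 1).continuousAt
      have c0 : Filter.Tendsto (fun w : Plane => foldPt w 0 / δ) (𝓝 (pt 0 x)) (𝓝 0) := by
        have : Continuous fun w : Plane => foldPt w 0 / δ :=
          ((continuous_coord 0).comp continuous_foldPt).div_const δ
        have := this.tendsto (pt 0 x)
        simpa using this
      filter_upwards [c1.eventually (hχ1 x hx), c0.eventually hζ1] with w h1 h0 i j
      rw [hN, corr_apply, h1, h0, one_mul, one_mul]
    refine ⟨t0.congr_of_eventuallyEq ?_, t1.congr_of_eventuallyEq ?_, t2.congr_of_eventuallyEq ?_⟩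
    all_goals filter_upwards [hev] with w hw; simp only [Matrix.sub_apply, hw]
  -- If `M` is even, so is its residue, and the cutoff by `χ` is independent of the normal
  -- coordinate.
  · intro x hxB he
    obtain ⟨t0, t1, t2⟩ := h.contDiffAt_even_part hxB
    have c0 : Filter.Tendsto (fun w : Plane => foldPt w 0 / δ) (𝓝 (pt 0 x)) (𝓝 0) := by
      have : Continuous fun w : Plane => foldPt w 0 / δ :=
        ((continuous_coord 0).comp continuous_foldPt).div_const δ
      have := this.tendsto (pt 0 x)
      simpa using this
    have hcχ : ContDiffAt ℝ ∞ (fun w : Plane => χ (w 1)) (pt 0 x) :=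
      (hχ.comp (contDiff_coord 1)).contDiffAt
    refine ⟨(he.1.sub (hcχ.mul (he.1.sub t0))).congr_of_eventuallyEq ?_,
      (he.2.1.sub (hcχ.mul (he.2.1.sub t1))).congr_of_eventuallyEq ?_,
      (he.2.2.sub (hcχ.mul (he.2.2.sub t2))).congr_of_eventuallyEq ?_⟩
    all_goals
      filter_upwards [c0.eventually hζ1] with w h0
      simp only [Matrix.sub_apply, hN, corr_apply, h0]
      simp only [foldPt, pt_apply_one]
      ring

end GeodesicChart

/-! ### The inverse function theorem at a boundary point of the half-plane -/

/-- The retraction of the plane onto the half-plane along the first coordinate. -/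
def clampPt (v : Plane) : Plane := pt (max (v 0) 0) (v 1)

lemma clampPt_mem (v : Plane) : clampPt v ∈ ℍ₂ := pt_mem_half.2 (le_max_right _ _)

lemma clampPt_of_mem {v : Plane} (hv : v ∈ ℍ₂) : clampPt v = v := by
  rw [clampPt, max_eq_left (mem_half.1 hv), pt_eta]

lemma norm_clampPt_sub_le (a b : Plane) : ‖clampPt a - clampPt b‖ ≤ ‖a - b‖ := by
  rw [EuclideanSpace.norm_eq, EuclideanSpace.norm_eq]
  apply Real.sqrt_le_sqrt
  simp only [Fin.sum_univ_two, PiLp.sub_apply, clampPt, pt_apply_zero, pt_apply_one,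
      Real.norm_eq_abs]
  gcongr ?_ ^ 2 + _
  exact abs_max_sub_max_le_abs _ _ _

/-- The extension of a map from the half-plane to the plane which is affine, with linear part `L`,
along the outer normals. -/
def affineExt (θ : Plane → Plane) (L : Plane →L[ℝ] Plane) (v : Plane) : Plane :=
  θ (clampPt v) + L (v - clampPt v)

lemma affineExt_of_mem {θ : Plane → Plane} {L : Plane →L[ℝ] Plane} {v : Plane} (hv : v ∈ ℍ₂) :
    affineExt θ L v = θ v := by
  simp [affineExt, clampPt_of_mem hv]

lemma SmoothNear.continuousWithinAt_fderivWithin {θ : Plane → Plane} {u : Plane}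
    (h : SmoothNear θ u) (hu : u ∈ ℍ₂) : ContinuousWithinAt (fderivWithin ℝ θ ℍ₂) ℍ₂ u := by
  have : ContDiffWithinAt ℝ ∞ (fderivWithin ℝ θ ℍ₂) ℍ₂ u :=
    (h.self hu).fderivWithin_right uniqueDiffOn_half (by exact le_rfl) hu
  exact this.continuousWithinAt

/-- The extension is strictly differentiable at `u`, which is all that the inverse function theorem
requires, although it need not be differentiable at other boundary points. -/
lemma SmoothNear.hasStrictFDerivAt_affineExt {θ : Plane → Plane} {u : Plane} (h : SmoothNear θ u)
    (hu : u ∈ ℍ₂) :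
    HasStrictFDerivAt (affineExt θ (fderivWithin ℝ θ ℍ₂ u)) (fderivWithin ℝ θ ℍ₂ u) u := by
  rw [hasStrictFDerivAt_iff_isLittleO, Asymptotics.isLittleO_iff]
  intro c hc
  have h1 : ∀ᶠ w in 𝓝[ℍ₂] u, ContDiffWithinAt ℝ ∞ θ ℍ₂ w ∧
      ‖fderivWithin ℝ θ ℍ₂ w - fderivWithin ℝ θ ℍ₂ u‖ ≤ c := by
    have h2 := (h.continuousWithinAt_fderivWithin hu).eventually (Metric.closedBall_mem_nhds _ hc)
    filter_upwards [h, h2] with w hw hw2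
    exact ⟨hw, by rwa [dist_eq_norm] at hw2⟩
  obtain ⟨r, hr, hB⟩ := Metric.mem_nhdsWithin_iff.1 h1
  have hs : Convex ℝ (ℍ₂ ∩ Metric.ball u r) := by
    refine Convex.inter ?_ (convex_ball _ _)
    exact (𝓡∂ 2).convex_range
  have hev : ∀ᶠ a in 𝓝 u, a ∈ Metric.ball u r := Metric.ball_mem_nhds u hr
  have key : ∀ a ∈ Metric.ball u r, clampPt a ∈ ℍ₂ ∩ Metric.ball u r := by
    intro a ha
    refine ⟨clampPt_mem a, ?_⟩
    rw [Metric.mem_ball, dist_eq_norm] at ha ⊢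
    have := norm_clampPt_sub_le a u
    rw [clampPt_of_mem hu] at this
    exact this.trans_lt ha
  have hev2 : ∀ᶠ p in 𝓝 (u, u), p.1 ∈ Metric.ball u r ∧ p.2 ∈ Metric.ball u r := by
    rw [nhds_prod_eq]; exact hev.prod_mk hev
  filter_upwards [hev2] with p hp
  -- The mean value inequality within the half-plane, for the clamped points.
  have hmv := hs.norm_image_sub_le_of_norm_hasFDerivWithin_le' (f := θ)
    (f' := fun w => fderivWithin ℝ θ ℍ₂ w) (φ := fderivWithin ℝ θ ℍ₂ u) (C := c)
    (fun w hw => by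
      have hw' : ContDiffWithinAt ℝ ∞ θ ℍ₂ w := (hB ⟨hw.2, hw.1⟩).1
      exact ((hw'.differentiableWithinAt (by simp)).hasFDerivWithinAt).mono inter_subset_left)
    (fun w hw => (hB ⟨hw.2, hw.1⟩).2) (key _ hp.2) (key _ hp.1)
  refine le_trans (le_of_eq ?_) (hmv.trans (mul_le_mul_of_nonneg_left (norm_clampPt_sub_le _ _)
      hc.le))
  congr 1
  simp only [affineExt, map_sub]
  abel

lemma SmoothNear.partialWithin_apply {θ : Plane → Plane} {u : Plane} (h : SmoothNear θ u)
    (hu : u ∈ ℍ₂) (i k : Fin 2) :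
    partialWithin ℍ₂ i (fun w => θ w k) u = fderivWithin ℝ θ ℍ₂ u (stdVec i) k := by
  have := ((EuclideanSpace.proj k : Plane →L[ℝ] ℝ).hasFDerivAt.comp_hasFDerivWithinAt u
      (h.diff hu).hasFDerivWithinAt).fderivWithin (uniqueDiffOn_half u hu)
  have h2 : fderivWithin ℝ (fun w => θ w k) ℍ₂ u
      = (EuclideanSpace.proj k : Plane →L[ℝ] ℝ).comp (fderivWithin ℝ θ ℍ₂ u) := this
  rw [partialWithin, h2]; rfl

/-- A continuous inverse of a smooth map with invertible differentials is smooth, relative to sets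
with unique differentials. -/
lemma contDiffOn_of_leftInverse {f g : Plane → Plane} {s t : Set Plane}
    (ht : UniqueDiffOn ℝ t) (hs : UniqueDiffOn ℝ s) (hf : ContDiffOn ℝ ∞ f s) (hg : ContinuousOn g
        t)
    (hgm : MapsTo g t s) (hfg : ∀ y ∈ t, f (g y) = y)
    (hinv : ∀ w ∈ s, (fderivWithin ℝ f s w).IsInvertible) : ContDiffOn ℝ ∞ g t := by
  have hder : ∀ y ∈ t, HasFDerivWithinAt g (fderivWithin ℝ f s (g y)).inverse t y := by
    intro y hy
    obtain ⟨e, he⟩ := hinv _ (hgm hy)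
    rw [← he, ContinuousLinearMap.inverse_equiv]
    refine HasFDerivWithinAt.of_local_left_inverse (t := s) (f := f) ?_ ?_ hy ?_
    · exact tendsto_nhdsWithin_iff.2 ⟨hg y hy,
        Filter.eventually_of_mem self_mem_nhdsWithin fun z hz => hgm hz⟩
    · rw [he]
      exact ((hf _ (hgm hy)).differentiableWithinAt (by simp)).hasFDerivWithinAt
    · exact Filter.eventually_of_mem self_mem_nhdsWithin hfg
  -- The differential of `g` is a smooth function of `g`, which allows induction on the order.
  rw [contDiffOn_infty]
  intro n
  induction n with
  | zero => exact contDiffOn_zero.2 hg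
  | succ n ih =>
    push_cast
    refine contDiffOn_succ_of_fderivWithin (fun y hy => (hder y hy).differentiableWithinAt)
      (fun h => absurd h (by simp)) ?_
    have h1 : ContDiffOn ℝ n (fun y => (fderivWithin ℝ f s (g y)).inverse) t := by
      intro y hy
      have h2 : ContDiffWithinAt ℝ n (fderivWithin ℝ f s) s (g y) :=
        ((hf _ (hgm hy)).fderivWithin_right (m := ∞) hs (by exact le_rfl) (hgm hy)).of_le
          (by exact_mod_cast le_top)
      have h3 := h2.comp y (ih y hy) hgm
      exact ((hinv _ (hgm hy)).contDiffAt_map_inverse).comp_contDiffWithinAt y h3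
    exact h1.congr fun y hy => (hder y hy).fderivWithin (ht y hy)

/-- A smooth map of the half-plane into itself which preserves the boundary line and has an
invertible derivative at a boundary point restricts to a local diffeomorphism. It is extended to the
plane by a map which is affine in the normal direction outside the half-plane; this extension
preserves the two sides of the boundary line, and the usual inverse function theorem applies to it.
-/
theorem exists_halfPlane_diffeomorph {θ : Plane → Plane} {u : Plane} (hu : u 0 = 0)
    (hθ : SmoothNear θ u) (h0 : ∀ᶠ x in 𝓝 (u 1), θ (pt 0 x) 0 = 0)
    (hn : ∀ᶠ w in 𝓝[ℍ₂] u, 0 ≤ θ w 0) (ha : 0 < partialWithin ℍ₂ 0 (fun w => θ w 0) u)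
    (hb : partialWithin ℍ₂ 1 (fun w => θ w 1) u ≠ 0) {O : Set Plane} (hO : O ∈ 𝓝 u) :
    ∃ E : OpenPartialHomeomorph (EuclideanHalfSpace 2) (EuclideanHalfSpace 2),
      E ∈ contDiffGroupoid ∞ (𝓡∂ 2) ∧ (𝓡∂ 2).symm u ∈ E.source ∧
      (∀ z ∈ E.source, (𝓡∂ 2) z ∈ O) ∧ ∀ z ∈ E.source, (𝓡∂ 2) (E z) = θ ((𝓡∂ 2) z) := by
  have huH : u ∈ ℍ₂ := mem_half.2 hu.ge
  have hupt : u = pt 0 (u 1) := by rw [← hu, pt_eta]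
  set L := fderivWithin ℝ θ ℍ₂ u with hL
  rw [hθ.partialWithin_apply huH] at ha hb
  -- The differential is triangular, as the boundary line is preserved, and so invertible.
  have h10 : L (stdVec 1) 0 = 0 := by
    rw [hL, ← hθ.partialWithin_apply huH, hupt]
    refine partial_one_eq_zero ?_ h0
    rw [← hupt]
    exact (hθ.apply 0).diff huH
  have hLinj : Function.Injective (L : Plane →ₗ[ℝ] Plane) := by
    rw [← LinearMap.ker_eq_bot, LinearMap.ker_eq_bot']
    intro v hv
    have hv' : L v = 0 := hv
    rw [plane_eq_sum v, map_add, map_smul, map_smul] at hv'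
    have e0 := congrArg (fun w : Plane => w 0) hv'
    have e1 := congrArg (fun w : Plane => w 1) hv'
    simp only [PiLp.add_apply, PiLp.smul_apply, smul_eq_mul, h10, mul_zero, add_zero,
      PiLp.zero_apply] at e0 e1
    have v0 : v 0 = 0 := (mul_eq_zero.1 e0).resolve_right ha.ne'
    rw [v0, zero_mul, zero_add] at e1
    have v1 : v 1 = 0 := (mul_eq_zero.1 e1).resolve_right hb
    ext i; fin_cases i <;> simp [v0, v1]
  let Le : Plane ≃L[ℝ] Plane :=
    (LinearEquiv.ofInjectiveEndo (L : Plane →ₗ[ℝ] Plane) hLinj).toContinuousLinearEquiv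
  have hLe : (Le : Plane →L[ℝ] Plane) = L := by ext v : 1; rfl
  have hstrict : HasStrictFDerivAt (affineExt θ L) (Le : Plane →L[ℝ] Plane) u := by
    rw [hLe]; exact hθ.hasStrictFDerivAt_affineExt huH
  have hinv : ∀ᶠ w in 𝓝[ℍ₂] u, (fderivWithin ℝ θ ℍ₂ w).IsInvertible := by
    have h2 : ∀ᶠ T in 𝓝 (fderivWithin ℝ θ ℍ₂ u), T.IsInvertible := by
      rw [← hL, ← hLe]
      exact Le.nhds
    exact (hθ.continuousWithinAt_fderivWithin huH).eventually h2
  have hgood : ∀ᶠ w in 𝓝[ℍ₂] u, ContDiffWithinAt ℝ ∞ θ ℍ₂ w ∧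
      (fderivWithin ℝ θ ℍ₂ w).IsInvertible ∧ 0 ≤ θ w 0 := hθ.and (hinv.and hn)
  rw [eventually_nhdsWithin_iff] at hgood
  have hline : ∀ᶠ w : Plane in 𝓝 u, θ (pt 0 (w 1)) 0 = 0 :=
    ((continuous_coord 1).tendsto u).eventually h0
  obtain ⟨r, hr, hB⟩ := Metric.eventually_nhds_iff_ball.1 (hgood.and (hline.and hO))
  set Φ := (hstrict.toOpenPartialHomeomorph _).restrOpen (Metric.ball u r) Metric.isOpen_ball with
      hΦ
  have hΦs : ∀ v ∈ Φ.source, v ∈ Metric.ball u r := fun v hv => by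
    rw [hΦ, OpenPartialHomeomorph.restrOpen_source] at hv; exact hv.2
  have huΦ : u ∈ Φ.source := by
    rw [hΦ, OpenPartialHomeomorph.restrOpen_source]
    exact ⟨hstrict.mem_toOpenPartialHomeomorph_source, Metric.mem_ball_self hr⟩
  have hΦe : ∀ v, Φ v = affineExt θ L v := fun v => rfl
  -- Outside the half-plane the first coordinate of the extension is `v 0 * L (stdVec 0) 0 < 0`.
  have hside : ∀ v ∈ Φ.source, Φ v ∈ ℍ₂ ↔ v ∈ ℍ₂ := by
    intro v hv
    have hv' := hB v (hΦs v hv)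
    constructor
    · intro h
      by_contra hc
      rw [mem_half, not_le] at hc
      have h1 : Φ v 0 = v 0 * L (stdVec 0) 0 := by
        have h2 : clampPt v = pt 0 (v 1) := by rw [clampPt, max_eq_right hc.le]
        have h3 : v - pt 0 (v 1) = v 0 • stdVec 0 := by
          ext i; fin_cases i <;> simp [stdVec, pt]
        rw [hΦe, affineExt, h2, h3]
        simp [hv'.2.1]
      have h4 := mem_half.1 h
      rw [h1] at h4
      nlinarith [mul_neg_of_neg_of_pos hc ha]
    · intro h
      rw [hΦe, affineExt_of_mem h]
      exact mem_half.2 (hv'.1 h).2.2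
  have hside' : ∀ v ∈ Φ.target, Φ.symm v ∈ ℍ₂ ↔ v ∈ ℍ₂ := by
    intro v hv
    rw [← hside _ (Φ.map_target hv), Φ.right_inv hv]
  have hI : ∀ z, (𝓡∂ 2) z ∈ ℍ₂ := fun z => mem_range_self z
  let E : OpenPartialHomeomorph (EuclideanHalfSpace 2) (EuclideanHalfSpace 2) :=
    { toFun := fun z => (𝓡∂ 2).symm (Φ ((𝓡∂ 2) z))
      invFun := fun z => (𝓡∂ 2).symm (Φ.symm ((𝓡∂ 2) z))
      source := (𝓡∂ 2) ⁻¹' Φ.source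
      target := (𝓡∂ 2) ⁻¹' Φ.target
      map_source' := by
        intro z hz
        rw [mem_preimage, (𝓡∂ 2).right_inv ((hside _ hz).2 (hI z))]
        exact Φ.map_source hz
      map_target' := by
        intro z hz
        rw [mem_preimage, (𝓡∂ 2).right_inv ((hside' _ hz).2 (hI z))]
        exact Φ.map_target hz
      left_inv' := by
        intro z hz
        rw [(𝓡∂ 2).right_inv ((hside _ hz).2 (hI z)), Φ.left_inv hz, (𝓡∂ 2).left_inv]
      right_inv' := by
        intro z hz
        rw [(𝓡∂ 2).right_inv ((hside' _ hz).2 (hI z)), Φ.right_inv hz, (𝓡∂ 2).left_inv]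
      open_source := Φ.open_source.preimage (𝓡∂ 2).continuous
      open_target := Φ.open_target.preimage (𝓡∂ 2).continuous
      continuousOn_toFun := (𝓡∂ 2).continuous_symm.comp_continuousOn
        (Φ.continuousOn.comp (𝓡∂ 2).continuous.continuousOn fun z hz => hz)
      continuousOn_invFun := (𝓡∂ 2).continuous_symm.comp_continuousOn
        (Φ.symm.continuousOn.comp (𝓡∂ 2).continuous.continuousOn fun z hz => hz) }
  have hEθ : ∀ z ∈ E.source, (𝓡∂ 2) (E z) = θ ((𝓡∂ 2) z) := by
    intro z hz
    change (𝓡∂ 2) ((𝓡∂ 2).symm (Φ ((𝓡∂ 2) z))) = _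
    rw [(𝓡∂ 2).right_inv ((hside _ hz).2 (hI z)), hΦe, affineExt_of_mem (hI z)]
  have hsub : ContDiffOn ℝ ∞ θ (Φ.source ∩ ℍ₂) := fun w hw =>
    ((hB w (hΦs w hw.1)).1 hw.2).1.mono inter_subset_right
  have hud : UniqueDiffOn ℝ (Φ.source ∩ ℍ₂) := by
    rw [inter_comm]; exact uniqueDiffOn_half.inter Φ.open_source
  have hud' : UniqueDiffOn ℝ (Φ.target ∩ ℍ₂) := by
    rw [inter_comm]; exact uniqueDiffOn_half.inter Φ.open_target
  refine ⟨E, ?_, ?_, fun z hz => (hB _ (hΦs _ hz)).2.2, hEθ⟩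
  · rw [contDiffGroupoid, mem_groupoid_of_pregroupoid]
    constructor
    · have hss : (𝓡∂ 2).symm ⁻¹' E.source ∩ ℍ₂ = Φ.source ∩ ℍ₂ := by
        ext w
        refine and_congr_left fun hw => ?_
        change (𝓡∂ 2) ((𝓡∂ 2).symm w) ∈ Φ.source ↔ _
        rw [(𝓡∂ 2).right_inv hw]
      change ContDiffOn ℝ ∞ ((𝓡∂ 2) ∘ E ∘ (𝓡∂ 2).symm) ((𝓡∂ 2).symm ⁻¹' E.source ∩ ℍ₂)
      refine (hsub.mono hss.subset).congr fun w hw => ?_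
      simp only [Function.comp_apply]
      rw [hEθ _ hw.1, (𝓡∂ 2).right_inv hw.2]
    · have hss : (𝓡∂ 2).symm ⁻¹' E.target ∩ ℍ₂ = Φ.target ∩ ℍ₂ := by
        ext w
        refine and_congr_left fun hw => ?_
        change (𝓡∂ 2) ((𝓡∂ 2).symm w) ∈ Φ.target ↔ _
        rw [(𝓡∂ 2).right_inv hw]
      change ContDiffOn ℝ ∞ ((𝓡∂ 2) ∘ E.symm ∘ (𝓡∂ 2).symm) ((𝓡∂ 2).symm ⁻¹' E.target ∩ ℍ₂)
      rw [hss]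
      have hsymm : ContDiffOn ℝ ∞ Φ.symm (Φ.target ∩ ℍ₂) := by
        refine contDiffOn_of_leftInverse hud' hud hsub (Φ.symm.continuousOn.mono inter_subset_left)
          (fun y hy => ⟨Φ.map_target hy.1, (hside' _ hy.1).2 hy.2⟩) ?_ ?_
        · intro y hy
          rw [← affineExt_of_mem (θ := θ) (L := L) ((hside' _ hy.1).2 hy.2), ← hΦe, Φ.right_inv
              hy.1]
        · intro w hw
          rw [inter_comm, fderivWithin_inter (Φ.open_source.mem_nhds hw.1)]
          exact ((hB w (hΦs w hw.1)).1 hw.2).2.1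
      refine hsymm.congr fun w hw => ?_
      change (𝓡∂ 2) ((𝓡∂ 2).symm (Φ.symm ((𝓡∂ 2) ((𝓡∂ 2).symm w)))) = _
      rw [(𝓡∂ 2).right_inv hw.2, (𝓡∂ 2).right_inv ((hside' _ hw.1).2 hw.2)]
  · change (𝓡∂ 2) ((𝓡∂ 2).symm u) ∈ Φ.source
    rw [(𝓡∂ 2).right_inv huH]; exact huΦ

/-! ### Maps which are isometric to first order along the boundary -/

/-- Near the boundary point `(0, a)`, the map `Θ` sends the half-plane to itself and the boundary
line to itself, and its differential at boundary points is an isometry from the metric `M` to the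
Euclidean metric. -/
structure AdaptedNear (M : Plane → Matrix (Fin 2) (Fin 2) ℝ) (Θ : Plane → Plane) (a : ℝ) :
    Prop where
  smooth : SmoothNear Θ (pt 0 a)
  nonneg : ∀ᶠ w in 𝓝[ℍ₂] (pt 0 a), 0 ≤ Θ w 0
  zero : ∀ᶠ x in 𝓝 a, Θ (pt 0 x) 0 = 0
  isom : ∀ᶠ x in 𝓝 a, ∀ i j, M (pt 0 x) i j = ∑ k, partialWithin ℍ₂ i (fun w => Θ w k) (pt 0 x)
    * partialWithin ℍ₂ j (fun w => Θ w k) (pt 0 x)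

lemma pt_zero_mem (x : ℝ) : pt 0 x ∈ ℍ₂ := pt_mem_half.2 le_rfl

lemma tendsto_pt_zero (a : ℝ) : Filter.Tendsto (fun x => pt 0 x) (𝓝 a) (𝓝[ℍ₂] (pt 0 a)) :=
  tendsto_nhdsWithin_iff.2 ⟨(continuous_pt continuous_const continuous_id).tendsto a,
    Filter.Eventually.of_forall pt_zero_mem⟩

lemma SmoothNear.contDiffAt_boundary {f : Plane → ℝ} {a : ℝ} (h : SmoothNear f (pt 0 a)) :
    ∀ᶠ x in 𝓝 a, ContDiffAt ℝ ∞ (fun x => f (pt 0 x)) x := by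
  filter_upwards [(tendsto_pt_zero a).eventually h] with x hx
  have h1 : ContDiffWithinAt ℝ ∞ (fun x => pt 0 x) univ x :=
    (contDiff_pt contDiff_const contDiff_id).contDiffAt
  exact ContDiffWithinAt.comp (t := ℍ₂) x hx h1 (fun y _ => pt_zero_mem y)

lemma SmoothNear.of_contDiffAt_coord {q : ℝ → ℝ} {v : Plane} (k : Fin 2)
    (h : ∀ᶠ x in 𝓝 (v k), ContDiffAt ℝ ∞ q x) : SmoothNear (fun w => q (w k)) v := by
  apply SmoothNear.of_contDiffAt
  filter_upwards [((continuous_coord k).tendsto v).eventually h] with w hw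
  exact ContDiffAt.comp w hw (contDiff_coord k).contDiffAt

lemma SmoothNear.pt {f g : Plane → ℝ} {v : Plane} (hf : SmoothNear f v) (hg : SmoothNear g v) :
    SmoothNear (fun w => pt (f w) (g w)) v := by
  simp only [pt_eq]
  filter_upwards [hf, hg] with w h1 h2
  exact (h1.smul contDiffWithinAt_const).add (h2.smul contDiffWithinAt_const)

/-- A germ of a smooth function has a primitive which is smooth on the whole line. -/
lemma exists_smooth_primitive {q : ℝ → ℝ} {a : ℝ} (h : ∀ᶠ x in 𝓝 a, ContDiffAt ℝ ∞ q x) :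
    ∃ s : ℝ → ℝ, ContDiff ℝ ∞ s ∧ ∀ᶠ x in 𝓝 a, HasDerivAt s (q x) x := by
  obtain ⟨U, hU, hUo, haU⟩ := eventually_nhds_iff.1 h
  obtain ⟨χ, hχ, h1, hc, hs, -⟩ := exists_cutoff (C := {a}) isCompact_singleton hUo
    (singleton_subset_iff.2 haU)
  have hQ : ContDiff ℝ ∞ (fun x => χ x * q x) := by
    rw [contDiff_iff_contDiffAt]
    intro x
    by_cases hx : x ∈ tsupport χ
    · exact hχ.contDiffAt.mul (hU x (hs hx))
    · have : (fun x => χ x * q x) =ᶠ[𝓝 x] fun _ => 0 := by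
        filter_upwards [(isClosed_tsupport χ).isOpen_compl.mem_nhds hx] with y hy
        rw [image_eq_zero_of_notMem_tsupport hy, zero_mul]
      exact contDiffAt_const.congr_of_eventuallyEq this
  have hd : ∀ x, HasDerivAt (fun x => ∫ t in a..x, χ t * q t) (χ x * q x) x := fun x =>
    intervalIntegral.integral_hasDerivAt_right (hQ.continuous.intervalIntegrable _ _)
      (hQ.continuous.stronglyMeasurableAtFilter _ _) hQ.continuous.continuousAt
  refine ⟨fun x => ∫ t in a..x, χ t * q t, ?_, ?_⟩
  · rw [contDiff_infty_iff_deriv]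
    refine ⟨fun x => (hd x).differentiableAt, ?_⟩
    rwa [show deriv (fun x => ∫ t in a..x, χ t * q t) = fun x => χ x * q x from
      funext fun x => (hd x).deriv]
  · filter_upwards [h1 a rfl] with x hx
    simpa [hx] using hd x

namespace AdaptedNear

variable {M M' : Plane → Matrix (Fin 2) (Fin 2) ℝ} {Θ Θ' : Plane → Plane} {a : ℝ}

lemma eventually (h : AdaptedNear M Θ a) : ∀ᶠ x in 𝓝 a, AdaptedNear M Θ x := by
  filter_upwards [(tendsto_pt_zero a).eventually h.smooth.eventually,
    (tendsto_pt_zero a).eventually (eventually_eventually_nhdsWithin.2 h.nonneg),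
    eventually_eventually_nhds.2 h.zero, eventually_eventually_nhds.2 h.isom] with x h1 h2 h3 h4
  exact ⟨h1, h2, h3, h4⟩

lemma partial_one_zero (h : AdaptedNear M Θ a) :
    ∀ᶠ x in 𝓝 a, partialWithin ℍ₂ 1 (fun w => Θ w 0) (pt 0 x) = 0 := by
  filter_upwards [h.eventually] with x hx
  exact partial_one_eq_zero ((hx.smooth.apply 0).diff (pt_zero_mem x)) hx.zero

lemma partial_zero_nonneg (h : AdaptedNear M Θ a) :
    0 ≤ partialWithin ℍ₂ 0 (fun w => Θ w 0) (pt 0 a) := by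
  have hd := hasDerivWithinAt_normal ((h.smooth.apply 0).diff (pt_zero_mem a))
  refine ge_of_tendsto (x := 𝓝[>] (0 : ℝ)) (f := slope (fun t => Θ (pt t a) 0) 0)
    ((hasDerivWithinAt_iff_tendsto_slope' (by simp)).1 (hd.mono Ioi_subset_Ici_self)) ?_
  have hn : ∀ᶠ t in 𝓝[>] (0 : ℝ), 0 ≤ Θ (pt t a) 0 := by
    have : Filter.Tendsto (fun t : ℝ => pt t a) (𝓝[>] 0) (𝓝[ℍ₂] (pt 0 a)) :=
      tendsto_nhdsWithin_iff.2
        ⟨((continuous_pt continuous_id continuous_const).tendsto 0).mono_left nhdsWithin_le_nhds,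
        Filter.eventually_of_mem self_mem_nhdsWithin fun t ht => pt_mem_half.2 (le_of_lt ht)⟩
    exact this.eventually h.nonneg
  filter_upwards [hn, self_mem_nhdsWithin] with t ht htp
  rw [slope_def_field, h.zero.self_of_nhds, sub_zero, sub_zero]
  exact div_nonneg ht (le_of_lt htp)

lemma jac_eq (h : AdaptedNear M Θ a) (hM : (M (pt 0 a)).det ≠ 0) :
    0 < partialWithin ℍ₂ 0 (fun w => Θ w 0) (pt 0 a) ∧
      partialWithin ℍ₂ 1 (fun w => Θ w 1) (pt 0 a) ≠ 0 := by
  have h1 := h.isom.self_of_nhds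
  have h0 := h.partial_one_zero.self_of_nhds
  rw [Matrix.det_fin_two] at hM
  simp only [h1, Fin.sum_univ_two, h0] at hM
  constructor
  · refine lt_of_le_of_ne h.partial_zero_nonneg fun he => hM ?_
    rw [← he]; ring
  · intro he
    apply hM
    rw [he]; ring

/-- Adapted maps exist near every boundary point: along the boundary, arc length `s` is the second
coordinate, and `(c, d)` is the image of `∂₀`, given by the Gram-Schmidt process. -/
theorem exists_adapted (hM : MetricNear M (pt 0 a)) (h00 : 0 < M (pt 0 a) 1 1)
    (hdet : 0 < (M (pt 0 a)).det) : ∃ Θ, AdaptedNear M Θ a := by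
  set m : Fin 2 → Fin 2 → ℝ → ℝ := fun i j x => M (pt 0 x) i j with hm
  have hsm : ∀ i j, ∀ᶠ x in 𝓝 a, ContDiffAt ℝ ∞ (m i j) x := fun i j =>
    (hM.smooth i j).contDiffAt_boundary
  have hsymm : ∀ᶠ x in 𝓝 a, m 1 0 x = m 0 1 x := (tendsto_pt_zero a).eventually hM.symm
  have hpos : ∀ᶠ x in 𝓝 a, 0 < m 1 1 x :=
    (hsm 1 1).self_of_nhds.continuousAt.eventually (lt_mem_nhds h00)
  set σ : ℝ → ℝ := fun x => √(m 1 1 x) with hσ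
  set d : ℝ → ℝ := fun x => m 0 1 x / σ x with hd
  set e : ℝ → ℝ := fun x => m 0 0 x - d x ^ 2 with he
  set c : ℝ → ℝ := fun x => √(e x) with hc
  have hσs : ∀ᶠ x in 𝓝 a, ContDiffAt ℝ ∞ σ x := by
    filter_upwards [hsm 1 1, hpos] with x h1 h2 using h1.sqrt h2.ne'
  have hds : ∀ᶠ x in 𝓝 a, ContDiffAt ℝ ∞ d x := by
    filter_upwards [hsm 0 1, hσs, hpos] with x h1 h2 h3
    exact h1.div h2 (Real.sqrt_pos.2 h3).ne'
  have hes : ∀ᶠ x in 𝓝 a, ContDiffAt ℝ ∞ e x := by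
    filter_upwards [hsm 0 0, hds] with x h1 h2 using h1.sub (h2.pow 2)
  have hepos : ∀ᶠ x in 𝓝 a, 0 < e x := by
    refine hes.self_of_nhds.continuousAt.eventually (lt_mem_nhds ?_)
    have h1 := hsymm.self_of_nhds
    rw [Matrix.det_fin_two] at hdet
    simp only [he, hd, hσ, div_pow, Real.sq_sqrt h00.le, hm] at h1 ⊢
    rw [h1] at hdet
    rw [sub_pos, div_lt_iff₀ h00]
    linarith
  have hcs : ∀ᶠ x in 𝓝 a, ContDiffAt ℝ ∞ c x := by
    filter_upwards [hes, hepos] with x h1 h2 using h1.sqrt h2.ne'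
  obtain ⟨s, hs, hsd⟩ := exists_smooth_primitive hσs
  refine ⟨fun w => pt (w 0 * c (w 1)) (s (w 1) + w 0 * d (w 1)), ?_, ?_, ?_, ?_⟩
  · refine SmoothNear.pt ((SmoothNear.coord 0).mul (SmoothNear.of_contDiffAt_coord 1 hcs)) ?_
    exact (SmoothNear.of_contDiffAt_coord 1 (Filter.Eventually.of_forall fun x =>
        hs.contDiffAt)).add
      ((SmoothNear.coord 0).mul (SmoothNear.of_contDiffAt_coord 1 hds))
  · filter_upwards [self_mem_nhdsWithin] with w hw
    exact mul_nonneg (mem_half.1 hw) (Real.sqrt_nonneg _)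
  · filter_upwards with x
    simp
  -- Along the boundary the Jacobian matrix has columns `(c, d)` and `(0, σ)`.
  · filter_upwards [hsymm, hpos, hepos, hsd, hcs, hds] with x h1 h2 h3 h4 h5 h6
    have hx := pt_zero_mem x
    have hcd : DifferentiableAt ℝ c (pt 0 x 1) := h5.differentiableAt (by simp)
    have hdd : DifferentiableAt ℝ d (pt 0 x 1) := h6.differentiableAt (by simp)
    have hsd' : DifferentiableAt ℝ s (pt 0 x 1) := h4.differentiableAt
    have p0 : ∀ i : Fin 2, HasPartial i (fun w : Plane => w 0 * c (w 1))
        (if i = 0 then c x else 0) (pt 0 x) := fun i =>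
      ((HasPartial.coord hx 0).mul (HasPartial.of_coord hx hcd)).of_eq (by
        fin_cases i <;> simp)
    have p1 : ∀ i : Fin 2, HasPartial i (fun w : Plane => s (w 1) + w 0 * d (w 1))
        (if i = 0 then d x else σ x) (pt 0 x) := fun i =>
      ((HasPartial.of_coord hx hsd').add
        ((HasPartial.coord hx 0).mul (HasPartial.of_coord hx hdd))).of_eq (by
        fin_cases i <;> simp [h4.deriv])
    have q0 := fun i => (p0 i).eq
    have q1 := fun i => (p1 i).eq
    have s1 : σ x ^ 2 = m 1 1 x := Real.sq_sqrt h2.le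
    have s2 : c x ^ 2 = e x := Real.sq_sqrt h3.le
    have s3 : d x * σ x = m 0 1 x := div_mul_cancel₀ _ (Real.sqrt_pos.2 h2).ne'
    have s4 : e x = m 0 0 x - d x ^ 2 := rfl
    intro i j
    simp only [Fin.sum_univ_two, pt_apply_zero, pt_apply_one, q0, q1]
    change m i j x = _
    fin_cases i <;> fin_cases j <;> simp <;> linarith

/-- An adapted map is pulled back to an adapted map. -/
theorem comp {θ : Plane → Plane} {b : ℝ} (h : AdaptedNear M Θ (θ (pt 0 b) 1))
    (hp : PullbackNear M M' θ (pt 0 b)) (h0 : ∀ᶠ x in 𝓝 b, θ (pt 0 x) 0 = 0) :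
    AdaptedNear M' (fun w => Θ (θ w)) b := by
  have hb : θ (pt 0 b) = pt 0 (θ (pt 0 b) 1) := by
    conv_lhs => rw [← pt_eta (θ (pt 0 b)), h0.self_of_nhds]
  have hθ1 : ∀ᶠ x in 𝓝 b, θ (pt 0 x) = pt 0 (θ (pt 0 x) 1) := by
    filter_upwards [h0] with x hx
    conv_lhs => rw [← pt_eta (θ (pt 0 x)), hx]
  have ht : Filter.Tendsto (fun x => θ (pt 0 x) 1) (𝓝 b) (𝓝 (θ (pt 0 b) 1)) :=
    (hp.smooth.apply 1).contDiffAt_boundary.self_of_nhds.continuousAt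
  have hsm : SmoothNear Θ (θ (pt 0 b)) := by rw [hb]; exact h.smooth
  refine ⟨hsm.comp hp.smooth hp.pull.mem hp.maps, ?_, ?_, ?_⟩
  · have h1 : ∀ᶠ w in 𝓝[ℍ₂] (θ (pt 0 b)), 0 ≤ Θ w 0 := by rw [hb]; exact h.nonneg
    exact hp.tendsto.eventually h1
  · filter_upwards [ht.eventually h.zero, hθ1] with x h1 h2
    rw [h2]; exact h1
  · filter_upwards [ht.eventually h.isom, hθ1, (tendsto_pt_zero b).eventually hp.eventually,
      ht.eventually h.eventually] with x h1 h2 h3 h4 i j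
    have hc : ∀ i k, partialWithin ℍ₂ i (fun w => Θ (θ w) k) (pt 0 x) = _ := fun i k =>
      (h3.hasPartial_comp (f := fun w => Θ w k) (by rw [h2]; exact h4.smooth.apply k) i).eq
    rw [h3.eq_at]
    simp only [hc]
    simp only [Fin.sum_univ_two]
    rw [h2]
    simp only [h1, Fin.sum_univ_two]
    ring

/-- Two adapted maps differ, along the boundary line, by an isometry of this line. -/
theorem exists_isometry (h : AdaptedNear M Θ a) (h' : AdaptedNear M Θ' a) (hM : 0 < M (pt 0 a) 1
    1) :
    ∃ τ c : ℝ, τ ^ 2 = 1 ∧ ∀ᶠ x in 𝓝 a, Θ' (pt 0 x) 1 = τ * Θ (pt 0 x) 1 + c := by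
  have key : ∀ {Θ : Plane → Plane}, AdaptedNear M Θ a →
      ContinuousAt (fun x => partialWithin ℍ₂ 1 (fun w => Θ w 1) (pt 0 x)) a ∧ ∀ᶠ x in 𝓝 a,
      HasDerivAt (fun x => Θ (pt 0 x) 1) (partialWithin ℍ₂ 1 (fun w => Θ w 1) (pt 0 x)) x ∧
      partialWithin ℍ₂ 1 (fun w => Θ w 1) (pt 0 x) ^ 2 = M (pt 0 x) 1 1 := by
    intro Θ h
    refine ⟨((h.smooth.apply 1).partial_ 1).contDiffAt_boundary.self_of_nhds.continuousAt, ?_⟩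
    filter_upwards [h.eventually, h.isom, h.partial_one_zero] with x h1 h2 h3
    refine ⟨hasDerivAt_tangential ((h1.smooth.apply 1).diff (pt_zero_mem x)), ?_⟩
    rw [h2, Fin.sum_univ_two, h3]; ring
  -- The tangential derivatives have the same square `M₁₁`, hence agree up to a sign `τ`, which is
  -- locally constant by continuity.
  obtain ⟨c1, e1⟩ := key h
  obtain ⟨c2, e2⟩ := key h'
  set p := fun x => partialWithin ℍ₂ 1 (fun w => Θ w 1) (pt 0 x)
  set q := fun x => partialWithin ℍ₂ 1 (fun w => Θ' w 1) (pt 0 x)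
  have hp : p a ^ 2 = M (pt 0 a) 1 1 := e1.self_of_nhds.2
  have hq : q a ^ 2 = M (pt 0 a) 1 1 := e2.self_of_nhds.2
  have hp0 : p a ≠ 0 := by intro h0; rw [h0] at hp; simp at hp; linarith
  have hq0 : q a ≠ 0 := by intro h0; rw [h0] at hq; simp at hq; linarith
  obtain ⟨τ, hτ, hpos⟩ : ∃ τ : ℝ, τ ^ 2 = 1 ∧ 0 < τ * (p a * q a) := by
    rcases lt_or_gt_of_ne (mul_ne_zero hp0 hq0) with h | h
    · exact ⟨-1, by norm_num, by linarith⟩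
    · exact ⟨1, by norm_num, by linarith⟩
  have hev : ∀ᶠ x in 𝓝 a, q x = τ * p x := by
    have h3 : ∀ᶠ x in 𝓝 a, 0 < τ * (p x * q x) :=
      ((c1.mul c2).const_mul τ).eventually (lt_mem_nhds hpos)
    filter_upwards [e1, e2, h3] with x h1 h2 h3
    have h4 : (q x - τ * p x) * (q x + τ * p x) = 0 := by
      have : q x ^ 2 = p x ^ 2 := h2.2.trans h1.2.symm
      linear_combination this - p x ^ 2 * hτ
    rcases mul_eq_zero.1 h4 with h5 | h5
    · linarith
    · have : q x = - τ * p x := by linarith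
      rw [this] at h3
      nlinarith [sq_nonneg (p x), mul_nonneg (sq_nonneg τ) (sq_nonneg (p x))]
  obtain ⟨r, hr, hB⟩ := Metric.eventually_nhds_iff_ball.1 (e1.and (e2.and hev))
  refine ⟨τ, Θ' (pt 0 a) 1 - τ * Θ (pt 0 a) 1, hτ, ?_⟩
  filter_upwards [Metric.ball_mem_nhds a hr] with x hx
  have hd : ∀ x ∈ Metric.ball a r,
      HasDerivAt (fun x => Θ' (pt 0 x) 1 - τ * Θ (pt 0 x) 1) 0 x := by
    intro x hx
    obtain ⟨h1, h2, h3⟩ := hB x hx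
    have := h2.1.sub (h1.1.const_mul τ)
    rwa [show partialWithin ℍ₂ 1 (fun w => Θ' w 1) (pt 0 x)
      - τ * partialWithin ℍ₂ 1 (fun w => Θ w 1) (pt 0 x) = 0 from sub_eq_zero.2 h3] at this
  have := Metric.isOpen_ball.is_const_of_deriv_eq_zero (convex_ball a r).isPreconnected
    (fun x hx => (hd x hx).differentiableAt.differentiableWithinAt) (fun x hx => (hd x hx).deriv)
    hx (Metric.mem_ball_self hr)
  dsimp only at this
  linarith

/-- Two adapted maps which agree along the boundary line agree there to first order. -/
theorem partial_eq_of_eq (h : AdaptedNear M Θ a) (h' : AdaptedNear M Θ' a)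
    (hM : 0 < M (pt 0 a) 1 1) (he : ∀ᶠ x in 𝓝 a, Θ' (pt 0 x) 1 = Θ (pt 0 x) 1) (i k : Fin 2) :
    partialWithin ℍ₂ i (fun w => Θ' w k) (pt 0 a)
      = partialWithin ℍ₂ i (fun w => Θ w k) (pt 0 a) := by
  have z := h.partial_one_zero.self_of_nhds
  have z' := h'.partial_one_zero.self_of_nhds
  have h11 : partialWithin ℍ₂ 1 (fun w => Θ' w 1) (pt 0 a)
      = partialWithin ℍ₂ 1 (fun w => Θ w 1) (pt 0 a) :=
    (hasDerivAt_tangential ((h'.smooth.apply 1).diff (pt_zero_mem a))).unique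
      ((hasDerivAt_tangential ((h.smooth.apply 1).diff (pt_zero_mem a))).congr_of_eventuallyEq he)
  have i1 := h.isom.self_of_nhds
  have i2 := h'.isom.self_of_nhds
  simp only [Fin.sum_univ_two] at i1 i2
  have a11 := i1 1 1
  have a01 := i1 0 1
  have b01 := i2 0 1
  have a00 := i1 0 0
  have b00 := i2 0 0
  rw [z] at a11 a01
  rw [z', h11] at b01
  -- The relations `M₁₁`, `M₀₁`, `M₀₀` determine the remaining derivatives one after the other, the
  -- last one because it is nonnegative.
  have n0 : partialWithin ℍ₂ 1 (fun w => Θ w 1) (pt 0 a) ≠ 0 := by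
    intro h0; rw [h0] at a11; simp at a11; linarith
  have h01 : partialWithin ℍ₂ 0 (fun w => Θ' w 1) (pt 0 a)
      = partialWithin ℍ₂ 0 (fun w => Θ w 1) (pt 0 a) := by
    apply mul_right_cancel₀ n0
    linarith
  have h00 : partialWithin ℍ₂ 0 (fun w => Θ' w 0) (pt 0 a)
      = partialWithin ℍ₂ 0 (fun w => Θ w 0) (pt 0 a) := by
    rw [h01] at b00
    have := h.partial_zero_nonneg
    have := h'.partial_zero_nonneg
    rw [← pow_left_inj₀ h'.partial_zero_nonneg h.partial_zero_nonneg two_ne_zero]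
    linarith
  fin_cases i <;> fin_cases k
  · exact h00
  · exact h01
  · exact z'.trans z.symm
  · exact h11

end AdaptedNear

/-- The map which fixes the first coordinate and acts on the second one by `x ↦ τ x + c`. -/
def slide (τ c : ℝ) (w : Plane) : Plane := pt (w 0) (τ * w 1 + c)

lemma slide_zero (τ c : ℝ) (w : Plane) : slide τ c w 0 = w 0 := rfl

lemma slide_one (τ c : ℝ) (w : Plane) : slide τ c w 1 = τ * w 1 + c := rfl

lemma HasPartial.sum {ι : Type*} {s : Finset ι} {i : Fin 2} {f : ι → Plane → ℝ} {f' : ι → ℝ}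
    {v : Plane} (hv : v ∈ ℍ₂) (h : ∀ l ∈ s, HasPartial i (f l) (f' l) v) :
    HasPartial i (fun w => ∑ l ∈ s, f l w) (∑ l ∈ s, f' l) v := by
  classical
  induction s using Finset.induction_on with
  | empty => simpa using HasPartial.const (i := i) hv 0
  | insert l s hl ih =>
    simp only [Finset.sum_insert hl]
    exact (h l (Finset.mem_insert_self _ _)).add
      (ih fun k hk => h k (Finset.mem_insert_of_mem hk))

namespace AdaptedNear

variable {M M' : Plane → Matrix (Fin 2) (Fin 2) ℝ} {Θ Θ' : Plane → Plane} {a : ℝ}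

lemma slide (h : AdaptedNear M Θ a) {τ : ℝ} (hτ : τ ^ 2 = 1) (c : ℝ) :
    AdaptedNear M (fun w => slide τ c (Θ w)) a := by
  refine ⟨SmoothNear.pt (h.smooth.apply 0)
    (((SmoothNear.const τ).mul (h.smooth.apply 1)).add (SmoothNear.const c)), h.nonneg, h.zero, ?_⟩
  filter_upwards [h.isom, h.eventually] with x h1 h2 i j
  have hx := pt_zero_mem x
  have p1 : ∀ i, partialWithin ℍ₂ i (fun w => RiemSurf.slide τ c (Θ w) 1) (pt 0 x)
      = τ * partialWithin ℍ₂ i (fun w => Θ w 1) (pt 0 x) := fun i =>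
    ((((h2.smooth.apply 1).hasPartial hx i).const_mul τ).add (HasPartial.const hx c)).eq.trans
      (add_zero _)
  rw [h1, Fin.sum_univ_two, Fin.sum_univ_two, p1, p1]
  simp only [slide_zero]
  linear_combination -(partialWithin ℍ₂ i (fun w => Θ w 1) (pt 0 x)
    * partialWithin ℍ₂ j (fun w => Θ w 1) (pt 0 x)) * hτ

/-- A convex combination, with variable coefficients, of adapted maps which agree along the boundary
is adapted: the maps agree to first order, and the derivatives of the coefficients add up to zero.
-/
theorem sum {ι : Type*} {s : Finset ι} {ρ : ι → Plane → ℝ} {Θs : ι → Plane → Plane}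
    (hρ : ∀ i ∈ s, SmoothNear (ρ i) (pt 0 a)) (hρ0 : ∀ i ∈ s, ∀ w, 0 ≤ ρ i w)
    (hρ1 : ∀ᶠ w in 𝓝[ℍ₂] (pt 0 a), ∑ i ∈ s, ρ i w = 1) (hΘ : ∀ i ∈ s, AdaptedNear M (Θs i) a)
    (h : AdaptedNear M Θ a) (hM : ∀ᶠ x in 𝓝 a, 0 < M (pt 0 x) 1 1)
    (he : ∀ i ∈ s, ∀ᶠ x in 𝓝 a, Θs i (pt 0 x) 1 = Θ (pt 0 x) 1) :
    AdaptedNear M (fun w => ∑ i ∈ s, ρ i w • Θs i w) a := by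
  have hco : ∀ w k, (∑ i ∈ s, ρ i w • Θs i w) k = ∑ i ∈ s, ρ i w * Θs i w k := by
    intro w k
    rw [show (∑ i ∈ s, ρ i w • Θs i w) k
      = (EuclideanSpace.proj k : Plane →L[ℝ] ℝ) (∑ i ∈ s, ρ i w • Θs i w) from rfl, map_sum]
    rfl
  refine ⟨SmoothNear.sum fun i hi => ?_, ?_, ?_, ?_⟩
  · filter_upwards [hρ i hi, (hΘ i hi).smooth] with w h1 h2 using h1.smul h2
  · have : ∀ᶠ w in 𝓝[ℍ₂] (pt 0 a), ∀ i ∈ s, 0 ≤ Θs i w 0 :=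
      (Filter.eventually_all_finset s).2 fun i hi => (hΘ i hi).nonneg
    filter_upwards [this] with w hw
    rw [hco]
    exact Finset.sum_nonneg fun i hi => mul_nonneg (hρ0 i hi w) (hw i hi)
  · have : ∀ᶠ x in 𝓝 a, ∀ i ∈ s, Θs i (pt 0 x) 0 = 0 :=
      (Filter.eventually_all_finset s).2 fun i hi => (hΘ i hi).zero
    filter_upwards [this] with x hx
    rw [hco]
    exact Finset.sum_eq_zero fun i hi => by rw [hx i hi, mul_zero]
  · have e1 : ∀ᶠ x in 𝓝 a, ∀ i ∈ s, AdaptedNear M (Θs i) x ∧ SmoothNear (ρ i) (pt 0 x) ∧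
        ∀ᶠ y in 𝓝 x, Θs i (pt 0 y) 1 = Θ (pt 0 y) 1 :=
      (Filter.eventually_all_finset s).2 fun i hi => (hΘ i hi).eventually.and
        (((tendsto_pt_zero a).eventually (hρ i hi).eventually).and
          (eventually_eventually_nhds.2 (he i hi)))
    filter_upwards [e1, h.eventually, hM, (tendsto_pt_zero a).eventually
      (eventually_eventually_nhdsWithin.2 hρ1)] with x h1 h2 h3 h4 i j
    have hx := pt_zero_mem x
    have hs1 : ∀ i, ∑ l ∈ s, partialWithin ℍ₂ i (ρ l) (pt 0 x) = 0 := by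
      intro i
      have e1 : HasPartial i (fun w => ∑ l ∈ s, ρ l w) _ (pt 0 x) :=
        HasPartial.sum hx fun l hl => (h1 l hl).2.1.hasPartial hx i
      exact e1.uniq ((HasPartial.const hx 1).congr h4)
    have hs : ∀ i k, partialWithin ℍ₂ i (fun w => (∑ l ∈ s, ρ l w • Θs l w) k) (pt 0 x)
        = partialWithin ℍ₂ i (fun w => Θ w k) (pt 0 x) := by
      intro i k
      simp only [hco]
      have e2 : HasPartial i (fun w => ∑ l ∈ s, ρ l w * Θs l w k) _ (pt 0 x) :=
        HasPartial.sum hx fun l hl => ((h1 l hl).2.1.hasPartial hx i).mul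
          (((h1 l hl).1.smooth.apply k).hasPartial hx i)
      rw [e2.eq]
      have e3 : ∀ l ∈ s, Θs l (pt 0 x) k = Θ (pt 0 x) k := by
        intro l hl
        fin_cases k
        · exact (h1 l hl).1.zero.self_of_nhds.trans h2.zero.self_of_nhds.symm
        · exact (h1 l hl).2.2.self_of_nhds
      have e4 : ∑ l ∈ s, ρ l (pt 0 x) = 1 := h4.self_of_nhdsWithin hx
      rw [Finset.sum_congr rfl fun l hl => by
        rw [e3 l hl, h2.partial_eq_of_eq (h1 l hl).1 h3 (h1 l hl).2.2 i k],
        Finset.sum_add_distrib, ← Finset.sum_mul, ← Finset.sum_mul, hs1, e4]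
      ring
    simp only [hs]
    exact h2.isom.self_of_nhds i j

end AdaptedNear

/-! ### Metrics in the charts of the maximal atlas -/

section Charts

variable {S : Type*} [TopologicalSpace S]

/-- The open subset of the plane whose intersection with the half-plane is the image of `e`. -/
def chartDomain (e : OpenPartialHomeomorph S (EuclideanHalfSpace 2)) : Set Plane :=
  (𝓡∂ 2).symm ⁻¹' e.target

lemma isOpen_chartDomain (e : OpenPartialHomeomorph S (EuclideanHalfSpace 2)) :
    IsOpen (chartDomain e) := e.open_target.preimage (𝓡∂ 2).continuous_symm

lemma extend_target_eq (e : OpenPartialHomeomorph S (EuclideanHalfSpace 2)) :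
    (e.extend (𝓡∂ 2)).target = ℍ₂ ∩ chartDomain e := by
  rw [e.extend_target, inter_comm]; rfl

lemma extend_mem_target {e : OpenPartialHomeomorph S (EuclideanHalfSpace 2)} {z : S}
    (hz : z ∈ e.source) : e.extend (𝓡∂ 2) z ∈ ℍ₂ ∩ chartDomain e := by
  rw [← extend_target_eq]
  exact (e.extend (𝓡∂ 2)).map_source (by rwa [e.extend_source])

lemma extend_symm_mem {e : OpenPartialHomeomorph S (EuclideanHalfSpace 2)} {v : Plane}
    (hv : v ∈ ℍ₂ ∩ chartDomain e) : (e.extend (𝓡∂ 2)).symm v ∈ e.source := by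
  rw [← extend_target_eq] at hv
  rw [← e.extend_source (I := 𝓡∂ 2)]
  exact (e.extend (𝓡∂ 2)).map_target hv

lemma extend_left_inv {e : OpenPartialHomeomorph S (EuclideanHalfSpace 2)} {z : S}
    (hz : z ∈ e.source) : (e.extend (𝓡∂ 2)).symm (e.extend (𝓡∂ 2) z) = z :=
  (e.extend (𝓡∂ 2)).left_inv (by rwa [e.extend_source])

lemma extend_right_inv {e : OpenPartialHomeomorph S (EuclideanHalfSpace 2)} {v : Plane}
    (hv : v ∈ ℍ₂ ∩ chartDomain e) : e.extend (𝓡∂ 2) ((e.extend (𝓡∂ 2)).symm v) = v :=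
  (e.extend (𝓡∂ 2)).right_inv (by rwa [extend_target_eq])

lemma chartDomain_mem_nhdsWithin {e : OpenPartialHomeomorph S (EuclideanHalfSpace 2)} {v : Plane}
    (hv : v ∈ chartDomain e) : ℍ₂ ∩ chartDomain e ∈ 𝓝[ℍ₂] v :=
  Filter.inter_mem self_mem_nhdsWithin
    (mem_nhdsWithin_of_mem_nhds ((isOpen_chartDomain e).mem_nhds hv))

variable [ChartedSpace (EuclideanHalfSpace 2) S]
  {e f : OpenPartialHomeomorph S (EuclideanHalfSpace 2)}

/-- The `i`-th coordinate vector field of the chart `e`. -/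
def frame (e : OpenPartialHomeomorph S (EuclideanHalfSpace 2)) (i : Fin 2) (y : Plane) :
    TangentSpace (𝓡∂ 2) ((e.extend (𝓡∂ 2)).symm y) :=
  mfderivWithin 𝓘(ℝ, Plane) (𝓡∂ 2) (e.extend (𝓡∂ 2)).symm ℍ₂ y (stdVec i)

lemma contMDiffWithinAt_extend_symm (he : e ∈ IsManifold.maximalAtlas (𝓡∂ 2) ∞ S)
    {v : Plane} (hv : v ∈ ℍ₂ ∩ chartDomain e) :
    ContMDiffWithinAt 𝓘(ℝ, Plane) (𝓡∂ 2) ∞ (e.extend (𝓡∂ 2)).symm ℍ₂ v := by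
  have h := contMDiffOn_extend_symm (I := 𝓡∂ 2) (n := ∞) he
  have hs : (𝓡∂ 2) '' e.target = ℍ₂ ∩ chartDomain e := by
    ext w
    constructor
    · rintro ⟨z, hz, rfl⟩
      refine ⟨mem_range_self z, ?_⟩
      change (𝓡∂ 2).symm ((𝓡∂ 2) z) ∈ e.target
      rwa [(𝓡∂ 2).left_inv]
    · rintro ⟨hw, hw'⟩
      exact ⟨_, hw', (𝓡∂ 2).right_inv hw⟩
  rw [hs] at h
  exact (h v hv).mono_of_mem_nhdsWithin (chartDomain_mem_nhdsWithin hv.2)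

lemma extend_apply (z : S) : e.extend (𝓡∂ 2) z = (𝓡∂ 2) (e z) := rfl

lemma contMDiffAt_extend (he : e ∈ IsManifold.maximalAtlas (𝓡∂ 2) ∞ S) {z : S}
    (hz : z ∈ e.source) :
    ContMDiffAt (𝓡∂ 2) 𝓘(ℝ, Plane) ∞ (e.extend (𝓡∂ 2)) z := e.contMDiffAt_extend he hz

/-- The differential of the inverse of a chart is inverse to that of the chart. -/
lemma mfderivWithin_symm_comp (he : e ∈ IsManifold.maximalAtlas (𝓡∂ 2) ∞ S) {z : S}
    (hz : z ∈ e.source) (X : TangentSpace (𝓡∂ 2) z) :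
    mfderivWithin 𝓘(ℝ, Plane) (𝓡∂ 2) (e.extend (𝓡∂ 2)).symm ℍ₂ (e.extend (𝓡∂ 2) z)
      (mfderiv (𝓡∂ 2) 𝓘(ℝ, Plane) (e.extend (𝓡∂ 2)) z X) = X := by
  have h1 := (contMDiffWithinAt_extend_symm he (extend_mem_target hz)).mdifferentiableWithinAt
    (by simp)
  have h2 := (contMDiffAt_extend he hz).mdifferentiableAt (by simp)
  have h3 := mfderivWithin_comp (I := 𝓡∂ 2) (I' := 𝓘(ℝ, Plane)) (I'' := 𝓡∂ 2) (s := univ) z h1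
    h2.mdifferentiableWithinAt (fun w _ => mem_range_self _) (uniqueMDiffWithinAt_univ _)
  rw [mfderivWithin_univ, mfderivWithin_univ] at h3
  have h4 : (e.extend (𝓡∂ 2)).symm ∘ (e.extend (𝓡∂ 2)) =ᶠ[𝓝 z] id := by
    filter_upwards [e.open_source.mem_nhds hz] with w hw using extend_left_inv hw
  rw [h4.mfderiv_eq, mfderiv_id] at h3
  exact (DFunLike.congr_fun h3 X).symm

lemma mfderiv_comp_symm (he : e ∈ IsManifold.maximalAtlas (𝓡∂ 2) ∞ S) {v : Plane}
    (hv : v ∈ ℍ₂ ∩ chartDomain e) (X : Plane) :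
    mfderiv (𝓡∂ 2) 𝓘(ℝ, Plane) (e.extend (𝓡∂ 2)) ((e.extend (𝓡∂ 2)).symm v)
      (mfderivWithin 𝓘(ℝ, Plane) (𝓡∂ 2) (e.extend (𝓡∂ 2)).symm ℍ₂ v X) = X := by
  have h1 := (contMDiffWithinAt_extend_symm he hv).mdifferentiableWithinAt (by simp)
  have h2 := (contMDiffAt_extend he (extend_symm_mem hv)).mdifferentiableAt (by simp)
  have hu : UniqueMDiffWithinAt 𝓘(ℝ, Plane) ℍ₂ v := (uniqueDiffOn_half v hv.1).uniqueMDiffWithinAt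
  have h3 := mfderiv_comp_mfderivWithin (I := 𝓘(ℝ, Plane)) (I' := 𝓡∂ 2) (I'' := 𝓘(ℝ, Plane)) v h2
    h1 hu
  have h4 : (e.extend (𝓡∂ 2)) ∘ (e.extend (𝓡∂ 2)).symm =ᶠ[𝓝[ℍ₂] v] id := by
    filter_upwards [chartDomain_mem_nhdsWithin hv.2] with w hw using extend_right_inv hw
  rw [h4.mfderivWithin_eq (extend_right_inv hv), mfderivWithin_id hu] at h3
  exact (DFunLike.congr_fun h3 X).symm

lemma mfderiv_frame (he : e ∈ IsManifold.maximalAtlas (𝓡∂ 2) ∞ S) {v : Plane}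
    (hv : v ∈ ℍ₂ ∩ chartDomain e) (i : Fin 2) :
    mfderiv (𝓡∂ 2) 𝓘(ℝ, Plane) (e.extend (𝓡∂ 2)) ((e.extend (𝓡∂ 2)).symm v) (frame e i v)
      = stdVec i := mfderiv_comp_symm he hv _

/-- The differential of a chart, as a plane-valued map. -/
def dchart (e : OpenPartialHomeomorph S (EuclideanHalfSpace 2)) (z : S)
    (X : TangentSpace (𝓡∂ 2) z) : Plane :=
  mfderiv (𝓡∂ 2) 𝓘(ℝ, Plane) (e.extend (𝓡∂ 2)) z X

variable [IsManifold (𝓡∂ 2) ∞ S]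

/-- The matrix of `g` in the chart `e`. -/
def coeffs (g : Metric S) (e : OpenPartialHomeomorph S (EuclideanHalfSpace 2)) (y : Plane) :
    Matrix (Fin 2) (Fin 2) ℝ :=
  Matrix.of fun i j => g.inner ((e.extend (𝓡∂ 2)).symm y) (frame e i y) (frame e j y)

/-- The expression of a metric in terms of the differentials of the coordinates of a chart. -/
theorem inner_eq_coeffs (he : e ∈ IsManifold.maximalAtlas (𝓡∂ 2) ∞ S) (g : Metric S) {z : S}
    (hz : z ∈ e.source) (X Y : TangentSpace (𝓡∂ 2) z) : g.inner z X Y = ∑ i, ∑ j,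
      coeffs g e (e.extend (𝓡∂ 2) z) i j * dchart e z X i * dchart e z Y j := by
  have key : ∀ (w : S) (hw : w = z) (L : Plane →L[ℝ] TangentSpace (𝓡∂ 2) w)
      (hL : ∀ X : TangentSpace (𝓡∂ 2) z, L (dchart e z X) = (X : Plane)),
      g.inner z X Y = ∑ i, ∑ j, g.inner w (L (stdVec i)) (L (stdVec j)) *
        dchart e z X i * dchart e z Y j := by
    rintro w rfl L hL
    have hx : ∀ X : TangentSpace (𝓡∂ 2) w, X = dchart e w X 0 • L (stdVec 0)
        + dchart e w X 1 • L (stdVec 1) := by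
      intro X
      rw [← map_smul, ← map_smul, ← map_add, ← plane_eq_sum]
      exact (hL X).symm
    conv_lhs => rw [hx X, hx Y]
    simp only [map_add, map_smul, add_apply, smul_apply,
      smul_eq_mul, Fin.sum_univ_two]
    ring
  exact key _ (extend_left_inv hz) (mfderivWithin 𝓘(ℝ, Plane) (𝓡∂ 2) (e.extend (𝓡∂ 2)).symm ℍ₂
    (e.extend (𝓡∂ 2) z)) fun X => mfderivWithin_symm_comp he hz X


/-- The differential of the inverse of a chart, in terms of another chart. -/
lemma mfderivWithin_symm_eq (he : e ∈ IsManifold.maximalAtlas (𝓡∂ 2) ∞ S)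
    (hf : f ∈ IsManifold.maximalAtlas (𝓡∂ 2) ∞ S) {v : Plane} (hv : v ∈ ℍ₂ ∩ chartDomain e)
    (hvf : (e.extend (𝓡∂ 2)).symm v ∈ f.source) (X : Plane) :
    dchart f ((e.extend (𝓡∂ 2)).symm v)
      (mfderivWithin 𝓘(ℝ, Plane) (𝓡∂ 2) (e.extend (𝓡∂ 2)).symm ℍ₂ v X)
      = fderivWithin ℝ (fun w => f.extend (𝓡∂ 2) ((e.extend (𝓡∂ 2)).symm w)) ℍ₂ v X := by
  have h1 := (contMDiffWithinAt_extend_symm he hv).mdifferentiableWithinAt (by simp)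
  have h2 := (contMDiffAt_extend hf hvf).mdifferentiableAt (by simp)
  have hu : UniqueMDiffWithinAt 𝓘(ℝ, Plane) ℍ₂ v := (uniqueDiffOn_half v hv.1).uniqueMDiffWithinAt
  have h3 := mfderiv_comp_mfderivWithin (I := 𝓘(ℝ, Plane)) (I' := 𝓡∂ 2) (I'' := 𝓘(ℝ, Plane)) v h2
    h1 hu
  rw [mfderivWithin_eq_fderivWithin] at h3
  exact (DFunLike.congr_fun h3 X).symm

/-- The coordinate change from `e` to `f`. -/
def chartTrans (e f : OpenPartialHomeomorph S (EuclideanHalfSpace 2)) (v : Plane) : Plane :=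
  f.extend (𝓡∂ 2) ((e.extend (𝓡∂ 2)).symm v)

lemma eventually_symm_mem (he : e ∈ IsManifold.maximalAtlas (𝓡∂ 2) ∞ S) {v : Plane}
    (hv : v ∈ ℍ₂ ∩ chartDomain e) {U : Set S} (hU : U ∈ 𝓝 ((e.extend (𝓡∂ 2)).symm v)) :
    ∀ᶠ w in 𝓝[ℍ₂] v, w ∈ ℍ₂ ∩ chartDomain e ∧ (e.extend (𝓡∂ 2)).symm w ∈ U :=
  Filter.Eventually.and (chartDomain_mem_nhdsWithin hv.2)
    ((contMDiffWithinAt_extend_symm he hv).continuousWithinAt.eventually hU)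

lemma smoothNear_comp_symm {F : Type*} [NormedAddCommGroup F] [NormedSpace ℝ F]
    (he : e ∈ IsManifold.maximalAtlas (𝓡∂ 2) ∞ S) {v : Plane} (hv : v ∈ ℍ₂ ∩ chartDomain e)
    {u : S → F} (hu : ∀ᶠ z in 𝓝 ((e.extend (𝓡∂ 2)).symm v), ContMDiffAt (𝓡∂ 2) 𝓘(ℝ, F) ∞ u z) :
    SmoothNear (fun w => u ((e.extend (𝓡∂ 2)).symm w)) v := by
  filter_upwards [eventually_symm_mem he hv hu] with w hw
  rw [← contMDiffWithinAt_iff_contDiffWithinAt]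
  exact ContMDiffAt.comp_contMDiffWithinAt w hw.2 (contMDiffWithinAt_extend_symm he hw.1)

lemma smoothNear_chartTrans (he : e ∈ IsManifold.maximalAtlas (𝓡∂ 2) ∞ S)
    (hf : f ∈ IsManifold.maximalAtlas (𝓡∂ 2) ∞ S) {v : Plane} (hv : v ∈ ℍ₂ ∩ chartDomain e)
    (hvf : (e.extend (𝓡∂ 2)).symm v ∈ f.source) : SmoothNear (chartTrans e f) v :=
  smoothNear_comp_symm he hv (by
    filter_upwards [f.open_source.mem_nhds hvf] with z hz using contMDiffAt_extend hf hz)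

lemma coeffs_eq (he : e ∈ IsManifold.maximalAtlas (𝓡∂ 2) ∞ S)
    (hf : f ∈ IsManifold.maximalAtlas (𝓡∂ 2) ∞ S) (g : Metric S) {v : Plane}
    (hv : v ∈ ℍ₂ ∩ chartDomain e) (hvf : (e.extend (𝓡∂ 2)).symm v ∈ f.source) (i j : Fin 2) :
    coeffs g e v i j = ∑ k, ∑ l, partialWithin ℍ₂ i (fun w => chartTrans e f w k) v *
      partialWithin ℍ₂ j (fun w => chartTrans e f w l) v * coeffs g f (chartTrans e f v) k l := by
  have hs := smoothNear_chartTrans he hf hv hvf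
  have hd : ∀ i k, dchart f ((e.extend (𝓡∂ 2)).symm v) (frame e i v) k
      = partialWithin ℍ₂ i (fun w => chartTrans e f w k) v := by
    intro i k
    rw [hs.partialWithin_apply hv.1, frame, mfderivWithin_symm_eq he hf hv hvf]
    rfl
  change g.inner _ (frame e i v) (frame e j v) = _
  rw [inner_eq_coeffs hf g hvf]
  simp only [hd]
  refine Finset.sum_congr rfl fun k _ => Finset.sum_congr rfl fun l _ => ?_
  change coeffs g f (chartTrans e f v) k l * _ * _ = _
  ring

lemma contMDiffWithinAt_frame (he : e ∈ IsManifold.maximalAtlas (𝓡∂ 2) ∞ S) {v : Plane}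
    (hv : v ∈ ℍ₂ ∩ chartDomain e) (i : Fin 2) :
    ContMDiffWithinAt 𝓘(ℝ, Plane) (𝓡∂ 2).tangent ∞
      (fun y => TotalSpace.mk' Plane (E := fun z : S => TangentSpace (𝓡∂ 2) z)
        ((e.extend (𝓡∂ 2)).symm y) (frame e i y)) ℍ₂ v := by
  have hu : UniqueDiffOn ℝ (ℍ₂ ∩ chartDomain e) := uniqueDiffOn_half.inter (isOpen_chartDomain e)
  have hψ : ContMDiffOn 𝓘(ℝ, Plane) (𝓡∂ 2) ∞ (e.extend (𝓡∂ 2)).symm (ℍ₂ ∩ chartDomain e) :=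
    fun w hw => (contMDiffWithinAt_extend_symm he hw).mono inter_subset_left
  have hT := hψ.contMDiffOn_tangentMapWithin (m := ∞) (by exact le_rfl) hu.uniqueMDiffOn
  have hc : ContMDiff 𝓘(ℝ, Plane) 𝓘(ℝ, Plane).tangent ∞
      (fun y : Plane => (⟨y, stdVec i⟩ : TangentBundle 𝓘(ℝ, Plane) Plane)) := by
    intro y
    rw [contMDiffAt_totalSpace]
    refine ⟨contMDiffAt_id, ?_⟩
    simpa using contMDiffAt_const
  have h := (hT.comp hc.contMDiffOn (s := ℍ₂ ∩ chartDomain e) fun w hw => hw) v hv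
  refine (h.mono_of_mem_nhdsWithin (chartDomain_mem_nhdsWithin hv.2)).congr_of_eventuallyEq ?_ ?_
  · filter_upwards [chartDomain_mem_nhdsWithin hv.2] with w hw
    simp only [Function.comp_apply, tangentMapWithin, frame]
    rw [mfderivWithin_inter ((isOpen_chartDomain e).mem_nhds hw.2)]
  · simp only [Function.comp_apply, tangentMapWithin, frame]
    rw [mfderivWithin_inter ((isOpen_chartDomain e).mem_nhds hv.2)]

lemma smoothNear_coeffs (he : e ∈ IsManifold.maximalAtlas (𝓡∂ 2) ∞ S) (g : Metric S) {v : Plane}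
    (hv : v ∈ ℍ₂ ∩ chartDomain e) (i j : Fin 2) : SmoothNear (fun w => coeffs g e w i j) v := by
  filter_upwards [chartDomain_mem_nhdsWithin hv.2] with w hw
  have h : ContMDiffWithinAt 𝓘(ℝ, Plane) ((𝓡∂ 2).prod 𝓘(ℝ, ℝ)) ∞
      (fun y ↦ TotalSpace.mk' ℝ (E := Bundle.Trivial S ℝ) ((e.extend (𝓡∂ 2)).symm y)
        (g.inner ((e.extend (𝓡∂ 2)).symm y) (frame e i y) (frame e j y))) ℍ₂ w := by
    apply ContMDiffWithinAt.clm_bundle_apply₂ (F₁ := Plane) (F₂ := Plane)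
      (E₁ := fun z : S => TangentSpace (𝓡∂ 2) z) (E₂ := fun z : S => TangentSpace (𝓡∂ 2) z)
    · exact ContMDiffAt.comp_contMDiffWithinAt w g.contMDiff.contMDiffAt
        (contMDiffWithinAt_extend_symm he hw)
    · exact contMDiffWithinAt_frame he hw i
    · exact contMDiffWithinAt_frame he hw j
  simp only [contMDiffWithinAt_totalSpace] at h
  exact contMDiffWithinAt_iff_contDiffWithinAt.1 h.2

end Charts

section Charts

variable {S : Type*} [TopologicalSpace S] [ChartedSpace (EuclideanHalfSpace 2) S]
  [IsManifold (𝓡∂ 2) ∞ S] {e f : OpenPartialHomeomorph S (EuclideanHalfSpace 2)}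

lemma coeffs_symm (g : Metric S) (v : Plane) : coeffs g e v 1 0 = coeffs g e v 0 1 :=
  g.symm _ _ _

lemma coeffs_quad_pos (he : e ∈ IsManifold.maximalAtlas (𝓡∂ 2) ∞ S) (g : Metric S) {v : Plane}
    (hv : v ∈ ℍ₂ ∩ chartDomain e) {s t : ℝ} (h : s ≠ 0 ∨ t ≠ 0) :
    0 < coeffs g e v 0 0 * s ^ 2 + 2 * coeffs g e v 0 1 * (s * t) + coeffs g e v 1 1 * t ^ 2 := by
  have hX : dchart e _ (s • frame e 0 v + t • frame e 1 v) = s • stdVec 0 + t • stdVec 1 := by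
    rw [dchart, map_add, map_smul, map_smul, mfderiv_frame he hv, mfderiv_frame he hv]
    rfl
  have hne : s • frame e 0 v + t • frame e 1 v ≠ 0 := by
    intro h0
    rw [h0, dchart, map_zero] at hX
    have h1 := congrArg (fun w : Plane => w 0) hX
    have h2 := congrArg (fun w : Plane => w 1) hX
    simp [stdVec] at h1 h2
    rcases h with h | h
    · exact h h1.symm
    · exact h h2.symm
  have := g.pos _ _ hne
  simp only [map_add, map_smul, add_apply, smul_apply, smul_eq_mul] at this
  have hs := coeffs_symm (e := e) g v
  change g.inner _ (frame e 1 v) (frame e 0 v) = g.inner _ (frame e 0 v) (frame e 1 v) at hs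
  change 0 < g.inner _ (frame e 0 v) (frame e 0 v) * s ^ 2
    + 2 * g.inner _ (frame e 0 v) (frame e 1 v) * (s * t)
    + g.inner _ (frame e 1 v) (frame e 1 v) * t ^ 2
  rw [hs] at this
  linarith

lemma coeffs_pos (he : e ∈ IsManifold.maximalAtlas (𝓡∂ 2) ∞ S) (g : Metric S) {v : Plane}
    (hv : v ∈ ℍ₂ ∩ chartDomain e) : 0 < coeffs g e v 1 1 := by
  simpa using coeffs_quad_pos he g hv (s := 0) (t := 1) (by simp)

lemma coeffs_det_pos (he : e ∈ IsManifold.maximalAtlas (𝓡∂ 2) ∞ S) (g : Metric S) {v : Plane}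
    (hv : v ∈ ℍ₂ ∩ chartDomain e) : 0 < (coeffs g e v).det := by
  have h1 := coeffs_pos he g hv
  have h2 := coeffs_quad_pos he g hv (s := coeffs g e v 1 1) (t := - coeffs g e v 0 1)
    (Or.inl h1.ne')
  rw [Matrix.det_fin_two, coeffs_symm]
  have h3 : 0 < coeffs g e v 1 1 *
      (coeffs g e v 0 0 * coeffs g e v 1 1 - coeffs g e v 0 1 * coeffs g e v 0 1) := by
    linarith
  exact pos_of_mul_pos_right (by linarith) h1.le

lemma metricNear_coeffs (he : e ∈ IsManifold.maximalAtlas (𝓡∂ 2) ∞ S) (g : Metric S) {v : Plane}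
    (hv : v ∈ ℍ₂ ∩ chartDomain e) : MetricNear (coeffs g e) v :=
  ⟨hv.1, smoothNear_coeffs he g hv, Filter.Eventually.of_forall fun w => coeffs_symm g w,
    (coeffs_det_pos he g hv).ne'⟩

lemma chartTrans_mem {v : Plane} (hvf : (e.extend (𝓡∂ 2)).symm v ∈ f.source) :
    chartTrans e f v ∈ ℍ₂ ∩ chartDomain f := extend_mem_target hvf

lemma chartTrans_symm {v : Plane} (hvf : (e.extend (𝓡∂ 2)).symm v ∈ f.source) :
    (f.extend (𝓡∂ 2)).symm (chartTrans e f v) = (e.extend (𝓡∂ 2)).symm v := extend_left_inv hvf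

lemma pullbackNear_coeffs (he : e ∈ IsManifold.maximalAtlas (𝓡∂ 2) ∞ S)
    (hf : f ∈ IsManifold.maximalAtlas (𝓡∂ 2) ∞ S) (g : Metric S) {v : Plane}
    (hv : v ∈ ℍ₂ ∩ chartDomain e) (hvf : (e.extend (𝓡∂ 2)).symm v ∈ f.source) :
    PullbackNear (coeffs g f) (coeffs g e) (chartTrans e f) v := by
  have hev := eventually_symm_mem he hv (f.open_source.mem_nhds hvf)
  refine ⟨smoothNear_chartTrans he hf hv hvf, ?_, metricNear_coeffs hf g (chartTrans_mem hvf),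
    metricNear_coeffs he g hv, ?_⟩
  · exact Filter.Eventually.of_forall fun w => mem_range_self _
  · filter_upwards [hev] with w hw i j using coeffs_eq he hf g hw.1 hw.2 i j

/-- The Gaussian curvature may be computed in any chart. -/
theorem gaussCurvature_eq (he : e ∈ IsManifold.maximalAtlas (𝓡∂ 2) ∞ S) (g : Metric S) {z : S}
    (hz : z ∈ e.source) :
    gaussCurvature g z = coordCurvature ℍ₂ (coeffs g e) (e.extend (𝓡∂ 2) z) := by
  set f := chartAt (EuclideanHalfSpace 2) z with hf
  have hfm : f ∈ IsManifold.maximalAtlas (𝓡∂ 2) ∞ S := IsManifold.chart_mem_maximalAtlas z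
  have h := pullbackNear_coeffs hfm he g (v := f.extend (𝓡∂ 2) z)
    (extend_mem_target (mem_chart_source _ z))
    (by rw [extend_left_inv (mem_chart_source _ z)]; exact hz)
  have h2 := h.coordCurvature_eq
  have h3 : chartTrans f e (f.extend (𝓡∂ 2) z) = e.extend (𝓡∂ 2) z := by
    rw [chartTrans, extend_left_inv (mem_chart_source _ z)]
  rw [h3] at h2
  exact h2

/-- The boundary points are those whose first coordinate vanishes, in any chart. -/
theorem mem_boundary_iff (he : e ∈ IsManifold.maximalAtlas (𝓡∂ 2) ∞ S) {z : S} (hz : z ∈ e.source) :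
    z ∈ (𝓡∂ 2).boundary S ↔ e.extend (𝓡∂ 2) z 0 = 0 := by
  have hl : IsLocalDiffeomorphAt (𝓡∂ 2) (𝓡∂ 2) ∞ e z :=
    ⟨{ toPartialEquiv := e.toPartialEquiv
       open_source := e.open_source
       open_target := e.open_target
       contMDiffOn_toFun := contMDiffOn_of_mem_maximalAtlas he
       contMDiffOn_invFun := contMDiffOn_symm_of_mem_maximalAtlas he }, hz, fun _ _ => rfl⟩
  have h1 := hl.isBoundaryPoint_iff (by simp)
  change (𝓡∂ 2).IsBoundaryPoint z ↔ _
  rw [h1, ModelWithCorners.isBoundaryPoint_iff]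
  have h2 : extChartAt (𝓡∂ 2) (e z) (e z) = e.extend (𝓡∂ 2) z := by
    simp [chartAt_self_eq]
  rw [h2, frontier_range_modelWithCornersEuclideanHalfSpace]
  exact eq_comm

lemma isClosed_boundary' : IsClosed ((𝓡∂ 2).boundary S) :=
  (𝓡∂ 2).isClosed_boundary (n := ∞) (by simp)

/-- Metrics which agree near a point have the same coefficients near its image. -/
lemma coeffs_congr (he : e ∈ IsManifold.maximalAtlas (𝓡∂ 2) ∞ S) {g g' : Metric S} {z : S}
    (hz : z ∈ e.source) (h : ∀ᶠ w in 𝓝 z, g'.inner w = g.inner w) :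
    coeffs g' e =ᶠ[𝓝[ℍ₂] (e.extend (𝓡∂ 2) z)] coeffs g e := by
  rw [← extend_left_inv hz] at h
  filter_upwards [eventually_symm_mem he (extend_mem_target hz) h] with w hw
  ext i j
  change g'.inner _ _ _ = g.inner _ _ _
  rw [hw.2]

lemma gaussCurvature_congr {g g' : Metric S} {z : S}
    (h : ∀ᶠ w in 𝓝 z, g'.inner w = g.inner w) : gaussCurvature g' z = gaussCurvature g z := by
  have hc := coeffs_congr (IsManifold.chart_mem_maximalAtlas z) (mem_chart_source _ z) h
  have hm := extend_mem_target (mem_chart_source (EuclideanHalfSpace 2) z)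
  rw [gaussCurvature_eq (IsManifold.chart_mem_maximalAtlas z) g' (mem_chart_source _ z),
    gaussCurvature_eq (IsManifold.chart_mem_maximalAtlas z) g (mem_chart_source _ z)]
  rw [(metricNear_coeffs (IsManifold.chart_mem_maximalAtlas z) g' hm).coordCurvature_eq_curvJ,
    (metricNear_coeffs (IsManifold.chart_mem_maximalAtlas z) g hm).coordCurvature_eq_curvJ,
    jetOf_congr hm.1 hc]

end Charts

section Sections

variable {H M : Type*} [TopologicalSpace H] {I : ModelWithCorners ℝ Plane H} [TopologicalSpace M]
  [ChartedSpace H M] [IsManifold I ∞ M]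

/-- The differential of a plane-valued map. -/
def dmap (I : ModelWithCorners ℝ Plane H) (α : M → Plane) (z : M) (X : TangentSpace I z) : Plane :=
  mfderiv I 𝓘(ℝ, Plane) α z X

set_option synthInstance.maxHeartbeats 400000 in
/-- A field of bilinear forms is smooth if it is a combination, with smooth coefficients, of
products of differentials of smooth functions. -/
theorem contMDiffAt_bilin {α : M → Plane} {m : Fin 2 → Fin 2 → M → ℝ} {z₀ : M}
    (hα : ContMDiffAt I 𝓘(ℝ, Plane) ∞ α z₀) (hm : ∀ i j, ContMDiffAt I 𝓘(ℝ, ℝ) ∞ (m i j) z₀)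
    (Φ : ∀ z : M, TangentSpace I z →L[ℝ] TangentSpace I z →L[ℝ] ℝ)
    (hΦ : ∀ᶠ z in 𝓝 z₀, ∀ v w : TangentSpace I z, Φ z v w = ∑ i, ∑ j, m i j z *
      dmap I α z v i * dmap I α z w j) :
    ContMDiffAt I (I.prod 𝓘(ℝ, Plane →L[ℝ] Plane →L[ℝ] ℝ)) ∞
      (fun z => TotalSpace.mk' (Plane →L[ℝ] Plane →L[ℝ] ℝ)
        (E := fun z : M => TangentSpace I z →L[ℝ] TangentSpace I z →L[ℝ] ℝ) z (Φ z)) z₀ := by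
  rw [contMDiffAt_hom_bundle]
  refine ⟨contMDiffAt_id, ?_⟩
  have hA := hα.mfderiv_const (m := ∞) (by exact le_rfl)
  set A := inTangentCoordinates I 𝓘(ℝ, Plane) id α (mfderiv I 𝓘(ℝ, Plane) α) z₀ with hAdef
  let P : Fin 2 → M → (Plane →L[ℝ] ℝ) := fun i z =>
    (EuclideanSpace.proj i : Plane →L[ℝ] ℝ).comp (A z)
  have hP : ∀ i, ContMDiffAt I 𝓘(ℝ, Plane →L[ℝ] ℝ) ∞ (P i) z₀ := fun i =>
    contMDiffAt_const.clm_comp hA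
  let B : M → (Plane →L[ℝ] Plane →L[ℝ] ℝ) := fun z =>
    ∑ i, ∑ j, m i j z • (ContinuousLinearMap.smulRightL ℝ Plane (Plane →L[ℝ] ℝ) (P i z)) (P j z)
  have hB : ContMDiffAt I 𝓘(ℝ, Plane →L[ℝ] Plane →L[ℝ] ℝ) ∞ B z₀ := by
    refine ContMDiffAt.sum fun i _ => ContMDiffAt.sum fun j _ => (hm i j).smul ?_
    exact (contMDiffAt_const.clm_apply (hP i)).clm_apply (hP j)
  refine hB.congr_of_eventuallyEq ?_
  filter_upwards [hΦ, (chartAt H z₀).open_source.mem_nhds (mem_chart_source H z₀)]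
    with z hz hzs
  ext v w
  have hz1 : z ∈ (trivializationAt Plane (fun z : M => TangentSpace I z) z₀).baseSet := hzs
  rw [inCoordinates_apply_eq₂ hz1 hz1 (by simp), hz]
  have hAz : ∀ v : Plane, A z v = dmap I α z
      ((trivializationAt Plane (fun z : M => TangentSpace I z) z₀).symm z v) := by
    intro v
    change ContinuousLinearMap.inCoordinates Plane (TangentSpace I) Plane
      (TangentSpace 𝓘(ℝ, Plane)) z₀ z (α z₀) (α z) (mfderiv I 𝓘(ℝ, Plane) α z) v = _
    rw [ContinuousLinearMap.inCoordinates_eq hz1 (by simp [chartAt_self_eq])]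
    have hc := TangentBundle.continuousLinearMapAt_model_space (𝕜 := ℝ) (F := Plane) (α z₀) (α z)
    simp only [ContinuousLinearMap.comp_apply, ContinuousLinearEquiv.coe_coe]
    refine (congrFun (Trivialization.coe_continuousLinearEquivAt_eq _ _) _).trans ?_
    exact DFunLike.congr_fun hc _
  simp [B, P, hAz]
  ring

end Sections

/-! ### Adapted maps on a surface -/

lemma AdaptedNear.congr {M : Plane → Matrix (Fin 2) (Fin 2) ℝ} {Θ Θ' : Plane → Plane} {a : ℝ}
    (h : AdaptedNear M Θ a) (he : Θ' =ᶠ[𝓝[ℍ₂] (pt 0 a)] Θ) : AdaptedNear M Θ' a := by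
  have hk : ∀ k, (fun w => Θ' w k) =ᶠ[𝓝[ℍ₂] (pt 0 a)] fun w => Θ w k := fun k => by
    filter_upwards [he] with w hw; rw [hw]
  refine ⟨h.smooth.congr he, ?_, ?_, ?_⟩
  · filter_upwards [h.nonneg, he] with w h1 h2; rwa [h2]
  · filter_upwards [h.zero, (tendsto_pt_zero a).eventually he] with x h1 h2; rwa [h2]
  · have : ∀ᶠ w in 𝓝[ℍ₂] (pt 0 a), ∀ i k, partialWithin ℍ₂ i (fun w => Θ' w k) w
        = partialWithin ℍ₂ i (fun w => Θ w k) w :=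
      Filter.eventually_all.2 fun i => Filter.eventually_all.2 fun k => partialWithin_congr (hk k) i
    filter_upwards [h.isom, (tendsto_pt_zero a).eventually this] with x h1 h2 i j
    simp only [h1, h2]

section Adapted

variable {S : Type*} [TopologicalSpace S] [ChartedSpace (EuclideanHalfSpace 2) S]
  [IsManifold (𝓡∂ 2) ∞ S] {e f : OpenPartialHomeomorph S (EuclideanHalfSpace 2)}

lemma extend_eq_pt (he : e ∈ IsManifold.maximalAtlas (𝓡∂ 2) ∞ S) {r : S} (hr : r ∈ e.source)
    (hb : r ∈ (𝓡∂ 2).boundary S) : e.extend (𝓡∂ 2) r = pt 0 (e.extend (𝓡∂ 2) r 1) := by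
  conv_lhs => rw [← pt_eta (e.extend (𝓡∂ 2) r), (mem_boundary_iff he hr).1 hb]

lemma symm_mem_boundary (he : e ∈ IsManifold.maximalAtlas (𝓡∂ 2) ∞ S) {x : ℝ}
    (hx : pt 0 x ∈ chartDomain e) : (e.extend (𝓡∂ 2)).symm (pt 0 x) ∈ (𝓡∂ 2).boundary S := by
  have hm : pt 0 x ∈ ℍ₂ ∩ chartDomain e := ⟨pt_zero_mem x, hx⟩
  rw [mem_boundary_iff he (extend_symm_mem hm), extend_right_inv hm]
  rfl

/-- The plane-valued map `Ξ` is adapted to `g` near the boundary point `r`, in the chart `e`. -/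
def AdaptedIn (g : Metric S) (e : OpenPartialHomeomorph S (EuclideanHalfSpace 2)) (Ξ : S → Plane)
    (r : S) : Prop :=
  AdaptedNear (coeffs g e) (fun w => Ξ ((e.extend (𝓡∂ 2)).symm w)) (e.extend (𝓡∂ 2) r 1)

/-- A property of boundary points near `r` may be checked on the boundary line of a chart. -/
lemma eventually_boundary_of_chart (he : e ∈ IsManifold.maximalAtlas (𝓡∂ 2) ∞ S) {r : S}
    (hr : r ∈ e.source) {P : S → Prop}
    (h : ∀ᶠ x in 𝓝 (e.extend (𝓡∂ 2) r 1), P ((e.extend (𝓡∂ 2)).symm (pt 0 x))) :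
    ∀ᶠ z in 𝓝 r, z ∈ (𝓡∂ 2).boundary S → P z := by
  have ht : Filter.Tendsto (fun z => e.extend (𝓡∂ 2) z 1) (𝓝 r) (𝓝 (e.extend (𝓡∂ 2) r 1)) :=
    ((continuous_coord 1).continuousAt.comp (contMDiffAt_extend he hr).continuousAt)
  filter_upwards [ht.eventually h, e.open_source.mem_nhds hr] with z hz hzs hb
  rwa [← extend_eq_pt he hzs hb, extend_left_inv hzs] at hz

lemma eventually_chart_of_boundary (he : e ∈ IsManifold.maximalAtlas (𝓡∂ 2) ∞ S) {r : S}
    (hr : r ∈ e.source) (hb : r ∈ (𝓡∂ 2).boundary S) {P : S → Prop}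
    (h : ∀ᶠ z in 𝓝 r, z ∈ (𝓡∂ 2).boundary S → P z) :
    ∀ᶠ x in 𝓝 (e.extend (𝓡∂ 2) r 1), P ((e.extend (𝓡∂ 2)).symm (pt 0 x)) := by
  have hm := extend_mem_target hr
  have h' : ∀ᶠ z in 𝓝 ((e.extend (𝓡∂ 2)).symm (e.extend (𝓡∂ 2) r)),
      z ∈ (𝓡∂ 2).boundary S → P z := by rwa [extend_left_inv hr]
  have h2 := eventually_symm_mem he hm h'
  rw [extend_eq_pt he hr hb] at h2
  filter_upwards [(tendsto_pt_zero _).eventually h2] with x hx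
  exact hx.2 (symm_mem_boundary he hx.1.2)

lemma AdaptedIn.trans {g : Metric S} {Ξ : S → Plane} {r : S}
    (he : e ∈ IsManifold.maximalAtlas (𝓡∂ 2) ∞ S) (hf : f ∈ IsManifold.maximalAtlas (𝓡∂ 2) ∞ S)
    (hr : r ∈ e.source) (hrf : r ∈ f.source) (hb : r ∈ (𝓡∂ 2).boundary S)
    (h : AdaptedIn g f Ξ r) : AdaptedIn g e Ξ r := by
  have hm := extend_mem_target hr
  have hl := extend_left_inv hr
  have hp := extend_eq_pt he hr hb
  have hθ : chartTrans e f (pt 0 (e.extend (𝓡∂ 2) r 1)) = f.extend (𝓡∂ 2) r := by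
    rw [← hp, chartTrans, hl]
  have hpb := pullbackNear_coeffs he hf g hm (by rwa [hl])
  have hev : ∀ᶠ w in 𝓝[ℍ₂] (e.extend (𝓡∂ 2) r),
      w ∈ ℍ₂ ∩ chartDomain e ∧ (e.extend (𝓡∂ 2)).symm w ∈ f.source :=
    eventually_symm_mem he hm (by rw [hl]; exact f.open_source.mem_nhds hrf)
  rw [hp] at hpb hev
  have h1 : AdaptedNear (coeffs g e)
      (fun w => Ξ ((f.extend (𝓡∂ 2)).symm (chartTrans e f w))) (e.extend (𝓡∂ 2) r 1) := by
    refine AdaptedNear.comp (M := coeffs g f) (θ := chartTrans e f)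
      (Θ := fun w => Ξ ((f.extend (𝓡∂ 2)).symm w)) (by rw [hθ]; exact h) hpb ?_
    filter_upwards [(tendsto_pt_zero _).eventually hev] with x hx
    exact (mem_boundary_iff hf hx.2).1 (symm_mem_boundary he hx.1.2)
  refine AdaptedNear.congr h1 ?_
  filter_upwards [hev] with w hw
  rw [chartTrans_symm hw.2]

/-- The map `Ξ` is adapted to `g` near the boundary point `r`. -/
def AdaptedAt (g : Metric S) (Ξ : S → Plane) (r : S) : Prop :=
  AdaptedIn g (chartAt (EuclideanHalfSpace 2) r) Ξ r

lemma adaptedAt_iff {g : Metric S} {Ξ : S → Plane} {r : S}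
    (he : e ∈ IsManifold.maximalAtlas (𝓡∂ 2) ∞ S) (hr : r ∈ e.source)
    (hb : r ∈ (𝓡∂ 2).boundary S) : AdaptedAt g Ξ r ↔ AdaptedIn g e Ξ r :=
  ⟨fun h => AdaptedIn.trans he (IsManifold.chart_mem_maximalAtlas r) hr (mem_chart_source _ r) hb h,
    fun h => AdaptedIn.trans (IsManifold.chart_mem_maximalAtlas r) he (mem_chart_source _ r) hr hb
        h⟩

namespace AdaptedAt

variable {g : Metric S} {Ξ Ξ' : S → Plane} {r : S}

lemma eventually (h : AdaptedAt g Ξ r) :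
    ∀ᶠ z in 𝓝 r, z ∈ (𝓡∂ 2).boundary S → AdaptedAt g Ξ z := by
  set e := chartAt (EuclideanHalfSpace 2) r
  have he : e ∈ IsManifold.maximalAtlas (𝓡∂ 2) ∞ S := IsManifold.chart_mem_maximalAtlas r
  have h1 : ∀ᶠ x in 𝓝 (e.extend (𝓡∂ 2) r 1),
      AdaptedNear (coeffs g e) (fun w => Ξ ((e.extend (𝓡∂ 2)).symm w)) x := AdaptedNear.eventually h
  have ht : Filter.Tendsto (fun z => e.extend (𝓡∂ 2) z 1) (𝓝 r) (𝓝 (e.extend (𝓡∂ 2) r 1)) :=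
    (continuous_coord 1).continuousAt.comp
      (contMDiffAt_extend he (mem_chart_source _ r)).continuousAt
  filter_upwards [ht.eventually h1, e.open_source.mem_nhds (mem_chart_source _ r)] with z hz hzs hb
  exact (adaptedAt_iff he hzs hb).2 hz

lemma exists_adaptedAt (g : Metric S) (hb : r ∈ (𝓡∂ 2).boundary S) : ∃ Ξ, AdaptedAt g Ξ r := by
  set e := chartAt (EuclideanHalfSpace 2) r with hed
  have he : e ∈ IsManifold.maximalAtlas (𝓡∂ 2) ∞ S := IsManifold.chart_mem_maximalAtlas r
  have hr : r ∈ e.source := mem_chart_source _ r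
  have hm := extend_mem_target hr
  have hp := extend_eq_pt he hr hb
  rw [hp] at hm
  obtain ⟨Θ, hΘ⟩ := AdaptedNear.exists_adapted (metricNear_coeffs he g hm) (coeffs_pos he g hm)
    (coeffs_det_pos he g hm)
  refine ⟨fun z => Θ (e.extend (𝓡∂ 2) z), AdaptedNear.congr hΘ ?_⟩
  filter_upwards [chartDomain_mem_nhdsWithin hm.2] with w hw
  rw [extend_right_inv hw]

/-- Two adapted maps differ, along the boundary, by an isometry of the line. -/
lemma exists_isometry (hb : r ∈ (𝓡∂ 2).boundary S) (h : AdaptedAt g Ξ r) (h' : AdaptedAt g Ξ' r) :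
    ∃ τ c : ℝ, τ ^ 2 = 1 ∧ ∀ᶠ z in 𝓝 r, z ∈ (𝓡∂ 2).boundary S → Ξ' z 1 = τ * Ξ z 1 + c := by
  set e := chartAt (EuclideanHalfSpace 2) r with hed
  have he : e ∈ IsManifold.maximalAtlas (𝓡∂ 2) ∞ S := IsManifold.chart_mem_maximalAtlas r
  have hr : r ∈ e.source := mem_chart_source _ r
  have hm := extend_mem_target hr
  rw [extend_eq_pt he hr hb] at hm
  obtain ⟨τ, c, hτ, h1⟩ := AdaptedNear.exists_isometry h h' (coeffs_pos he g hm)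
  exact ⟨τ, c, hτ, eventually_boundary_of_chart he hr h1⟩

/-- The isometry of the line which relates two adapted maps is unique. -/
lemma isometry_unique (hb : r ∈ (𝓡∂ 2).boundary S) (h : AdaptedAt g Ξ r) {τ c τ' c' : ℝ}
    (he : ∀ᶠ z in 𝓝 r, z ∈ (𝓡∂ 2).boundary S → τ * Ξ z 1 + c = τ' * Ξ z 1 + c') :
    τ = τ' ∧ c = c' := by
  set e := chartAt (EuclideanHalfSpace 2) r with hed
  have hem : e ∈ IsManifold.maximalAtlas (𝓡∂ 2) ∞ S := IsManifold.chart_mem_maximalAtlas r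
  have hr : r ∈ e.source := mem_chart_source _ r
  have hm := extend_mem_target hr
  rw [extend_eq_pt hem hr hb] at hm
  have h1 := eventually_chart_of_boundary hem hr hb he
  have h2 := (AdaptedNear.jac_eq h (coeffs_det_pos hem g hm).ne').2
  have h3 := hasDerivAt_tangential ((AdaptedNear.smooth h).apply 1 |>.diff (pt_zero_mem _))
  have h4 := (h3.const_mul τ).add_const c
  have h5 := (h3.const_mul τ').add_const c'
  have h6 := mul_right_cancel₀ h2 (h4.unique (h5.congr_of_eventuallyEq h1))
  refine ⟨h6, ?_⟩
  have := h1.self_of_nhds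
  rw [h6] at this
  linarith

lemma slide (h : AdaptedAt g Ξ r) {τ : ℝ} (hτ : τ ^ 2 = 1) (c : ℝ) :
    AdaptedAt g (fun z => slide τ c (Ξ z)) r := AdaptedNear.slide h hτ c

end AdaptedAt

end Adapted

/-! ### Charts of a surface in which the double is smooth -/

section Glue

variable {S : Type*} [TopologicalSpace S] [ChartedSpace (EuclideanHalfSpace 2) S]
  [IsManifold (𝓡∂ 2) ∞ S]

/-- A convex combination of adapted maps which agree along the boundary is adapted. -/
lemma AdaptedAt.sum {g : Metric S} {ι : Type*} {s : Finset ι} {ρ : ι → S → ℝ} {L : ι → S → Plane}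
    {Ξ : S → Plane} {r : S} (hb : r ∈ (𝓡∂ 2).boundary S)
    (hρ : ∀ i ∈ s, ContMDiff (𝓡∂ 2) 𝓘(ℝ, ℝ) ∞ (ρ i)) (hρ0 : ∀ i ∈ s, ∀ z, 0 ≤ ρ i z)
    (hρ1 : ∀ᶠ z in 𝓝 r, ∑ i ∈ s, ρ i z = 1) (hL : ∀ i ∈ s, AdaptedAt g (L i) r)
    (h : AdaptedAt g Ξ r)
    (he : ∀ i ∈ s, ∀ᶠ z in 𝓝 r, z ∈ (𝓡∂ 2).boundary S → L i z 1 = Ξ z 1) :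
    AdaptedAt g (fun z => ∑ i ∈ s, ρ i z • L i z) r := by
  set e := chartAt (EuclideanHalfSpace 2) r with hed
  have hem : e ∈ IsManifold.maximalAtlas (𝓡∂ 2) ∞ S := IsManifold.chart_mem_maximalAtlas r
  have hr : r ∈ e.source := mem_chart_source _ r
  have hm := extend_mem_target hr
  have hl := extend_left_inv hr
  have hρ1' : ∀ᶠ z in 𝓝 ((e.extend (𝓡∂ 2)).symm (e.extend (𝓡∂ 2) r)), ∑ i ∈ s, ρ i z = 1 := by
    rwa [hl]
  have hρ1'' := eventually_symm_mem hem hm hρ1'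
  have hp := extend_eq_pt hem hr hb
  rw [hp] at hm hρ1''
  refine AdaptedNear.sum (ρ := fun i w => ρ i ((e.extend (𝓡∂ 2)).symm w))
    (Θs := fun i w => L i ((e.extend (𝓡∂ 2)).symm w)) ?_ (fun i hi w => hρ0 i hi _) ?_ hL h ?_ ?_
  · exact fun i hi => smoothNear_comp_symm hem hm (Filter.Eventually.of_forall fun z => hρ i hi z)
  · filter_upwards [hρ1''] with w hw using hw.2
  · filter_upwards [(tendsto_pt_zero _).eventually (chartDomain_mem_nhdsWithin hm.2)] with x hx
    exact coeffs_pos hem g hx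
  · exact fun i hi => eventually_chart_of_boundary hem hr hb (he i hi)

lemma slide_slide (τ c τ' c' : ℝ) (w : Plane) :
    slide τ c (slide τ' c' w) = slide (τ * τ') (τ * c' + c) w := by
  simp only [slide, pt_apply_zero, pt_apply_one]
  congr 1
  ring

lemma slide_inverse {τ : ℝ} (hτ : τ ^ 2 = 1) (c : ℝ) (w : Plane) :
    slide τ (-(τ * c)) (slide τ c w) = w := by
  rw [slide_slide, ← pow_two, hτ, slide]
  simp [pt_eta]

/-- There is a family of adapted maps, one for each boundary point, any two of which differ near a
common boundary point by an isometry of the second coordinate. They are obtained by gluing, with a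
partition of unity, local adapted maps normalised by such isometries. -/
theorem exists_compatible_adapted [T2Space S] [SigmaCompactSpace S] (g : Metric S) :
    ∃ Ξ : (𝓡∂ 2).boundary S → S → Plane, (∀ p, AdaptedAt g (Ξ p) p) ∧
      ∀ p, ∀ᶠ r in 𝓝 (p : S), ∀ hr : r ∈ (𝓡∂ 2).boundary S, ∃ τ c : ℝ, τ ^ 2 = 1 ∧
        ∀ᶠ z in 𝓝 r, Ξ ⟨r, hr⟩ z = slide τ c (Ξ p z) := by
  have h1 : ∀ p : (𝓡∂ 2).boundary S, ∃ (L : S → Plane) (U : Set S), IsOpen U ∧ (p : S) ∈ U ∧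
      ∀ z ∈ U, z ∈ (𝓡∂ 2).boundary S → AdaptedAt g L z := by
    intro p
    obtain ⟨L, hL⟩ := AdaptedAt.exists_adaptedAt g p.2
    obtain ⟨U, hU, hUo, hpU⟩ := eventually_nhds_iff.1 hL.eventually
    exact ⟨L, U, hUo, hpU, hU⟩
  choose L U hUo hpU hL using h1
  -- The index `none` stands for the complement of the boundary, where no adapted map is needed.
  let U' : Option ((𝓡∂ 2).boundary S) → Set S := fun i => i.elim ((𝓡∂ 2).boundary S)ᶜ U
  let L' : Option ((𝓡∂ 2).boundary S) → S → Plane := fun i => i.elim (fun _ => 0) L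
  obtain ⟨ρ, hρ⟩ := SmoothPartitionOfUnity.exists_isSubordinate (𝓡∂ 2) (isClosed_univ (X := S)) U'
    (by
      rintro (_ | p)
      · exact isClosed_boundary'.isOpen_compl
      · exact hUo p)
    (by
      intro z _
      by_cases hz : z ∈ (𝓡∂ 2).boundary S
      · exact mem_iUnion.2 ⟨some ⟨z, hz⟩, hpU ⟨z, hz⟩⟩
      · exact mem_iUnion.2 ⟨none, hz⟩)
  set F : S → Finset (Option ((𝓡∂ 2).boundary S)) := fun r => ρ.fintsupport r with hF
  have hFad : ∀ r ∈ (𝓡∂ 2).boundary S, ∀ i ∈ F r, AdaptedAt g (L' i) r := by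
    intro r hr i hi
    have hri : r ∈ tsupport (ρ i) := (ρ.mem_fintsupport_iff r i).1 hi
    rcases i with _ | p
    · exact absurd hr (hρ none hri)
    · exact hL p r (hρ (some p) hri) hr
  have hsum : ∀ r, ∀ᶠ z in 𝓝 r, ∑ i ∈ F r, ρ i z = 1 := by
    intro r
    filter_upwards [ρ.eventually_finsupport_subset r] with z hz
    exact ρ.sum_finsupport' z (mem_univ _) hz
  -- Isometries which normalise all local adapted maps at `r` to agree with `L r` along the
  -- boundary.
  have h2 : ∀ (r : (𝓡∂ 2).boundary S) (i : Option ((𝓡∂ 2).boundary S)), ∃ τ c : ℝ, i ∈ F r →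
      τ ^ 2 = 1 ∧ ∀ᶠ z in 𝓝 (r : S), z ∈ (𝓡∂ 2).boundary S → L r z 1 = τ * L' i z 1 + c := by
    intro r i
    by_cases hi : i ∈ F r
    · obtain ⟨τ, c, h⟩ := AdaptedAt.exists_isometry r.2 (hFad r r.2 i hi) (hL r r (hpU r) r.2)
      exact ⟨τ, c, fun _ => h⟩
    · exact ⟨0, 0, fun h => absurd h hi⟩
  choose τ c hτ using h2
  refine ⟨fun r z => ∑ i ∈ F r, ρ i z • slide (τ r i) (c r i) (L' i z), fun p => ?_, fun p => ?_⟩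
  · refine AdaptedAt.sum p.2 (fun i _ => (ρ i).contMDiff) (fun i _ z => ρ.nonneg i z) (hsum p)
      (fun i hi => (hFad p p.2 i hi).slide (hτ p i hi).1 _) (hL p p (hpU p) p.2) fun i hi => ?_
    filter_upwards [(hτ p i hi).2] with z hz hzb
    exact (hz hzb).symm
  -- Passing from `p` to a nearby point `r` changes the reference map `L p` by an isometry `(t, d)`,
  -- and by uniqueness it changes all normalising isometries in the same way. The glued map is then
  -- changed by `slide t d` too, because the weights add up to one.
  · have h3 : ∀ᶠ r in 𝓝 (p : S), ∀ i ∈ F p, ∀ᶠ z in 𝓝 r,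
        z ∈ (𝓡∂ 2).boundary S → L p z 1 = τ p i * L' i z 1 + c p i :=
      (Filter.eventually_all_finset _).2 fun i hi => eventually_eventually_nhds.2 (hτ p i hi).2
    filter_upwards [h3, ρ.eventually_fintsupport_subset p, (hUo p).mem_nhds (hpU p)] with
      r h3 h4 h5 hr
    obtain ⟨t, d, ht, h6⟩ := AdaptedAt.exists_isometry hr (hL p r h5 hr)
      (hL ⟨r, hr⟩ r (hpU ⟨r, hr⟩) hr)
    have h7 : ∀ i ∈ F r, τ ⟨r, hr⟩ i = t * τ p i ∧ c ⟨r, hr⟩ i = t * c p i + d := by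
      intro i hi
      refine AdaptedAt.isometry_unique hr (hFad r hr i hi) ?_
      filter_upwards [(hτ ⟨r, hr⟩ i hi).2, h3 i (h4 hi), h6] with z e1 e2 e3 hz
      rw [← e1 hz, e3 hz, e2 hz]
      ring
    refine ⟨t, d, ht, ?_⟩
    filter_upwards [ρ.eventually_finsupport_subset r, hsum r] with z hz hz1
    -- The terms with index in `F p` but not in `F r` have weight zero near `r`.
    have h8 : ∑ i ∈ F p, ρ i z • slide (τ p i) (c p i) (L' i z)
        = ∑ i ∈ F r, ρ i z • slide (τ p i) (c p i) (L' i z) := by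
      symm
      refine Finset.sum_subset h4 fun i _ hi => ?_
      have : ρ i z = 0 := by
        by_contra h0
        exact hi (hz ((ρ.mem_finsupport z).2 h0))
      rw [this, zero_smul]
    have hco : ∀ (s : Finset (Option ((𝓡∂ 2).boundary S)))
        (W : Option ((𝓡∂ 2).boundary S) → Plane) (k : Fin 2),
        (∑ i ∈ s, ρ i z • W i) k = ∑ i ∈ s, ρ i z * W i k := by
      intro s W k
      rw [show (∑ i ∈ s, ρ i z • W i) k
        = (EuclideanSpace.proj k : Plane →L[ℝ] ℝ) (∑ i ∈ s, ρ i z • W i) from rfl, map_sum]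
      rfl
    rw [h8]
    ext k
    fin_cases k
    · change (∑ i ∈ F r, ρ i z • slide (τ ⟨r, hr⟩ i) (c ⟨r, hr⟩ i) (L' i z)) 0
        = (∑ i ∈ F r, ρ i z • slide (τ p i) (c p i) (L' i z)) 0
      rw [hco, hco]
      rfl
    · change (∑ i ∈ F r, ρ i z • slide (τ ⟨r, hr⟩ i) (c ⟨r, hr⟩ i) (L' i z)) 1
        = t * (∑ i ∈ F r, ρ i z • slide (τ p i) (c p i) (L' i z)) 1 + d
      rw [hco, hco, Finset.mul_sum]
      conv_rhs => rw [← mul_one d, ← hz1, Finset.mul_sum, ← Finset.sum_add_distrib]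
      refine Finset.sum_congr rfl fun i hi => ?_
      rw [slide_one, slide_one, (h7 i hi).1, (h7 i hi).2]
      ring

end Glue

variable (S : Type*) [TopologicalSpace S] [ChartedSpace (EuclideanHalfSpace 2) S]
  [IsManifold (𝓡∂ 2) ∞ S] in
/-- A family of charts, one around each point, such that the coordinate changes near boundary points
are of the form `(y, x) ↦ (y, ± x + c)`. These extend to smooth maps of the plane which commute with
the reflection. -/
structure FlatAtlas where
  chart : S → OpenPartialHomeomorph S (EuclideanHalfSpace 2)
  mem_maximal : ∀ p, chart p ∈ IsManifold.maximalAtlas (𝓡∂ 2) ∞ S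
  mem_source : ∀ p, p ∈ (chart p).source
  compat : ∀ p q, ∀ r ∈ (𝓡∂ 2).boundary S, r ∈ (chart p).source → r ∈ (chart q).source →
    ∃ τ c : ℝ, τ ^ 2 = 1 ∧ ∀ᶠ z in 𝓝 r,
      (chart q).extend (𝓡∂ 2) z = slide τ c ((chart p).extend (𝓡∂ 2) z)

section Atlas

variable {S : Type*} [TopologicalSpace S] [ChartedSpace (EuclideanHalfSpace 2) S]
  [IsManifold (𝓡∂ 2) ∞ S]

lemma trans_mem_maximalAtlas {e : OpenPartialHomeomorph S (EuclideanHalfSpace 2)}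
    {E : OpenPartialHomeomorph (EuclideanHalfSpace 2) (EuclideanHalfSpace 2)}
    (he : e ∈ IsManifold.maximalAtlas (𝓡∂ 2) ∞ S) (hE : E ∈ contDiffGroupoid ∞ (𝓡∂ 2)) :
    e ≫ₕ E ∈ IsManifold.maximalAtlas (𝓡∂ 2) ∞ S := by
  intro f hf
  have h := he f hf
  constructor
  · rw [OpenPartialHomeomorph.trans_symm_eq_symm_trans_symm, OpenPartialHomeomorph.trans_assoc]
    exact StructureGroupoid.trans _ (StructureGroupoid.symm _ hE) h.1
  · rw [← OpenPartialHomeomorph.trans_assoc]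
    exact StructureGroupoid.trans _ h.2 hE

/-- An adapted map restricts to a chart around the boundary point. -/
lemma AdaptedAt.exists_chart {g : Metric S} {Ξ : S → Plane} {p : S}
    (hb : p ∈ (𝓡∂ 2).boundary S) (h : AdaptedAt g Ξ p) {V : Set S} (hV : V ∈ 𝓝 p) :
    ∃ e ∈ IsManifold.maximalAtlas (𝓡∂ 2) ∞ S, p ∈ e.source ∧ e.source ⊆ V ∧
      ∀ z ∈ e.source, e.extend (𝓡∂ 2) z = Ξ z := by
  set φ := chartAt (EuclideanHalfSpace 2) p with hφd
  have hφ : φ ∈ IsManifold.maximalAtlas (𝓡∂ 2) ∞ S := IsManifold.chart_mem_maximalAtlas p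
  have hp : p ∈ φ.source := mem_chart_source _ p
  have hm := extend_mem_target hp
  have hpt := extend_eq_pt hφ hp hb
  have hV' : ∀ᶠ w in 𝓝[ℍ₂] (φ.extend (𝓡∂ 2) p), (φ.extend (𝓡∂ 2)).symm w ∈ V := by
    have : V ∈ 𝓝 ((φ.extend (𝓡∂ 2)).symm (φ.extend (𝓡∂ 2) p)) := by rwa [extend_left_inv hp]
    filter_upwards [eventually_symm_mem hφ hm this] with w hw using hw.2
  rw [eventually_nhdsWithin_iff] at hV'
  have hj := AdaptedNear.jac_eq h (coeffs_det_pos hφ g (by rwa [← hpt])).ne'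
  obtain ⟨E, hE, huE, hEO, hEθ⟩ := exists_halfPlane_diffeomorph
    (u := pt 0 (φ.extend (𝓡∂ 2) p 1)) rfl (AdaptedNear.smooth h) (AdaptedNear.zero h)
    (AdaptedNear.nonneg h) hj.1 hj.2 (by rw [← hpt]; exact hV')
  rw [← hpt, extend_apply, (𝓡∂ 2).left_inv] at huE
  refine ⟨φ ≫ₕ E, trans_mem_maximalAtlas hφ hE, ?_, ?_, ?_⟩
  · rw [OpenPartialHomeomorph.trans_source]
    exact ⟨hp, huE⟩
  · intro z hz
    rw [OpenPartialHomeomorph.trans_source] at hz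
    have h1 : (φ.extend (𝓡∂ 2)).symm ((𝓡∂ 2) (φ z)) ∈ V := hEO _ hz.2 (mem_range_self _)
    rwa [← extend_apply, extend_left_inv hz.1] at h1
  · intro z hz
    rw [OpenPartialHomeomorph.trans_source] at hz
    rw [extend_apply, OpenPartialHomeomorph.trans_apply, hEθ _ hz.2, ← extend_apply,
      extend_left_inv hz.1]

/-- There is an atlas as above in whose charts the metric is Euclidean along the boundary. -/
theorem exists_flatAtlas [T2Space S] [SigmaCompactSpace S] (g : Metric S) :
    ∃ A : FlatAtlas S, ∀ p x, pt 0 x ∈ chartDomain (A.chart p) →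
      coeffs g (A.chart p) (pt 0 x) = 1 := by
  obtain ⟨Ξ, hΞ, hcomp⟩ := exists_compatible_adapted g
  have h1 : ∀ p : S, ∃ e ∈ IsManifold.maximalAtlas (𝓡∂ 2) ∞ S, p ∈ e.source ∧
      (p ∉ (𝓡∂ 2).boundary S → ∀ r ∈ e.source, r ∉ (𝓡∂ 2).boundary S) ∧
      ∀ hp : p ∈ (𝓡∂ 2).boundary S, (∀ z ∈ e.source, e.extend (𝓡∂ 2) z = Ξ ⟨p, hp⟩ z) ∧
        (∀ r ∈ e.source, r ∈ (𝓡∂ 2).boundary S → AdaptedAt g (Ξ ⟨p, hp⟩) r) ∧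
        ∀ r ∈ e.source, ∀ hr : r ∈ (𝓡∂ 2).boundary S, ∃ τ c : ℝ, τ ^ 2 = 1 ∧
          ∀ᶠ z in 𝓝 r, Ξ ⟨r, hr⟩ z = slide τ c (Ξ ⟨p, hp⟩ z) := by
    intro p
    by_cases hp : p ∈ (𝓡∂ 2).boundary S
    -- A boundary point has a chart given by its adapted map, and an interior point one that does
    -- not meet the boundary.
    · obtain ⟨e, he, hpe, hV, hez⟩ := (hΞ ⟨p, hp⟩).exists_chart hp
        (Filter.inter_mem (hΞ ⟨p, hp⟩).eventually (hcomp ⟨p, hp⟩))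
      exact ⟨e, he, hpe, fun h => absurd hp h, fun _ => ⟨hez, fun r hr => (hV hr).1,
        fun r hr => (hV hr).2⟩⟩
    · have ho : IsOpen ((𝓡∂ 2).boundary S)ᶜ := isClosed_boundary'.isOpen_compl
      refine ⟨(chartAt (EuclideanHalfSpace 2) p).restr ((𝓡∂ 2).boundary S)ᶜ,
        restr_mem_maximalAtlas _ (IsManifold.chart_mem_maximalAtlas p) ho, ?_, ?_,
        fun h => absurd h hp⟩
      · rw [OpenPartialHomeomorph.restr_source, ho.interior_eq]
        exact ⟨mem_chart_source _ p, hp⟩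
      · intro _ r hr
        rw [OpenPartialHomeomorph.restr_source, ho.interior_eq] at hr
        exact hr.2
  choose e he hpe hint hbd using h1
  have hbp : ∀ p, ∀ r ∈ (𝓡∂ 2).boundary S, r ∈ (e p).source → p ∈ (𝓡∂ 2).boundary S := by
    intro p r hr hrp
    by_contra hp
    exact hint p hp r hrp hr
  refine ⟨⟨e, he, hpe, ?_⟩, ?_⟩
  · intro p q r hr hrp hrq
    obtain ⟨z1, -, h1⟩ := hbd p (hbp p r hr hrp)
    obtain ⟨z2, -, h2⟩ := hbd q (hbp q r hr hrq)
    obtain ⟨t, c, ht, ht'⟩ := h1 r hrp hr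
    obtain ⟨s, d, hs, hs'⟩ := h2 r hrq hr
    refine ⟨s * t, s * c + -(s * d), by rw [mul_pow, ht, hs, one_mul], ?_⟩
    filter_upwards [ht', hs', (e p).open_source.mem_nhds hrp, (e q).open_source.mem_nhds hrq] with
      z e1 e2 e3 e4
    rw [z1 z e3, z2 z e4, ← slide_slide, ← e1, e2, slide_inverse hs]
  · intro p x hx
    have hm : pt 0 x ∈ ℍ₂ ∩ chartDomain (e p) := ⟨pt_zero_mem x, hx⟩
    set r := ((e p).extend (𝓡∂ 2)).symm (pt 0 x) with hr
    have hrs : r ∈ (e p).source := extend_symm_mem hm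
    have hrb : r ∈ (𝓡∂ 2).boundary S := symm_mem_boundary (he p) hx
    obtain ⟨z1, h1, -⟩ := hbd p (hbp p r hrb hrs)
    have h2 := (adaptedAt_iff (he p) hrs hrb).1 (h1 r hrs hrb)
    have hrx : (e p).extend (𝓡∂ 2) r = pt 0 x := extend_right_inv hm
    -- In a chart given by an adapted map, this map is the identity, which is therefore isometric to
    -- first order.
    have h3 : AdaptedNear (coeffs g (e p)) (fun w => w) x := by
      have h4 : AdaptedNear (coeffs g (e p))
          (fun w => Ξ ⟨p, hbp p r hrb hrs⟩ (((e p).extend (𝓡∂ 2)).symm w)) x := by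
        have := h2
        rw [AdaptedIn, hrx] at this
        exact this
      refine h4.congr ?_
      filter_upwards [chartDomain_mem_nhdsWithin hx] with w hw
      rw [← z1 _ (extend_symm_mem hw), extend_right_inv hw]
    have h5 := h3.isom.self_of_nhds
    have h6 : ∀ i k, partialWithin ℍ₂ i (fun w : Plane => w k) (pt 0 x) = if i = k then 1 else 0 :=
      fun i k => (HasPartial.coord (pt_zero_mem x) k).eq
    simp only [h6] at h5
    change coeffs g (e p) (pt 0 x) = 1
    ext i j
    rw [h5 i j]
    fin_cases i <;> fin_cases j <;> simp

end Atlas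

/-! ### Metrics with geodesic boundary in the charts of a flat atlas -/

lemma contDiff_slide (τ c : ℝ) : ContDiff ℝ ∞ (slide τ c) :=
  contDiff_pt (contDiff_coord 0) ((contDiff_const.mul (contDiff_coord 1)).add contDiff_const)

lemma foldPt_slide (τ c : ℝ) (w : Plane) : foldPt (slide τ c w) = slide τ c (foldPt w) := rfl

/-- Near `v`, the metric `M'` is the pullback of `M` by `slide τ c`. -/
def SlideRel (M M' : Plane → Matrix (Fin 2) (Fin 2) ℝ) (τ c : ℝ) (v : Plane) : Prop :=
  ∀ᶠ w in 𝓝[ℍ₂] v, M' w = !![M (slide τ c w) 0 0, τ * M (slide τ c w) 0 1;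
    τ * M (slide τ c w) 1 0, M (slide τ c w) 1 1]

namespace SlideRel

variable {M M' : Plane → Matrix (Fin 2) (Fin 2) ℝ} {τ c : ℝ} {v : Plane}

lemma eq_one (h : SlideRel M M' τ c v) (hv : v ∈ ℍ₂) (h1 : M (slide τ c v) = 1) : M' v = 1 := by
  have := h.self_of_nhdsWithin hv
  rw [this, h1]
  ext i j
  fin_cases i <;> fin_cases j <;> simp

lemma partial_eq (h : SlideRel M M' τ c v) (hv : v ∈ ℍ₂)
    (hM : SmoothNear (fun w => M w 1 1) (slide τ c v)) :
    partialWithin ℍ₂ 0 (fun w => M' w 1 1) v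
      = partialWithin ℍ₂ 0 (fun w => M w 1 1) (slide τ c v) := by
  have hm : ∀ w ∈ ℍ₂, slide τ c w ∈ ℍ₂ := fun w hw => pt_mem_half.2 (mem_half.1 hw)
  have hs : SmoothNear (slide τ c) v := SmoothNear.of_contDiff (contDiff_slide τ c)
  have h1 := HasPartial.comp (i := 0) (hM.diff (hm v hv)) (hs.diff hv) hv
    (Filter.eventually_of_mem self_mem_nhdsWithin hm)
  have h2 : HasPartial 0 (fun w => M' w 1 1) _ v := h1.congr (by
    filter_upwards [h] with w hw
    rw [hw]; rfl)
  rw [h2.eq]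
  have e0 : partialWithin ℍ₂ 0 (fun w => slide τ c w 0) v = 1 := (HasPartial.coord hv 0).eq
  have e1 : partialWithin ℍ₂ 0 (fun w => slide τ c w 1) v = 0 :=
    ((((HasPartial.coord hv 1).const_mul τ).add (HasPartial.const hv c)).of_eq
      (by simp : _ = (0 : ℝ))).eq
  rw [e0, e1]
  ring

lemma evenAt (h : SlideRel M M' τ c v) (hv : v 0 = 0) (hM : EvenAt M (slide τ c v)) :
    EvenAt M' v := by
  have hf : foldPt v = v := by rw [foldPt, hv, abs_zero, ← hv, pt_eta]
  have ht : Filter.Tendsto foldPt (𝓝 v) (𝓝[ℍ₂] v) := by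
    refine tendsto_nhdsWithin_iff.2 ⟨?_, Filter.Eventually.of_forall fun w =>
      pt_mem_half.2 (abs_nonneg _)⟩
    have := continuous_foldPt.tendsto v
    rwa [hf] at this
  have hev := ht.eventually h
  have hs : ContDiffAt ℝ ∞ (slide τ c) v := (contDiff_slide τ c).contDiffAt
  obtain ⟨h1, h2, h3⟩ := hM
  refine ⟨(h1.comp v hs).congr_of_eventuallyEq ?_, ?_, (h3.comp v hs).congr_of_eventuallyEq ?_⟩
  · filter_upwards [hev] with w hw
    simp only [hw, Function.comp_apply, foldPt_slide]; rfl
  · refine (contDiffAt_const (c := τ) |>.mul (h2.comp v hs)).congr_of_eventuallyEq ?_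
    filter_upwards [hev] with w hw
    simp only [hw, Function.comp_apply, foldPt_slide]
    change side w * (τ * _) = τ * (side w * _)
    ring
  · filter_upwards [hev] with w hw
    simp only [hw, Function.comp_apply, foldPt_slide]; rfl

end SlideRel

section Geodesic

variable {S : Type*} [TopologicalSpace S] [ChartedSpace (EuclideanHalfSpace 2) S]
  [IsManifold (𝓡∂ 2) ∞ S]

/-- The expressions of a metric in two charts of a flat atlas are related by a slide near boundary
points. -/
lemma FlatAtlas.exists_slideRel (A : FlatAtlas S) (p q : S) {r : S} (hb : r ∈ (𝓡∂ 2).boundary S)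
    (hp : r ∈ (A.chart p).source) (hq : r ∈ (A.chart q).source) : ∃ τ c : ℝ,
      slide τ c ((A.chart p).extend (𝓡∂ 2) r) = (A.chart q).extend (𝓡∂ 2) r ∧
      ∀ g : Metric S, SlideRel (coeffs g (A.chart q)) (coeffs g (A.chart p)) τ c
        ((A.chart p).extend (𝓡∂ 2) r) := by
  obtain ⟨τ, c, hτ, h⟩ := A.compat p q r hb hp hq
  refine ⟨τ, c, h.self_of_nhds.symm, fun g => ?_⟩
  have hm := extend_mem_target hp
  have hl := extend_left_inv hp
  have hpb := pullbackNear_coeffs (A.mem_maximal p) (A.mem_maximal q) g hm (by rwa [hl])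
  have h' : ∀ᶠ z in 𝓝 (((A.chart p).extend (𝓡∂ 2)).symm ((A.chart p).extend (𝓡∂ 2) r)),
      (A.chart q).extend (𝓡∂ 2) z = slide τ c ((A.chart p).extend (𝓡∂ 2) z) := by rwa [hl]
  have h2 : chartTrans (A.chart p) (A.chart q) =ᶠ[𝓝[ℍ₂] ((A.chart p).extend (𝓡∂ 2) r)]
      slide τ c := by
    filter_upwards [eventually_symm_mem (A.mem_maximal p) hm h'] with w hw
    rw [chartTrans, hw.2, extend_right_inv hw.1]
  have h3 : ∀ᶠ w in 𝓝[ℍ₂] ((A.chart p).extend (𝓡∂ 2) r), ∀ i k,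
      partialWithin ℍ₂ i (fun z => chartTrans (A.chart p) (A.chart q) z k) w
        = partialWithin ℍ₂ i (fun z => slide τ c z k) w :=
    Filter.eventually_all.2 fun i => Filter.eventually_all.2 fun k =>
      partialWithin_congr (by filter_upwards [h2] with w hw; rw [hw]) i
  filter_upwards [hpb.eq, h2, h3, self_mem_nhdsWithin] with w e1 e2 e3 hw
  have d0 : ∀ i : Fin 2, partialWithin ℍ₂ i (fun w => slide τ c w 0) w = if i = 0 then 1 else 0 :=
    fun i => (HasPartial.coord hw 0).eq
  have d1 : ∀ i : Fin 2, partialWithin ℍ₂ i (fun w => slide τ c w 1) w = if i = 1 then τ else 0 :=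
    fun i => ((((HasPartial.coord hw 1).const_mul τ).add (HasPartial.const hw c)).of_eq
      (by simp : _ = if i = 1 then τ else 0)).eq
  ext i j
  rw [e1]
  simp only [e2, e3, Fin.sum_univ_two, d0, d1]
  fin_cases i <;> fin_cases j <;> simp
  rw [← pow_two, hτ, one_mul]

/-- If the boundary is geodesic, then the normal part of `∇_∂₁ ∂₁` vanishes at the boundary point
`r`, in the preferred chart at `r`. -/
lemma HasGeodesicBoundary.christoffel_eq_zero {g : Metric S} (hg : HasGeodesicBoundary g) {r : S}
    (hb : r ∈ (𝓡∂ 2).boundary S) :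
    christoffel ℍ₂ (metricCoeff g r) 0 1 1 (extChartAt (𝓡∂ 2) r r) = 0 := by
  obtain ⟨γ, δ, hδ, rfl, hγ, hγb⟩ := hg r hb
  have h0 : (0 : ℝ) ∈ Ioo (-δ) δ := ⟨by linarith, hδ⟩
  set e := chartAt (EuclideanHalfSpace 2) (γ 0) with hed
  have he : e ∈ IsManifold.maximalAtlas (𝓡∂ 2) ∞ S := IsManifold.chart_mem_maximalAtlas _
  have hs : γ 0 ∈ e.source := mem_chart_source _ _
  set u : ℝ → Plane := fun τ => e.extend (𝓡∂ 2) (γ τ) with hu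
  have hJ : Ioo (-δ) δ ∈ 𝓝 (0 : ℝ) := Ioo_mem_nhds h0.1 h0.2
  have hγ0 : ∀ t ∈ Ioo (-δ) δ, ContMDiffAt 𝓘(ℝ, ℝ) (𝓡∂ 2) ∞ γ t := fun t ht =>
    hγ.smooth.contMDiffAt (Ioo_mem_nhds ht.1 ht.2)
  have hsrc : ∀ᶠ t in 𝓝 (0 : ℝ), γ t ∈ e.source :=
    (hγ0 0 h0).continuousAt.eventually (e.open_source.mem_nhds hs)
  have hus : ∀ᶠ t in 𝓝 (0 : ℝ), ContDiffAt ℝ ∞ u t := by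
    filter_upwards [hsrc, hJ] with t h1 h2
    exact ((contMDiffAt_extend he h1).comp t (hγ0 t h2)).contDiffAt
  have hu0 : ∀ᶠ t in 𝓝 (0 : ℝ), u t 0 = 0 := by
    filter_upwards [hsrc, hJ] with t h1 h2
    exact (mem_boundary_iff he h1).1 (hγb t h2)
  -- The curve stays on the boundary line, so the normal components of its first two derivatives
  -- vanish.
  have hzero : ∀ {f : ℝ → Plane} {t : ℝ}, DifferentiableAt ℝ f t → (∀ᶠ s in 𝓝 t, f s 0 = 0) →
      deriv f t 0 = 0 := by
    intro f t hf h
    have h1 : HasDerivAt (fun s => f s 0) (deriv f t 0) t :=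
      (EuclideanSpace.proj 0 : Plane →L[ℝ] ℝ).hasFDerivAt.comp_hasDerivAt t hf.hasDerivAt
    exact h1.unique ((hasDerivAt_const t (0 : ℝ)).congr_of_eventuallyEq h)
  have hd0 : ∀ᶠ t in 𝓝 (0 : ℝ), deriv u t 0 = 0 := by
    filter_upwards [hus, eventually_eventually_nhds.2 hu0] with t h1 h2
    exact hzero (h1.differentiableAt (by simp)) h2
  have hus0 : ContDiffAt ℝ ∞ u 0 := hus.self_of_nhds
  have hfd : ContDiffAt ℝ ∞ (fderiv ℝ u) 0 := hus0.fderiv_right (by exact le_rfl)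
  have hdd : DifferentiableAt ℝ (deriv u) 0 :=
    (hfd.differentiableAt (by simp)).clm_apply (differentiableAt_const (1 : ℝ))
  have hdd0 : deriv (deriv u) 0 0 = 0 := hzero hdd hd0
  -- What is left of the normal component of the geodesic equation is `Γ⁰₁₁ (u₁')² = 0`.
  have hgeo := hγ.geodesic 0 h0 0
  have hgeo' : deriv (deriv u) 0 0 + ∑ i, ∑ j, christoffel ℍ₂ (metricCoeff g (γ 0)) 0 i j (u 0)
      * deriv u 0 i * deriv u 0 j = 0 := hgeo
  rw [hdd0] at hgeo'
  simp only [Fin.sum_univ_two, hd0.self_of_nhds, mul_zero, zero_mul, zero_add] at hgeo'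
  -- The velocity does not vanish, because the geodesic has unit speed.
  have hu1 : deriv u 0 1 ≠ 0 := by
    intro h1
    have hz : deriv u 0 = 0 := by
      ext i; fin_cases i
      · exact hd0.self_of_nhds
      · exact h1
    have hm := mfderiv_comp (I := 𝓘(ℝ, ℝ)) (I' := 𝓡∂ 2) (I'' := 𝓘(ℝ, Plane)) (0 : ℝ)
      ((contMDiffAt_extend he hs).mdifferentiableAt (by simp))
      ((hγ0 0 h0).mdifferentiableAt (by simp))
    have hm2 : deriv u 0 = dchart e (γ 0) (mfderiv 𝓘(ℝ, ℝ) (𝓡∂ 2) γ 0 (1 : ℝ)) := by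
      rw [mfderiv_eq_fderiv] at hm
      exact DFunLike.congr_fun hm (1 : ℝ)
    have hsp := hγ.unitSpeed 0 h0
    rw [inner_eq_coeffs he g hs, ← hm2, hz] at hsp
    simp at hsp
  have := mul_eq_zero.1 hgeo'
  rcases this with h | h
  · rcases mul_eq_zero.1 h with h | h
    · exact h
    · exact absurd h hu1
  · exact absurd h hu1

/-- A metric with geodesic boundary which is Euclidean along the boundary in the charts of a flat
atlas satisfies there the hypotheses of the planar construction. -/
theorem geodesicChart_coeffs {g : Metric S} (hg : HasGeodesicBoundary g)
    {e : OpenPartialHomeomorph S (EuclideanHalfSpace 2)}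
    (he : e ∈ IsManifold.maximalAtlas (𝓡∂ 2) ∞ S)
    (h1 : ∀ x, pt 0 x ∈ chartDomain e → coeffs g e (pt 0 x) = 1) :
    GeodesicChart (coeffs g e) (chartDomain e) := by
  refine ⟨isOpen_chartDomain e, fun v hv => metricNear_coeffs he g hv, fun x hx => ⟨h1 x hx, ?_⟩⟩
  have hm : pt 0 x ∈ ℍ₂ ∩ chartDomain e := ⟨pt_zero_mem x, hx⟩
  set r := (e.extend (𝓡∂ 2)).symm (pt 0 x) with hr
  have hrb : r ∈ (𝓡∂ 2).boundary S := symm_mem_boundary he hx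
  set f := chartAt (EuclideanHalfSpace 2) r with hf
  have hfm : f ∈ IsManifold.maximalAtlas (𝓡∂ 2) ∞ S := IsManifold.chart_mem_maximalAtlas r
  have hrf : r ∈ f.source := mem_chart_source _ r
  have hpb := pullbackNear_coeffs he hfm g hm hrf
  have hθ0 : ∀ᶠ t in 𝓝 x, chartTrans e f (pt 0 t) 0 = 0 := by
    filter_upwards [(tendsto_pt_zero x).eventually
      (eventually_symm_mem he hm (f.open_source.mem_nhds hrf))] with t ht
    exact (mem_boundary_iff hfm ht.2).1 (symm_mem_boundary he ht.1.2)
  have hsm := hpb.smooth.apply 0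
  have hθ1 : ∀ᶠ t in 𝓝 x, partialWithin ℍ₂ 1 (fun z => chartTrans e f z 0) (pt 0 t) = 0 := by
    filter_upwards [(tendsto_pt_zero x).eventually hsm.eventually,
      eventually_eventually_nhds.2 hθ0] with t h1 h2
    exact partial_one_eq_zero (h1.diff (pt_zero_mem t)) h2
  have hΓ := hpb.christoffel_boundary hθ1.self_of_nhds
    (partial_one_eq_zero ((hsm.partial_ 1).diff hm.1) hθ1) (hg.christoffel_eq_zero hrb)
  have hone : ∀ᶠ t in 𝓝 x, coeffs g e (pt 0 t) = 1 := by
    filter_upwards [(tendsto_pt_zero x).eventually (chartDomain_mem_nhdsWithin hx)] with t ht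
    exact h1 t ht.2
  have h10 : partialWithin ℍ₂ 1 (fun w => coeffs g e w 1 0) (pt 0 x) = 0 := by
    refine partial_one_eq_zero ((smoothNear_coeffs he g hm 1 0).diff hm.1) ?_
    filter_upwards [hone] with t ht
    rw [ht]; simp
  -- For the identity matrix, and as `M₁₀` is zero along the boundary, `Γ⁰₁₁ = - ∂₀M₁₁ / 2`.
  rw [christoffel, h1 x hx] at hΓ
  simp only [inv_one, Fin.sum_univ_two, h10, Matrix.one_apply_eq,
    Matrix.one_apply_ne (show (0 : Fin 2) ≠ 1 by decide)] at hΓ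
  linarith

end Geodesic

/-! ### The smooth structure of the double -/

lemma tendsto_foldPt (v : Plane) : Filter.Tendsto foldPt (𝓝 v) (𝓝[ℍ₂] (foldPt v)) :=
  tendsto_nhdsWithin_iff.2 ⟨continuous_foldPt.tendsto v, Filter.Eventually.of_forall foldPt_mem⟩

lemma foldPt_of_eq_zero {v : Plane} (h : v 0 = 0) : foldPt v = v := foldPt_of_nonneg h.ge

/-- The copy of the half-plane with label `b` in the plane: `true` stands for the right half-plane
and `false` for the left one. -/
def toSide (b : Bool) (w : Plane) : Plane := pt ((if b then 1 else -1) * w 0) (w 1)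

lemma toSide_true (w : Plane) : toSide true w = w := by simp [toSide, pt_eta]

lemma contDiff_toSide (b : Bool) : ContDiff ℝ ∞ (toSide b) :=
  contDiff_pt (contDiff_const.mul (contDiff_coord 0)) (contDiff_coord 1)

lemma toSide_toSide (b : Bool) (w : Plane) : toSide b (toSide b w) = w := by
  cases b <;> simp [toSide, pt_eta]

lemma toSide_not (b : Bool) (w : Plane) : toSide (!b) w = toSide false (toSide b w) := by
  cases b <;> simp [toSide, pt_eta]

lemma toSide_of_eq_zero {w : Plane} (h : w 0 = 0) (b c : Bool) : toSide b w = toSide c w := by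
  simp [toSide, h]

lemma foldPt_toSide (b : Bool) {w : Plane} (h : w ∈ ℍ₂) : foldPt (toSide b w) = w := by
  have := mem_half.1 h
  cases b <;> simp [toSide, foldPt, abs_of_nonneg this, pt_eta]

lemma toSide_foldPt (v : Plane) : toSide (decide (0 ≤ v 0)) (foldPt v) = v := by
  rcases le_or_gt 0 (v 0) with h | h
  · simp [h, toSide_true, foldPt_of_nonneg h]
  · simp [not_le.2 h, toSide, foldPt, abs_of_neg h, pt_eta]

section Double

variable {S : Type*} [TopologicalSpace S] [ChartedSpace (EuclideanHalfSpace 2) S]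

/-- The projection of the double onto the surface. -/
def Double.proj : Double S → S := Quotient.lift Prod.fst fun _ _ h => h.1

lemma Double.continuous_proj : Continuous (Double.proj : Double S → S) :=
  continuous_fst.quotient_lift _

lemma Double.continuous_incl (b : Bool) : Continuous (Double.incl b : S → Double S) :=
  continuous_quotient_mk'.comp (Continuous.prodMk_left b)

lemma Double.continuous_swap : Continuous (Double.swap : Double S → Double S) :=
  (continuous_fst.prodMk ((continuous_of_discreteTopology (f := not)).comp
    continuous_snd)).quotient_map' _

lemma Double.exists_incl (a : Double S) : ∃ b x, a = Double.incl b x := by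
  obtain ⟨⟨x, b⟩, rfl⟩ := Quotient.exists_rep a
  exact ⟨b, x, rfl⟩

lemma Double.incl_eq_incl {b c : Bool} {x : S} (hx : x ∈ (𝓡∂ 2).boundary S) :
    Double.incl b x = Double.incl c x := Quotient.sound ⟨rfl, Or.inr hx⟩

/-- The map to the plane given by a chart of the surface on both of its copies. A point is
represented by `Quotient.out`; on the domain of the chart the choice is irrelevant, by
`doubleMap_incl`. -/
def doubleMap (e : OpenPartialHomeomorph S (EuclideanHalfSpace 2)) (a : Double S) : Plane :=
  toSide (Quotient.out a).2 (e.extend (𝓡∂ 2) (Quotient.out a).1)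

/-- The inverse of `doubleMap`. -/
def doubleInv (e : OpenPartialHomeomorph S (EuclideanHalfSpace 2)) (v : Plane) : Double S :=
  Double.incl (decide (0 ≤ v 0)) ((e.extend (𝓡∂ 2)).symm (foldPt v))

variable [IsManifold (𝓡∂ 2) ∞ S] {e f : OpenPartialHomeomorph S (EuclideanHalfSpace 2)}

lemma doubleMap_incl (he : e ∈ IsManifold.maximalAtlas (𝓡∂ 2) ∞ S) (b : Bool) {z : S}
    (hz : z ∈ e.source) : doubleMap e (Double.incl b z) = toSide b (e.extend (𝓡∂ 2) z) := by
  have h : (doubleSetoid S).r (Quotient.out (Double.incl b z)) (z, b) := Quotient.mk_out (z, b)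
  obtain ⟨h1, h2⟩ := h
  rw [doubleMap, h1]
  rcases h2 with h2 | h2
  · rw [h2]
  · rw [h1] at h2
    exact toSide_of_eq_zero ((mem_boundary_iff he hz).1 h2) _ _

/-- Continuity of a chart of the double may be checked on the disjoint union of the two copies. -/
lemma continuousOn_doubleMap (he : e ∈ IsManifold.maximalAtlas (𝓡∂ 2) ∞ S) :
    ContinuousOn (doubleMap e) (Double.proj ⁻¹' e.source) := by
  have hq : Topology.IsQuotientMap (fun a : S × Bool => Double.incl a.2 a.1) :=
    isQuotientMap_quot_mk
  rw [hq.continuousOn_isOpen_iff (e.open_source.preimage Double.continuous_proj)]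
  have h1 : ContinuousOn (fun a : S × Bool => pt ((if a.2 then 1 else -1) * e.extend (𝓡∂ 2) a.1 0)
      (e.extend (𝓡∂ 2) a.1 1)) (Prod.fst ⁻¹' e.source) := by
    have h2 : ContinuousOn (fun a : S × Bool => e.extend (𝓡∂ 2) a.1) (Prod.fst ⁻¹' e.source) := by
      have := e.continuousOn_extend (I := 𝓡∂ 2)
      rw [e.extend_source] at this
      exact this.comp continuousOn_fst fun _ h => h
    have h3 : Continuous (fun a : S × Bool => if a.2 then (1 : ℝ) else -1) :=
      (continuous_of_discreteTopology (f := fun b : Bool => if b then (1 : ℝ) else -1)).comp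
        continuous_snd
    exact (contDiff_pt (n := 0) (f := fun w : ℝ × ℝ => w.1) (g := fun w : ℝ × ℝ => w.2)
      contDiff_fst contDiff_snd).continuous.comp_continuousOn
      ((h3.continuousOn.mul ((continuous_coord 0).comp_continuousOn h2)).prodMk
        ((continuous_coord 1).comp_continuousOn h2))
  exact h1.congr fun a ha => doubleMap_incl he a.2 ha

/-- The inverse is continuous on each of the two closed half-planes, and on the boundary line the
two expressions agree, because the two copies of a boundary point are identified. -/
lemma continuousOn_doubleInv (he : e ∈ IsManifold.maximalAtlas (𝓡∂ 2) ∞ S) :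
    ContinuousOn (doubleInv e) (foldPt ⁻¹' chartDomain e) := by
  intro v hv
  have hc : ∀ b, ContinuousAt (fun w => Double.incl b ((e.extend (𝓡∂ 2)).symm (foldPt w))) v := by
    intro b
    have h1 : ContinuousWithinAt (e.extend (𝓡∂ 2)).symm ℍ₂ (foldPt v) :=
      (contMDiffWithinAt_extend_symm he ⟨foldPt_mem v, hv⟩).continuousWithinAt
    exact (Double.continuous_incl b).continuousAt.comp (h1.tendsto.comp (tendsto_foldPt v))
  refine ContinuousAt.continuousWithinAt ?_
  have hcov : (univ : Set Plane) = {w | 0 ≤ w 0} ∪ {w | w 0 ≤ 0} := by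
    ext w; simpa using le_total 0 (w 0)
  have hev : ∀ᶠ w in 𝓝 v, foldPt w ∈ chartDomain e :=
    ((isOpen_chartDomain e).preimage continuous_foldPt).mem_nhds hv
  rw [← continuousWithinAt_univ, hcov]
  refine ContinuousWithinAt.union ?_ ?_
  · by_cases h : v ∈ {w : Plane | 0 ≤ w 0}
    · exact (hc true).continuousWithinAt.congr (fun w hw => by simp [doubleInv, show 0 ≤ w 0 from
        hw])
        (by simp [doubleInv, show 0 ≤ v 0 from h])
    · refine continuousWithinAt_of_notMem_closure ?_
      rwa [(isClosed_le continuous_const (continuous_coord 0)).closure_eq]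
  · by_cases h : v ∈ {w : Plane | w 0 ≤ 0}
    · have key : ∀ w : Plane, w 0 ≤ 0 → foldPt w ∈ chartDomain e →
          doubleInv e w = Double.incl false ((e.extend (𝓡∂ 2)).symm (foldPt w)) := by
        intro w hw hw'
        rcases hw.lt_or_eq with hw | hw
        · simp [doubleInv, not_le.2 hw]
        · refine Double.incl_eq_incl ?_
          have h0 : foldPt w = pt 0 (w 1) := by simp [foldPt, hw]
          rw [h0] at hw' ⊢
          exact symm_mem_boundary he hw'
      refine (hc false).continuousWithinAt.congr_of_eventuallyEq ?_ (key v h hv)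
      filter_upwards [self_mem_nhdsWithin, mem_nhdsWithin_of_mem_nhds hev] with w h1 h2
        using key w h1 h2
    · refine continuousWithinAt_of_notMem_closure ?_
      rwa [(isClosed_le (continuous_coord 0) continuous_const).closure_eq]

/-- The chart of the double given by a chart of the surface. -/
def doubleChart (he : e ∈ IsManifold.maximalAtlas (𝓡∂ 2) ∞ S) :
    OpenPartialHomeomorph (Double S) Plane where
  toFun := doubleMap e
  invFun := doubleInv e
  source := Double.proj ⁻¹' e.source
  target := foldPt ⁻¹' chartDomain e
  map_source' := by
    intro a ha
    obtain ⟨b, x, rfl⟩ := a.exists_incl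
    replace ha : x ∈ e.source := ha
    have hm := extend_mem_target ha
    rw [mem_preimage, doubleMap_incl he b ha, foldPt_toSide b hm.1]
    exact hm.2
  map_target' := fun v hv => extend_symm_mem ⟨foldPt_mem v, hv⟩
  left_inv' := by
    intro a ha
    obtain ⟨b, x, rfl⟩ := a.exists_incl
    replace ha : x ∈ e.source := ha
    have hm := extend_mem_target ha
    rw [doubleMap_incl he b ha, doubleInv, foldPt_toSide b hm.1]
    change Double.incl _ ((e.extend (𝓡∂ 2)).symm (e.extend (𝓡∂ 2) x)) = _
    rw [extend_left_inv ha]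
    have h0 := mem_half.1 hm.1
    rcases h0.eq_or_lt with h | h
    · exact Double.incl_eq_incl ((mem_boundary_iff he ha).2 h.symm)
    · cases b
      · congr 1
        simpa [toSide] using h
      · congr 1
        simpa [toSide] using h0
  right_inv' := by
    intro v hv
    have hm : foldPt v ∈ ℍ₂ ∩ chartDomain e := ⟨foldPt_mem v, hv⟩
    rw [doubleInv, doubleMap_incl he _ (extend_symm_mem hm), extend_right_inv hm, toSide_foldPt]
  open_source := e.open_source.preimage Double.continuous_proj
  open_target := (isOpen_chartDomain e).preimage continuous_foldPt
  continuousOn_toFun := continuousOn_doubleMap he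
  continuousOn_invFun := continuousOn_doubleInv he

/-- The coordinate changes of the double are smooth if those of the surface are slides near the
boundary: on the open half-planes they are copies of those of the surface, and near the boundary
line they are slides. -/
lemma contDiffAt_doubleMap_doubleInv (he : e ∈ IsManifold.maximalAtlas (𝓡∂ 2) ∞ S)
    (hf : f ∈ IsManifold.maximalAtlas (𝓡∂ 2) ∞ S)
    (hc : ∀ r ∈ (𝓡∂ 2).boundary S, r ∈ e.source → r ∈ f.source → ∃ τ c : ℝ, ∀ᶠ z in 𝓝 r,
      f.extend (𝓡∂ 2) z = slide τ c (e.extend (𝓡∂ 2) z)) {v : Plane}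
    (hv : foldPt v ∈ chartDomain e) (hvf : (e.extend (𝓡∂ 2)).symm (foldPt v) ∈ f.source) :
    ContDiffAt ℝ ∞ (fun w => doubleMap f (doubleInv e w)) v := by
  have hm : foldPt v ∈ ℍ₂ ∩ chartDomain e := ⟨foldPt_mem v, hv⟩
  have hev := (tendsto_foldPt v).eventually (eventually_symm_mem he hm (f.open_source.mem_nhds hvf))
  have heq : ∀ᶠ w in 𝓝 v, doubleMap f (doubleInv e w)
      = toSide (decide (0 ≤ w 0)) (chartTrans e f (foldPt w)) := by
    filter_upwards [hev] with w hw
    rw [doubleInv, doubleMap_incl hf _ hw.2, chartTrans]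
  have hsm := smoothNear_chartTrans he hf hm hvf
  rcases lt_trichotomy (v 0) 0 with h | h | h
  · have hs : ContDiffAt ℝ ∞ (fun w => toSide false (chartTrans e f (toSide false w))) v := by
      have hfv : toSide false v = foldPt v := by simp [toSide, foldPt, abs_of_neg h]
      have h1 : ContDiffAt ℝ ∞ (chartTrans e f) (toSide false v) := by
        rw [hfv]
        refine (hsm.self hm.1).contDiffAt ?_
        have : ℍ₂ = {w : Plane | 0 ≤ w 0} := by ext w; exact mem_half
        rw [this]
        filter_upwards [(isOpen_lt continuous_const (continuous_coord 0)).mem_nhds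
          (show (0 : ℝ) < foldPt v 0 by simpa [foldPt] using h.ne)] with w hw using le_of_lt hw
      exact (contDiff_toSide false).contDiffAt.comp v
        (h1.comp v (contDiff_toSide false).contDiffAt)
    refine hs.congr_of_eventuallyEq ?_
    filter_upwards [heq, (isOpen_lt (continuous_coord 0) continuous_const).mem_nhds h] with w h1 h2
    have h2 : w 0 < 0 := h2
    have h3 : toSide false w = foldPt w := by simp [toSide, foldPt, abs_of_neg h2]
    rw [h1, h3]
    simp [not_le.2 h2]
  · have hf0 := foldPt_of_eq_zero h
    have hv0 : v = pt 0 (v 1) := by rw [← h, pt_eta]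
    have hrb : (e.extend (𝓡∂ 2)).symm (foldPt v) ∈ (𝓡∂ 2).boundary S := by
      rw [hf0, hv0] at hv ⊢
      exact symm_mem_boundary he hv
    obtain ⟨τ, c, hτ⟩ := hc _ hrb (extend_symm_mem hm) hvf
    refine (contDiff_slide τ c).contDiffAt.congr_of_eventuallyEq ?_
    filter_upwards [heq, (tendsto_foldPt v).eventually (eventually_symm_mem he hm hτ)] with w h1 h2
    rw [h1, chartTrans, h2.2, extend_right_inv h2.1, ← foldPt_slide]
    exact toSide_foldPt (slide τ c w)
  · have hs : ContDiffAt ℝ ∞ (chartTrans e f) v := by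
      rw [foldPt_of_nonneg h.le] at hsm hm
      refine (hsm.self hm.1).contDiffAt ?_
      have : ℍ₂ = {w : Plane | 0 ≤ w 0} := by ext w; exact mem_half
      rw [this]
      filter_upwards [(isOpen_lt continuous_const (continuous_coord 0)).mem_nhds h] with w hw
        using le_of_lt hw
    refine hs.congr_of_eventuallyEq ?_
    filter_upwards [heq, (isOpen_lt continuous_const (continuous_coord 0)).mem_nhds h] with w h1 h2
    have h2 : 0 < w 0 := h2
    rw [h1, foldPt_of_nonneg h2.le]
    simp [h2.le, toSide_true]

namespace FlatAtlas

variable (A : FlatAtlas S)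

/-- The charts of the double given by a flat atlas. -/
@[reducible] def chartedSpace : ChartedSpace Plane (Double S) where
  atlas := range fun p => doubleChart (A.mem_maximal p)
  chartAt a := doubleChart (A.mem_maximal a.proj)
  mem_chart_source a := A.mem_source a.proj
  chart_mem_atlas a := mem_range_self a.proj

lemma isManifold : letI := A.chartedSpace; IsManifold (𝓡 2) ∞ (Double S) := by
  let _ := A.chartedSpace
  refine isManifold_of_contDiffOn _ _ _ ?_
  rintro _ _ ⟨p, rfl⟩ ⟨q, rfl⟩ v hv
  have hv' : v ∈ ((doubleChart (A.mem_maximal p)).symm ≫ₕ doubleChart (A.mem_maximal q)).source :=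
    hv.1
  rw [OpenPartialHomeomorph.trans_source] at hv'
  refine ContDiffAt.contDiffWithinAt ?_
  exact contDiffAt_doubleMap_doubleInv (A.mem_maximal p) (A.mem_maximal q)
    (fun r hb hp hq => by
      obtain ⟨τ, c, -, h⟩ := A.compat p q r hb hp hq
      exact ⟨τ, c, h⟩) hv'.1 hv'.2

lemma contMDiffAt_doubleMap (p : S) {a : Double S} (ha : a.proj ∈ (A.chart p).source) :
    letI := A.chartedSpace
    ContMDiffAt (𝓡 2) 𝓘(ℝ, Plane) ∞ (doubleMap (A.chart p)) a := by
  let _ := A.chartedSpace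
  have := A.isManifold
  have h : doubleChart (A.mem_maximal p) ∈ IsManifold.maximalAtlas (𝓡 2) ∞ (Double S) :=
    IsManifold.subset_maximalAtlas (mem_range_self p)
  exact contMDiffAt_of_mem_maximalAtlas h ha

lemma contMDiff_incl (b : Bool) :
    letI := A.chartedSpace
    ContMDiff (𝓡∂ 2) (𝓡 2) ∞ (Double.incl b : S → Double S) := by
  let _ := A.chartedSpace
  intro x
  rw [contMDiffAt_iff_target]
  refine ⟨(Double.continuous_incl b).continuousAt, ?_⟩
  have h1 : ContMDiffAt (𝓡∂ 2) 𝓘(ℝ, Plane) ∞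
      (fun z => toSide b ((A.chart x).extend (𝓡∂ 2) z)) x :=
    (contDiff_toSide b).contMDiff.contMDiffAt.comp x
      (contMDiffAt_extend (A.mem_maximal x) (A.mem_source x))
  refine h1.congr_of_eventuallyEq ?_
  filter_upwards [(A.chart x).open_source.mem_nhds (A.mem_source x)] with z hz
  exact doubleMap_incl (A.mem_maximal x) b hz

lemma contMDiff_swap :
    letI := A.chartedSpace
    ContMDiff (𝓡 2) (𝓡 2) ∞ (Double.swap : Double S → Double S) := by
  let _ := A.chartedSpace
  -- In the charts, the involution is the reflection `toSide false`.
  intro a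
  obtain ⟨b, x, rfl⟩ := a.exists_incl
  rw [contMDiffAt_iff_target]
  refine ⟨Double.continuous_swap.continuousAt, ?_⟩
  have h1 : ContMDiffAt (𝓡 2) 𝓘(ℝ, Plane) ∞
      (fun a => toSide false (doubleMap (A.chart x) a)) (Double.incl b x) :=
    (contDiff_toSide false).contMDiff.contMDiffAt.comp _
      (A.contMDiffAt_doubleMap x (A.mem_source x))
  refine h1.congr_of_eventuallyEq ?_
  filter_upwards [((A.chart x).open_source.preimage Double.continuous_proj).mem_nhds
    (show Double.incl b x ∈ _ from A.mem_source x)] with a ha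
  obtain ⟨c, z, rfl⟩ := a.exists_incl
  replace ha : z ∈ (A.chart x).source := ha
  rw [doubleMap_incl (A.mem_maximal x) c ha, ← toSide_not,
    ← doubleMap_incl (A.mem_maximal x) (!c) ha]
  rfl

/-- The differential of the inclusions of the two copies, in a chart. -/
lemma dmap_mfderiv_incl (p : S) (b : Bool) {x : S} (hx : x ∈ (A.chart p).source)
    (X : TangentSpace (𝓡∂ 2) x) :
    letI := A.chartedSpace
    dmap (𝓡 2) (doubleMap (A.chart p)) (Double.incl b x)
      (mfderiv (𝓡∂ 2) (𝓡 2) (Double.incl b : S → Double S) x X)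
      = toSide b (dchart (A.chart p) x X) := by
  let _ := A.chartedSpace
  have h1 := mfderiv_comp (I := 𝓡∂ 2) (I' := 𝓡 2) (I'' := 𝓘(ℝ, Plane)) x
    ((A.contMDiffAt_doubleMap p (a := Double.incl b x) hx).mdifferentiableAt (by simp))
    ((A.contMDiff_incl b x).mdifferentiableAt (by simp))
  have hL : IsLinearMap ℝ (toSide b) := by
    constructor
    · intro v w; ext i; cases b <;> fin_cases i <;> simp [toSide]; ring
    · intro t w; ext i; cases b <;> fin_cases i <;> simp [toSide]
  let L : Plane →L[ℝ] Plane := LinearMap.toContinuousLinearMap hL.mk'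
  have h2 := mfderiv_comp (I := 𝓡∂ 2) (I' := 𝓘(ℝ, Plane)) (I'' := 𝓘(ℝ, Plane)) x
    (L.contMDiff (n := ∞)|>.mdifferentiableAt (by simp))
    ((contMDiffAt_extend (A.mem_maximal p) hx).mdifferentiableAt (by simp))
  have h3 : doubleMap (A.chart p) ∘ (Double.incl b : S → Double S)
      =ᶠ[𝓝 x] L ∘ (A.chart p).extend (𝓡∂ 2) := by
    filter_upwards [(A.chart p).open_source.mem_nhds hx] with z hz
    exact doubleMap_incl (A.mem_maximal p) b hz
  rw [h3.mfderiv_eq, h2, L.mfderiv_eq] at h1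
  exact (DFunLike.congr_fun h1 X).symm

lemma mfderiv_incl_injective (b : Bool) (x : S) :
    letI := A.chartedSpace
    Function.Injective (mfderiv (𝓡∂ 2) (𝓡 2) (Double.incl b : S → Double S) x) := by
  let _ := A.chartedSpace
  -- In the charts, the inclusions are the identity and the reflection.
  intro X Y h
  have h1 := A.dmap_mfderiv_incl x b (A.mem_source x) X
  rw [h, A.dmap_mfderiv_incl x b (A.mem_source x) Y] at h1
  have h2 : dchart (A.chart x) x X = dchart (A.chart x) x Y := by
    rw [← toSide_toSide b (dchart (A.chart x) x X), ← h1, toSide_toSide]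
  rw [← mfderivWithin_symm_comp (A.mem_maximal x) (A.mem_source x) X,
    ← mfderivWithin_symm_comp (A.mem_maximal x) (A.mem_source x) Y]
  exact congrArg _ h2

/-- The smooth structure on the double given by a flat atlas. -/
def double : SmoothDouble S where
  charted := A.chartedSpace
  isManifold := A.isManifold
  smooth_incl := A.contMDiff_incl
  immersive_incl := A.mfderiv_incl_injective
  smooth_swap := A.contMDiff_swap

end FlatAtlas

end Double

/-! ### Lifting a metric to the double -/

/-- The matrix of coefficients on the plane which is symmetric under the reflection in the boundary
line and extends `M` from the half-plane. -/
def evenExt (M : Plane → Matrix (Fin 2) (Fin 2) ℝ) (i j : Fin 2) (v : Plane) : ℝ :=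
  (if i = j then 1 else side v) * M (foldPt v) i j

/-- The extension by reflection is smooth off the boundary line, and by definition of `EvenAt` also
on it. -/
lemma contDiffAt_evenExt {M : Plane → Matrix (Fin 2) (Fin 2) ℝ} {v : Plane}
    (hM : MetricNear M (foldPt v)) (hE : v 0 = 0 → EvenAt M v) (i j : Fin 2) :
    ContDiffAt ℝ ∞ (evenExt M i j) v := by
  have hsymm : ∀ᶠ w in 𝓝 v, M (foldPt w) 1 0 = M (foldPt w) 0 1 :=
    (tendsto_foldPt v).eventually hM.symm
  have hhalf : ℍ₂ = {w : Plane | 0 ≤ w 0} := by ext w; exact mem_half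
  rcases lt_trichotomy (v 0) 0 with h | h | h
  · have hfv : toSide false v = foldPt v := by simp [toSide, foldPt, abs_of_neg h]
    have h1 : ContDiffAt ℝ ∞ (fun w => M w i j) (toSide false v) := by
      rw [hfv]
      refine ((hM.smooth i j).self hM.mem).contDiffAt ?_
      rw [hhalf]
      filter_upwards [(isOpen_lt continuous_const (continuous_coord 0)).mem_nhds
        (show (0 : ℝ) < foldPt v 0 by simpa [foldPt] using h.ne)] with w hw using le_of_lt hw
    have h2 : ContDiffAt ℝ ∞ (fun w => (if i = j then 1 else -1) * M (toSide false w) i j) v :=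
      contDiffAt_const.mul (h1.comp v (contDiff_toSide false).contDiffAt)
    refine h2.congr_of_eventuallyEq ?_
    filter_upwards [(isOpen_lt (continuous_coord 0) continuous_const).mem_nhds h] with w hw
    have hw : w 0 < 0 := hw
    have h3 : toSide false w = foldPt w := by simp [toSide, foldPt, abs_of_neg hw]
    rw [evenExt, h3, side, if_neg (not_le.2 hw)]
  · obtain ⟨h00, h01, h11⟩ := hE h
    fin_cases i <;> fin_cases j
    · exact h00.congr_of_eventuallyEq (Filter.Eventually.of_forall fun w => by simp [evenExt])
    · exact h01.congr_of_eventuallyEq (Filter.Eventually.of_forall fun w => by simp [evenExt])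
    · refine h01.congr_of_eventuallyEq ?_
      filter_upwards [hsymm] with w hw
      simp [evenExt, hw]
    · exact h11.congr_of_eventuallyEq (Filter.Eventually.of_forall fun w => by simp [evenExt])
  · have h1 : ContDiffAt ℝ ∞ (fun w => M w i j) v := by
      rw [foldPt_of_nonneg h.le] at hM
      refine ((hM.smooth i j).self hM.mem).contDiffAt ?_
      rw [hhalf]
      filter_upwards [(isOpen_lt continuous_const (continuous_coord 0)).mem_nhds h] with w hw
        using le_of_lt hw
    refine h1.congr_of_eventuallyEq ?_
    filter_upwards [(isOpen_lt continuous_const (continuous_coord 0)).mem_nhds h] with w hw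
    have hw : 0 < w 0 := hw
    rw [evenExt, foldPt_of_nonneg hw.le, side, if_pos hw.le]
    simp

/-- The extension is invariant under the reflection, if the matrix is diagonal along the boundary
line. -/
lemma evenExt_toSide {M : Plane → Matrix (Fin 2) (Fin 2) ℝ} {w : Plane} (hw : w ∈ ℍ₂)
    (h : w 0 = 0 → M w 0 1 = 0 ∧ M w 1 0 = 0) (b : Bool) (X Y : Plane) :
    ∑ i, ∑ j, evenExt M i j (toSide b w) * toSide b X i * toSide b Y j
      = ∑ i, ∑ j, M w i j * X i * Y j := by
  have h0 := mem_half.1 hw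
  simp only [evenExt, foldPt_toSide b hw, Fin.sum_univ_two]
  cases b
  · rcases h0.eq_or_lt with h1 | h1
    · obtain ⟨e1, e2⟩ := h h1.symm
      simp [toSide, e1, e2]
    · simp [toSide, side, not_le.2 h1]
  · simp [toSide_true, side, h0]

section Lift

variable {S : Type*} [TopologicalSpace S] [ChartedSpace (EuclideanHalfSpace 2) S]
  [IsManifold (𝓡∂ 2) ∞ S] (A : FlatAtlas S) (g : Metric S)

/-- The lift of `g` to the double, in the chart at `p`. -/
def FlatAtlas.liftForm (p : S) (a : Double S) :
    letI := A.chartedSpace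
    TangentSpace (𝓡 2) a →L[ℝ] TangentSpace (𝓡 2) a →L[ℝ] ℝ :=
  letI := A.chartedSpace
  let P : Fin 2 → (TangentSpace (𝓡 2) a →L[ℝ] ℝ) := fun i =>
    (EuclideanSpace.proj i : Plane →L[ℝ] ℝ).comp (mfderiv (𝓡 2) 𝓘(ℝ, Plane)
      (doubleMap (A.chart p)) a)
  ∑ i, ∑ j, evenExt (coeffs g (A.chart p)) i j (doubleMap (A.chart p) a) • (P i).smulRight (P j)

lemma FlatAtlas.liftForm_apply (p : S) (a : Double S) :
    letI := A.chartedSpace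
    ∀ V W : TangentSpace (𝓡 2) a, A.liftForm g p a V W
      = ∑ i, ∑ j, evenExt (coeffs g (A.chart p)) i j (doubleMap (A.chart p) a)
        * dmap (𝓡 2) (doubleMap (A.chart p)) a V i * dmap (𝓡 2) (doubleMap (A.chart p)) a W j := by
  let _ := A.chartedSpace
  intro V W
  simp [liftForm, dmap, mul_assoc]
  rfl

variable {g}

/-- The pullback of the lifted form to the two copies is the metric. -/
lemma FlatAtlas.liftForm_incl
    (h1 : ∀ p x, pt 0 x ∈ chartDomain (A.chart p) → coeffs g (A.chart p) (pt 0 x) = 1)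
    (p : S) (b : Bool) {x : S} (hx : x ∈ (A.chart p).source) (X Y : TangentSpace (𝓡∂ 2) x) :
    letI := A.chartedSpace
    A.liftForm g p (Double.incl b x) (mfderiv (𝓡∂ 2) (𝓡 2) (Double.incl b : S → Double S) x X)
      (mfderiv (𝓡∂ 2) (𝓡 2) (Double.incl b : S → Double S) x Y) = g.inner x X Y := by
  let _ := A.chartedSpace
  have hm := extend_mem_target hx
  rw [A.liftForm_apply, A.dmap_mfderiv_incl p b hx, A.dmap_mfderiv_incl p b hx,
    doubleMap_incl (A.mem_maximal p) b hx, evenExt_toSide hm.1 ?_,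
    inner_eq_coeffs (A.mem_maximal p) g hx]
  intro h0
  have h2 : (A.chart p).extend (𝓡∂ 2) x = pt 0 ((A.chart p).extend (𝓡∂ 2) x 1) := by
    rw [← h0, pt_eta]
  rw [h2] at hm ⊢
  rw [h1 p _ hm.2]
  simp

lemma FlatAtlas.mfderiv_incl_surjective (b : Bool) (x : S) :
    letI := A.chartedSpace
    Function.Surjective (mfderiv (𝓡∂ 2) (𝓡 2) (Double.incl b : S → Double S) x) := by
  let _ := A.chartedSpace
  let L : Plane →L[ℝ] Plane := mfderiv (𝓡∂ 2) (𝓡 2) (Double.incl b : S → Double S) x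
  have h : Function.Injective L.toLinearMap := A.mfderiv_incl_injective b x
  have h2 : Function.Surjective L.toLinearMap := LinearMap.injective_iff_surjective.1 h
  exact h2

/-- A metric which is Euclidean along the boundary and whose coefficients extend smoothly by
reflection, in the charts of a flat atlas, lifts to the double. -/
theorem FlatAtlas.lifts
    (h1 : ∀ p x, pt 0 x ∈ chartDomain (A.chart p) → coeffs g (A.chart p) (pt 0 x) = 1)
    (hE : ∀ p x, pt 0 x ∈ chartDomain (A.chart p) → EvenAt (coeffs g (A.chart p)) (pt 0 x)) :
    A.double.Lifts g := by
  let _ := A.chartedSpace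
  have : IsManifold (𝓡 2) ∞ (Double S) := A.isManifold
  have hpull : ∀ (b : Bool) (x : S) (X Y : TangentSpace (𝓡∂ 2) x),
      A.liftForm g x (Double.incl b x) (mfderiv (𝓡∂ 2) (𝓡 2) (Double.incl b : S → Double S) x X)
      (mfderiv (𝓡∂ 2) (𝓡 2) (Double.incl b : S → Double S) x Y) = g.inner x X Y := fun b x X Y =>
    A.liftForm_incl h1 x b (A.mem_source x) X Y
  -- The pullback determines the form, since the differentials of the inclusions are surjective. So
  -- the forms defined by different charts agree, and symmetry and positivity are inherited from
  -- `g`.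
  have hlocal : ∀ (p : S) (a : Double S), a.proj ∈ (A.chart p).source →
      ∀ V W : TangentSpace (𝓡 2) a, A.liftForm g a.proj a V W = A.liftForm g p a V W := by
    intro p a ha V W
    obtain ⟨b, x, rfl⟩ := a.exists_incl
    obtain ⟨X, rfl⟩ := A.mfderiv_incl_surjective b x V
    obtain ⟨Y, rfl⟩ := A.mfderiv_incl_surjective b x W
    exact (hpull b x X Y).trans (A.liftForm_incl h1 p b ha X Y).symm
  change ∃ h : ContMDiffRiemannianMetric (𝓡 2) ∞ Plane (fun z : Double S => TangentSpace (𝓡 2) z),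
    ∀ (b : Bool) (x : S) (v w : TangentSpace (𝓡∂ 2) x),
      h.inner (Double.incl b x) (mfderiv (𝓡∂ 2) (𝓡 2) (Double.incl b : S → Double S) x v)
        (mfderiv (𝓡∂ 2) (𝓡 2) (Double.incl b : S → Double S) x w) = g.inner x v w
  refine ⟨{ inner := fun a => A.liftForm g a.proj a, symm := ?_, pos := ?_, isVonNBounded := ?_,
            contMDiff := ?_ }, fun b x X Y => hpull b x X Y⟩
  · intro a V W
    obtain ⟨b, x, rfl⟩ := a.exists_incl
    obtain ⟨X, rfl⟩ := A.mfderiv_incl_surjective b x V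
    obtain ⟨Y, rfl⟩ := A.mfderiv_incl_surjective b x W
    exact (hpull b x X Y).trans ((g.symm x X Y).trans (hpull b x Y X).symm)
  · intro a V hV
    obtain ⟨b, x, rfl⟩ := a.exists_incl
    obtain ⟨X, rfl⟩ := A.mfderiv_incl_surjective b x V
    have hX : X ≠ 0 := by
      rintro rfl
      exact hV (map_zero _)
    exact (g.pos x X hX).trans_eq (hpull b x X X).symm
  · intro a
    obtain ⟨b, x, rfl⟩ := a.exists_incl
    refine ((g.isVonNBounded x).image
      (mfderiv (𝓡∂ 2) (𝓡 2) (Double.incl b : S → Double S) x)).subset ?_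
    intro V hV
    obtain ⟨X, rfl⟩ := A.mfderiv_incl_surjective b x V
    exact ⟨X, (hpull b x X X).symm.trans_lt hV, rfl⟩
  · intro a
    have hs := A.contMDiffAt_doubleMap a.proj (A.mem_source a.proj)
    refine contMDiffAt_bilin (I := 𝓡 2) hs
      (m := fun i j z => evenExt (coeffs g (A.chart a.proj)) i j (doubleMap (A.chart a.proj) z))
      ?_ _ ?_
    · intro i j
      have hm : foldPt (doubleMap (A.chart a.proj) a) ∈ chartDomain (A.chart a.proj) :=
        (doubleChart (A.mem_maximal a.proj)).map_source (A.mem_source a.proj)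
      have h2 : ContDiffAt ℝ ∞ (evenExt (coeffs g (A.chart a.proj)) i j)
          (doubleMap (A.chart a.proj) a) := by
        refine contDiffAt_evenExt (metricNear_coeffs (A.mem_maximal _) g ⟨foldPt_mem _, hm⟩) ?_ i j
        intro h0
        rw [foldPt_of_eq_zero h0] at hm
        have h3 : doubleMap (A.chart a.proj) a = pt 0 (doubleMap (A.chart a.proj) a 1) := by
          rw [← h0, pt_eta]
        rw [h3] at hm ⊢
        exact hE _ _ hm
      exact h2.contMDiffAt.comp a hs
    · filter_upwards [((A.chart a.proj).open_source.preimage Double.continuous_proj).mem_nhds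
        (show a ∈ _ from A.mem_source a.proj)] with z hz V W
      rw [hlocal a.proj z hz, A.liftForm_apply]

end Lift

/-! ### Correcting a metric near a compact part of the boundary -/

lemma EvenAt.congr {M M' : Plane → Matrix (Fin 2) (Fin 2) ℝ} {v : Plane} (hE : EvenAt M v)
    (hv : v 0 = 0) (h : ∀ᶠ w in 𝓝[ℍ₂] v, M' w = M w) : EvenAt M' v := by
  have ht := tendsto_foldPt v
  rw [foldPt_of_eq_zero hv] at ht
  have hev := ht.eventually h
  refine ⟨hE.1.congr_of_eventuallyEq ?_, hE.2.1.congr_of_eventuallyEq ?_,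
    hE.2.2.congr_of_eventuallyEq ?_⟩ <;>
  · filter_upwards [hev] with w hw
    rw [hw]

lemma GeodesicChart.congr {M M' : Plane → Matrix (Fin 2) (Fin 2) ℝ} {B : Set Plane}
    (h : GeodesicChart M B) (hM : ∀ v ∈ ℍ₂ ∩ B, M' v = M v) : GeodesicChart M' B := by
  have hev : ∀ v ∈ B, ∀ᶠ w in 𝓝[ℍ₂] v, M' w = M w := by
    intro v hv
    filter_upwards [self_mem_nhdsWithin, mem_nhdsWithin_of_mem_nhds (h.isOpen.mem_nhds hv)]
      with w h1 h2 using hM w ⟨h1, h2⟩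
  refine ⟨h.isOpen, fun v hv => (h.metric v hv).congr (hev v hv.2), fun x hx => ?_⟩
  rw [hM _ ⟨pt_zero_mem x, hx⟩]
  refine ⟨(h.bdry x hx).1, ((partialWithin_congr (?_ : _ =ᶠ[_] _) 0).self_of_nhdsWithin
    (pt_zero_mem x)).trans (h.bdry x hx).2⟩
  filter_upwards [hev _ hx] with w hw
  rw [hw]

lemma MetricNear.coordCurvature_congr {M M' : Plane → Matrix (Fin 2) (Fin 2) ℝ} {v : Plane}
    (hM : MetricNear M v) (h : ∀ᶠ w in 𝓝[ℍ₂] v, M' w = M w) :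
    coordCurvature ℍ₂ M' v = coordCurvature ℍ₂ M v := by
  rw [hM.coordCurvature_eq_curvJ, (hM.congr h).coordCurvature_eq_curvJ, jetOf_congr hM.mem h]

section Correction

variable {S : Type*} [TopologicalSpace S] [ChartedSpace (EuclideanHalfSpace 2) S]
  [IsManifold (𝓡∂ 2) ∞ S] {e : OpenPartialHomeomorph S (EuclideanHalfSpace 2)}

lemma SmoothNear.contMDiffAt_comp_extend (he : e ∈ IsManifold.maximalAtlas (𝓡∂ 2) ∞ S)
    {f : Plane → ℝ} {z : S} (hz : z ∈ e.source) (hf : SmoothNear f (e.extend (𝓡∂ 2) z)) :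
    ContMDiffAt (𝓡∂ 2) 𝓘(ℝ, ℝ) ∞ (fun w => f (e.extend (𝓡∂ 2) w)) z := by
  have h1 := (hf.self (mem_range_self _)).contMDiffWithinAt
  have h2 := (contMDiffAt_extend he hz).contMDiffWithinAt (s := univ)
  have h3 := ContMDiffWithinAt.comp z h1 h2 (fun w _ => mem_range_self _)
  exact contMDiffWithinAt_univ.1 h3

lemma frame_extend (he : e ∈ IsManifold.maximalAtlas (𝓡∂ 2) ∞ S) {v : Plane}
    (hv : v ∈ ℍ₂ ∩ chartDomain e) (i : Fin 2) :
    dchart e ((e.extend (𝓡∂ 2)).symm v) (frame e i v) = stdVec i := mfderiv_frame he hv i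

/-- The metric obtained by subtracting from `g` a small bilinear form, with compact support in the
domain of a chart. -/
theorem exists_metric_sub [T2Space S] (he : e ∈ IsManifold.maximalAtlas (𝓡∂ 2) ∞ S) (g : Metric S)
    {N : Plane → Matrix (Fin 2) (Fin 2) ℝ} {Q : Set Plane} (hQ : IsCompact Q)
    (hQe : Q ⊆ ℍ₂ ∩ chartDomain e) (hN0 : ∀ v ∈ ℍ₂, v ∉ Q → N v = 0)
    (hsymm : ∀ v, N v 1 0 = N v 0 1)
    (hsm : ∀ v ∈ ℍ₂ ∩ chartDomain e, ∀ i j, SmoothNear (fun w => N w i j) v)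
    {ε : ℝ} (hε : 0 < ε) (hε1 : ε < 1)
    (hb : ∀ v ∈ Q, ∀ s t : ℝ, |N v 0 0 * s ^ 2 + 2 * N v 0 1 * (s * t) + N v 1 1 * t ^ 2|
        ≤ ε * (coeffs g e v 0 0 * s ^ 2 + 2 * coeffs g e v 0 1 * (s * t)
          + coeffs g e v 1 1 * t ^ 2)) :
    ∃ g' : Metric S, (∀ v ∈ ℍ₂ ∩ chartDomain e, coeffs g' e v = coeffs g e v - N v) ∧
      (∀ z, z ∉ (e.extend (𝓡∂ 2)).symm '' Q → g'.inner z = g.inner z) ∧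
      ∀ z (X : TangentSpace (𝓡∂ 2) z), |g.inner z X X - g'.inner z X X| ≤ ε * g.inner z X X := by
  classical
  set Q' := (e.extend (𝓡∂ 2)).symm '' Q with hQ'
  have hQ'e : Q' ⊆ e.source := by
    rintro _ ⟨v, hv, rfl⟩
    exact extend_symm_mem (hQe hv)
  have hQ'c : IsCompact Q' := by
    refine hQ.image_of_continuousOn ((e.continuousOn_extend_symm (I := 𝓡∂ 2)).mono ?_)
    rw [extend_target_eq]
    exact hQe
  have hzQ : ∀ z ∈ e.source, z ∉ Q' → N (e.extend (𝓡∂ 2) z) = 0 := by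
    intro z hz hz'
    refine hN0 _ (mem_range_self _) fun h => hz' ⟨_, h, extend_left_inv hz⟩
  -- The form `F` is the pullback of `N` by the chart, extended by zero.
  let P : ∀ z : S, Fin 2 → (TangentSpace (𝓡∂ 2) z →L[ℝ] ℝ) := fun z i =>
    (EuclideanSpace.proj i : Plane →L[ℝ] ℝ).comp (mfderiv (𝓡∂ 2) 𝓘(ℝ, Plane) (e.extend (𝓡∂ 2)) z)
  let F : ∀ z : S, TangentSpace (𝓡∂ 2) z →L[ℝ] TangentSpace (𝓡∂ 2) z →L[ℝ] ℝ := fun z =>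
    if z ∈ Q' then ∑ i, ∑ j, N (e.extend (𝓡∂ 2) z) i j • (P z i).smulRight (P z j) else 0
  have hF : ∀ z ∈ e.source, ∀ X Y : TangentSpace (𝓡∂ 2) z, F z X Y
      = ∑ i, ∑ j, N (e.extend (𝓡∂ 2) z) i j * dchart e z X i * dchart e z Y j := by
    intro z hz X Y
    by_cases h : z ∈ Q'
    · simp only [F, if_pos h]
      simp [P, mul_assoc]
      rfl
    · simp only [F, if_neg h]
      rw [hzQ z hz h]
      simp
  have hF0 : ∀ z, z ∉ Q' → F z = 0 := fun z hz => if_neg hz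
  have hgF : ∀ z, z ∉ Q' → g.inner z - F z = g.inner z := by
    intro z hz
    ext X Y
    change g.inner z X Y - F z X Y = g.inner z X Y
    simp [hF0 z hz]
  have hbound : ∀ z (X : TangentSpace (𝓡∂ 2) z), |F z X X| ≤ ε * g.inner z X X := by
    intro z X
    by_cases h : z ∈ Q'
    · have hz := hQ'e h
      have hv : e.extend (𝓡∂ 2) z ∈ Q := by
        obtain ⟨v, hv, rfl⟩ := h
        rwa [extend_right_inv (hQe hv)]
      have h1 := hb _ hv (dchart e z X 0) (dchart e z X 1)
      rw [hF z hz, inner_eq_coeffs he g hz]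
      simp only [Fin.sum_univ_two, hsymm, coeffs_symm]
      convert h1 using 2 <;> ring
    · rw [hF0 z h]
      have : 0 ≤ g.inner z X X := by
        by_cases hX : X = 0
        · simp [hX]
        · exact (g.pos z X hX).le
      simpa using mul_nonneg hε.le this
  refine ⟨{ inner := fun z => g.inner z - F z, symm := ?_, pos := ?_, isVonNBounded := ?_,
            contMDiff := ?_ }, ?_, ?_, ?_⟩
  · intro z X Y
    change g.inner z X Y - F z X Y = g.inner z Y X - F z Y X
    rw [g.symm z X Y]
    by_cases h : z ∈ Q'
    · rw [hF z (hQ'e h), hF z (hQ'e h)]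
      simp only [Fin.sum_univ_two, hsymm]
      ring
    · simp [hF0 z h]
  · intro z X hX
    change 0 < g.inner z X X - F z X X
    have h1 := g.pos z X hX
    have h2 := (abs_le.1 (hbound z X)).2
    nlinarith
  · intro z
    -- As `g' ≥ (1 - ε) g`, the unit ball of `g'` is contained in a multiple of that of `g`.
    obtain ⟨r, hr, hr2⟩ : ∃ r : ℝ, 0 < r ∧ r ^ 2 * (1 - ε) = 1 := by
      have h1 : 0 < 1 - ε := by linarith
      refine ⟨√(1 - ε)⁻¹, Real.sqrt_pos.2 (inv_pos.2 h1), ?_⟩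
      rw [Real.sq_sqrt (inv_pos.2 h1).le, inv_mul_cancel₀ h1.ne']
    refine ((g.isVonNBounded z).image
      (r • ContinuousLinearMap.id ℝ (TangentSpace (𝓡∂ 2) z))).subset ?_
    intro X hX
    refine ⟨r⁻¹ • X, ?_, by simp [smul_smul, hr.ne']⟩
    have hX' : g.inner z X X - F z X X < 1 := hX
    have h2 := (abs_le.1 (hbound z X)).2
    have h3 : (1 - ε) * g.inner z X X < 1 := by linarith
    have h4 : r⁻¹ * r⁻¹ = 1 - ε := by field_simp; linarith
    change g.inner z (r⁻¹ • X) (r⁻¹ • X) < 1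
    simp only [map_smul, smul_apply, smul_eq_mul, ← mul_assoc]
    rwa [h4]
  · intro z
    by_cases hz : z ∈ e.source
    · refine contMDiffAt_bilin (contMDiffAt_extend he hz)
        (m := fun i j w => coeffs g e (e.extend (𝓡∂ 2) w) i j - N (e.extend (𝓡∂ 2) w) i j) ?_ _ ?_
      · intro i j
        exact SmoothNear.contMDiffAt_comp_extend he hz
          ((smoothNear_coeffs he g (extend_mem_target hz) i j).sub
            (hsm _ (extend_mem_target hz) i j))
      · filter_upwards [e.open_source.mem_nhds hz] with w hw X Y
        change g.inner w X Y - F w X Y = _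
        rw [hF w hw, inner_eq_coeffs he g hw, ← Finset.sum_sub_distrib]
        simp only [← Finset.sum_sub_distrib, sub_mul]
        rfl
    · refine (g.contMDiff z).congr_of_eventuallyEq ?_
      filter_upwards [hQ'c.isClosed.isOpen_compl.mem_nhds (fun h => hz (hQ'e h))] with w hw
      rw [hgF w hw]
  · intro v hv
    ext i j
    change g.inner _ _ _ - F _ _ _ = g.inner _ _ _ - N v i j
    rw [hF _ (extend_symm_mem hv), frame_extend he hv, frame_extend he hv, extend_right_inv hv]
    congr 1
    fin_cases i <;> fin_cases j <;> simp [stdVec]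
  · exact hgF
  · intro z X
    change |g.inner z X X - (g.inner z X X - F z X X)| ≤ _
    rw [sub_sub_cancel]
    exact hbound z X

namespace FlatAtlas

variable (A : FlatAtlas S)

/-- In the charts of the flat atlas, the metric is Euclidean along the boundary, and the boundary is
geodesic. -/
def IsGeodesic (g : Metric S) : Prop :=
  ∀ q, GeodesicChart (coeffs g (A.chart q)) (chartDomain (A.chart q))

/-- In the charts of the flat atlas, the metric extends smoothly by reflection near `z`. -/
def IsEvenAt (g : Metric S) (z : S) : Prop :=
  ∀ q, z ∈ (A.chart q).source → EvenAt (coeffs g (A.chart q)) ((A.chart q).extend (𝓡∂ 2) z)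

variable {A} {g g' : Metric S} {z : S}

lemma isEvenAt_of_evenAt (hz : z ∈ (𝓡∂ 2).boundary S) {p : S} (hp : z ∈ (A.chart p).source)
    (h : EvenAt (coeffs g (A.chart p)) ((A.chart p).extend (𝓡∂ 2) z)) : A.IsEvenAt g z := by
  intro q hq
  obtain ⟨τ, c, hs, hr⟩ := A.exists_slideRel q p hz hq hp
  exact (hr g).evenAt ((mem_boundary_iff (A.mem_maximal q) hq).1 hz) (by rwa [hs])

lemma IsEvenAt.congr (hE : A.IsEvenAt g z) (hz : z ∈ (𝓡∂ 2).boundary S)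
    (h : ∀ᶠ w in 𝓝 z, g'.inner w = g.inner w) : A.IsEvenAt g' z := fun q hq =>
  (hE q hq).congr ((mem_boundary_iff (A.mem_maximal q) hq).1 hz)
    (coeffs_congr (A.mem_maximal q) hq h)

/-- One step of the correction: a metric can be made even along a compact part of the boundary
contained in the domain of a chart, by a small modification near this part. -/
theorem exists_step [T2Space S] (hG : A.IsGeodesic g) (p : S) {C W : Set S} (hC : IsCompact C)
    (hCb : C ⊆ (𝓡∂ 2).boundary S) (hCp : C ⊆ (A.chart p).source) (hW : IsOpen W) (hCW : C ⊆ W)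
    {ε : ℝ} (hε : 0 < ε) (hε1 : ε < 1) :
    ∃ g' : Metric S, A.IsGeodesic g' ∧
      (∃ Q, IsCompact Q ∧ Q ⊆ W ∧ ∀ z, z ∉ Q → g'.inner z = g.inner z) ∧
      (∀ z (X : TangentSpace (𝓡∂ 2) z), |g.inner z X X - g'.inner z X X| ≤ ε * g.inner z X X) ∧
      (∀ z, |gaussCurvature g' z - gaussCurvature g z| ≤ ε) ∧
      (∀ z ∈ C, A.IsEvenAt g' z) ∧
      ∀ z ∈ (𝓡∂ 2).boundary S, A.IsEvenAt g z → A.IsEvenAt g' z := by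
  set e := A.chart p with hed
  have he : e ∈ IsManifold.maximalAtlas (𝓡∂ 2) ∞ S := A.mem_maximal p
  have hbd : ∀ z ∈ e.source, z ∈ (𝓡∂ 2).boundary S →
      e.extend (𝓡∂ 2) z = pt 0 (e.extend (𝓡∂ 2) z 1) := fun z hz hb => extend_eq_pt he hz hb
  have hcont : ContinuousOn (fun z => e.extend (𝓡∂ 2) z 1) C := by
    refine (continuous_coord 1).comp_continuousOn ((e.continuousOn_extend (I := 𝓡∂ 2)).mono ?_)
    rw [e.extend_source]
    exact hCp
  -- The planar construction is carried out in the chart, inside the image of `W`.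
  have hW'o : IsOpen ((𝓡∂ 2).symm ⁻¹' (e.target ∩ e.symm ⁻¹' W)) :=
    (e.isOpen_inter_preimage_symm hW).preimage (𝓡∂ 2).continuous_symm
  obtain ⟨N, Q, hQ, hQW, hN0, hsymm, hsm, hb, hgeo, hK, hev1, hev2⟩ := (hG p).exists_correction
    (hC.image_of_continuousOn hcont) hW'o (by
      rintro _ ⟨z, hz, rfl⟩
      rw [← hbd z (hCp hz) (hCb hz)]
      refine ⟨(extend_mem_target (hCp hz)).2, (extend_mem_target (hCp hz)).2, ?_⟩
      change (e.extend (𝓡∂ 2)).symm (e.extend (𝓡∂ 2) z) ∈ W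
      rw [extend_left_inv (hCp hz)]
      exact hCW hz) hε
  have hQe : Q ⊆ ℍ₂ ∩ chartDomain e := fun v hv => ⟨(hQW hv).1, (hQW hv).2.1⟩
  obtain ⟨g', hco, hoff, hclose⟩ := exists_metric_sub he g hQ hQe hN0 hsymm hsm hε hε1 hb
  set Q' := (e.extend (𝓡∂ 2)).symm '' Q with hQ'
  have hQ'e : Q' ⊆ e.source := by
    rintro _ ⟨v, hv, rfl⟩
    exact extend_symm_mem (hQe hv)
  have hQ'c : IsCompact Q' := by
    refine hQ.image_of_continuousOn ((e.continuousOn_extend_symm (I := 𝓡∂ 2)).mono ?_)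
    rw [extend_target_eq]
    exact hQe
  have hoff' : ∀ z, z ∉ Q' → ∀ᶠ w in 𝓝 z, g'.inner w = g.inner w := by
    intro z hz
    filter_upwards [hQ'c.isClosed.isOpen_compl.mem_nhds hz] with w hw using hoff w hw
  have hgeo' : GeodesicChart (coeffs g' e) (chartDomain e) := hgeo.congr hco
  have hcoev : ∀ z ∈ e.source, ∀ᶠ w in 𝓝[ℍ₂] (e.extend (𝓡∂ 2) z),
      coeffs g' e w = coeffs g e w - N w := fun z hz => by
    filter_upwards [chartDomain_mem_nhdsWithin (extend_mem_target hz).2] with w hw using hco w hw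
  refine ⟨g', ?_, ⟨Q', hQ'c, ?_, hoff⟩, hclose, ?_, ?_, ?_⟩
  -- The conditions along the boundary hold in the chart `p`, and the slides carry them over to the
  -- other charts.
  · intro q
    refine ⟨isOpen_chartDomain _, fun v hv => metricNear_coeffs (A.mem_maximal q) g' hv, ?_⟩
    intro x hx
    have hm : pt 0 x ∈ ℍ₂ ∩ chartDomain (A.chart q) := ⟨pt_zero_mem x, hx⟩
    set r := ((A.chart q).extend (𝓡∂ 2)).symm (pt 0 x) with hr
    have hrq : r ∈ (A.chart q).source := extend_symm_mem hm
    have hrb : r ∈ (𝓡∂ 2).boundary S := symm_mem_boundary (A.mem_maximal q) hx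
    have hrx : (A.chart q).extend (𝓡∂ 2) r = pt 0 x := extend_right_inv hm
    by_cases hrQ : r ∈ Q'
    · obtain ⟨τ, c, hs, hrel⟩ := A.exists_slideRel q p hrb hrq (hQ'e hrQ)
      have hrel' := hrel g'
      have hb := hbd r (hQ'e hrQ) hrb
      have hd := extend_mem_target (hQ'e hrQ)
      rw [hb] at hd
      rw [hrx] at hrel' hs
      have hs' : slide τ c (pt 0 x) = pt 0 (e.extend (𝓡∂ 2) r 1) := hs.trans hb
      have h2 := hgeo'.bdry _ hd.2
      refine ⟨hrel'.eq_one hm.1 ?_, ?_⟩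
      · rw [hs']
        exact h2.1
      · rw [hrel'.partial_eq hm.1, hs']
        · exact h2.2
        · rw [hs']
          exact smoothNear_coeffs he g' hd 1 1
    · have hc := coeffs_congr (A.mem_maximal q) hrq (hoff' r hrQ)
      rw [hrx] at hc
      have h2 := (hG q).bdry x hx
      rw [hc.self_of_nhdsWithin hm.1]
      refine ⟨h2.1, ((partialWithin_congr (?_ : _ =ᶠ[_] _) 0).self_of_nhdsWithin hm.1).trans h2.2⟩
      filter_upwards [hc] with w hw
      rw [hw]
  · rintro _ ⟨v, hv, rfl⟩
    exact (hQW hv).2.2.2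
  -- Outside the compact set `Q'` the metric is unchanged, and inside the chart `p` computes both
  -- curvatures.
  · intro z
    by_cases hz : z ∈ Q'
    · have hze := hQ'e hz
      rw [gaussCurvature_eq he g' hze, gaussCurvature_eq he g hze,
        (hgeo.metric _ (extend_mem_target hze)).coordCurvature_congr (hcoev z hze)]
      exact hK _ (extend_mem_target hze)
    · rw [gaussCurvature_congr (hoff' z hz), sub_self, abs_zero]
      exact hε.le
  · intro z hz
    have hze := hCp hz
    refine isEvenAt_of_evenAt (hCb hz) hze (p := p) (EvenAt.congr ?_
      ((mem_boundary_iff he hze).1 (hCb hz)) (hcoev z hze))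
    have := hev1 _ ⟨z, hz, rfl⟩
    rwa [← hbd z hze (hCb hz)] at this
  · intro z hzb hE
    by_cases hz : z ∈ Q'
    · have hze := hQ'e hz
      refine isEvenAt_of_evenAt hzb hze (p := p) (EvenAt.congr ?_
        ((mem_boundary_iff he hze).1 hzb) (hcoev z hze))
      have h2 := hev2 (e.extend (𝓡∂ 2) z 1)
      rw [← hbd z hze hzb] at h2
      exact h2 (extend_mem_target hze).2 (hE p hze)
    · exact hE.congr hzb (hoff' z hz)

end FlatAtlas

end Correction

/-! ### The locally finite sequence of corrections -/

section Limit

variable {S : Type*} [TopologicalSpace S] [ChartedSpace (EuclideanHalfSpace 2) S]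
  [IsManifold (𝓡∂ 2) ∞ S]

/-- The neighbourhoods defined by the Riemannian distance are neighbourhoods for the topology of the
surface. -/
lemma boundaryNhd_mem_nhds (g : Metric S) {ε : ℝ} (hε : 0 < ε) {y : S}
    (hy : y ∈ (𝓡∂ 2).boundary S) : boundaryNhd g ε ∈ 𝓝 y := by
  let _ : RiemannianBundle (fun x : S => TangentSpace (𝓡∂ 2) x) := ⟨g.toRiemannianMetric⟩
  have : IsContinuousRiemannianBundle Plane (fun x : S => TangentSpace (𝓡∂ 2) x) :=
    ⟨g.inner, g.contMDiff.continuous, fun _ _ _ => rfl⟩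
  filter_upwards [eventually_riemannianEDist_lt (𝓡∂ 2) y (ENNReal.ofReal_pos.2 hε)]
    with x hx
  refine ⟨y, hy, ?_⟩
  change Manifold.riemannianEDist (𝓡∂ 2) x y < _
  rwa [Manifold.riemannianEDist_comm]

/-- A sequence of metrics whose steps have locally finite supports is locally eventually constant,
and so has a limit. -/
lemma exists_limit_metric {G : ℕ → Metric S} {W : ℕ → Set S} (hW : LocallyFinite W)
    (hG : ∀ n z, z ∉ W n → (G (n + 1)).inner z = (G n).inner z) :
    ∃ g' : Metric S, ∀ z, ∃ N, ∀ n ≥ N, ∀ᶠ w in 𝓝 z, g'.inner w = (G n).inner w := by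
  have h1 : ∀ z : S, ∃ t ∈ 𝓝 z, ∃ N, ∀ n ≥ N, ∀ w ∈ t, (G n).inner w = (G N).inner w := by
    intro z
    obtain ⟨t, ht, hfin⟩ := hW z
    obtain ⟨N, hN⟩ := hfin.bddAbove
    refine ⟨t, ht, N + 1, fun n hn w hw => ?_⟩
    induction n, hn using Nat.le_induction with
    | base => rfl
    | succ n hn ih =>
      rw [hG n w, ih]
      intro hwn
      have : n ≤ N := hN ⟨w, hwn, hw⟩
      omega
  choose t ht N hN using h1
  have key : ∀ z, ∀ n ≥ N z, ∀ w ∈ t z, (G (N w)).inner w = (G n).inner w := by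
    intro z n hn w hw
    rw [hN z n hn w hw, ← hN z _ (le_max_left (N z) (N w)) w hw,
      ← hN w _ (le_max_right (N z) (N w)) w (mem_of_mem_nhds (ht w))]
  refine ⟨{ inner := fun z => (G (N z)).inner z
            symm := fun z => (G (N z)).symm z
            pos := fun z => (G (N z)).pos z
            isVonNBounded := fun z => (G (N z)).isVonNBounded z
            contMDiff := fun z => ((G (N z)).contMDiff z).congr_of_eventuallyEq ?_ }, ?_⟩
  · filter_upwards [ht z] with w hw
    rw [key z (N z) le_rfl w hw]
  · intro z
    refine ⟨N z, fun n hn => ?_⟩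
    filter_upwards [ht z] with w hw using key z n hn w hw

variable [T2Space S] [SigmaCompactSpace S] {A : FlatAtlas S} {g : Metric S}

/-- The boundary is covered by a locally finite sequence of compact sets, contained in charts. -/
lemma FlatAtlas.exists_cover [Nonempty S] (A : FlatAtlas S) {U : Set S} (hU : IsOpen U)
    (hbU : (𝓡∂ 2).boundary S ⊆ U) :
    ∃ C W : ℕ → Set S, LocallyFinite W ∧ (𝓡∂ 2).boundary S ⊆ ⋃ n, C n ∧
      ∀ n, IsCompact (C n) ∧ C n ⊆ (𝓡∂ 2).boundary S ∧ IsOpen (W n) ∧ C n ⊆ W n ∧ W n ⊆ U ∧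
        ∃ p, C n ⊆ (A.chart p).source := by
  have : LocallyCompactSpace S := Manifold.locallyCompact_of_finiteDimensional (𝓡∂ 2)
  have hbasis : ∀ x ∈ (𝓡∂ 2).boundary S, (𝓝 x).HasBasis
      (fun K : Set S => K ∈ 𝓝 x ∧ IsCompact K ∧ K ⊆ U ∩ (A.chart x).source) interior := by
    intro x hx
    refine ⟨fun t => ⟨fun ht => ?_, ?_⟩⟩
    · obtain ⟨K, hK, hKt, hKc⟩ := local_compact_nhds (Filter.inter_mem ht (Filter.inter_mem
        (hU.mem_nhds (hbU hx)) ((A.chart x).open_source.mem_nhds (A.mem_source x))))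
      exact ⟨K, ⟨hK, hKc, fun z hz => (hKt hz).2⟩, fun z hz => (hKt (interior_subset hz)).1⟩
    · rintro ⟨K, ⟨hK, -⟩, hKt⟩
      exact Filter.mem_of_superset (interior_mem_nhds.2 hK) hKt
  obtain ⟨α, c, K, hcK, hcov, hfin⟩ := refinement_of_locallyCompact_sigmaCompact_of_nhds_basis_set
    isClosed_boundary' hbasis
  -- A closed refinement of the cover by the interiors of the sets `K a` gives the compact sets.
  obtain ⟨V, hVcov, hVc, hVK⟩ := exists_subset_iUnion_closed_subset isClosed_boundary'
    (fun _ => isOpen_interior) (fun x _ => hfin.point_finite x) hcov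
  have hα : Countable α := by
    rw [← countable_univ_iff]
    exact hfin.countable_univ fun a => ⟨c a, mem_interior_iff_mem_nhds.2 (hcK a).2.1⟩
  -- The index set is countable; it is embedded into `ℕ`, with empty sets at the remaining indices.
  obtain ⟨f, hf⟩ := exists_injective_nat α
  refine ⟨Function.extend f (fun a => V a ∩ (𝓡∂ 2).boundary S) fun _ => ∅,
    Function.extend f (fun a => interior (K a)) fun _ => ∅, ?_, ?_, ?_⟩
  · intro x
    obtain ⟨t, ht, htf⟩ := hfin x
    refine ⟨t, ht, (htf.image f).subset ?_⟩
    rintro n ⟨z, hz, hzt⟩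
    by_cases hn : ∃ a, f a = n
    · obtain ⟨a, rfl⟩ := hn
      rw [hf.extend_apply] at hz
      exact ⟨a, ⟨z, hz, hzt⟩, rfl⟩
    · rw [Function.extend_apply' _ _ _ hn] at hz
      exact hz.elim
  · intro z hz
    obtain ⟨a, ha⟩ := mem_iUnion.1 (hVcov hz)
    refine mem_iUnion.2 ⟨f a, ?_⟩
    rw [hf.extend_apply]
    exact ⟨ha, hz⟩
  · intro n
    by_cases hn : ∃ a, f a = n
    · obtain ⟨a, rfl⟩ := hn
      rw [hf.extend_apply, hf.extend_apply]
      have hsub : V a ∩ (𝓡∂ 2).boundary S ⊆ interior (K a) := fun z hz => hVK a hz.1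
      exact ⟨(hcK a).2.2.1.of_isClosed_subset ((hVc a).inter isClosed_boundary')
          (hsub.trans interior_subset), inter_subset_right, isOpen_interior, hsub,
        fun z hz => ((hcK a).2.2.2 (interior_subset hz)).1, c a,
        fun z hz => ((hcK a).2.2.2 (interior_subset (hsub hz))).2⟩
    · rw [Function.extend_apply' _ _ _ hn, Function.extend_apply' _ _ _ hn]
      exact ⟨isCompact_empty, empty_subset _, isOpen_empty, subset_rfl, empty_subset _,
        Classical.arbitrary S, empty_subset _⟩

/-- A metric with geodesic boundary can be changed, in an arbitrary neighbourhood of the boundary,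
into a metric which lifts to the double, with a small change of the metric and of its curvature. -/
theorem FlatAtlas.exists_even_metric [Nonempty S] (hg : A.IsGeodesic g) {U : Set S}
    (hU : IsOpen U) (hbU : (𝓡∂ 2).boundary S ⊆ U) {ε : ℝ} (hε : 0 < ε) (hε1 : ε < 1) :
    ∃ g' : Metric S, A.double.Lifts g' ∧ (∀ z, z ∉ U → g'.inner z = g.inner z) ∧
      (∀ z (X : TangentSpace (𝓡∂ 2) z), |g.inner z X X - g'.inner z X X| ≤ ε * g.inner z X X) ∧
      ∀ z, |gaussCurvature g' z - gaussCurvature g z| ≤ ε := by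
  obtain ⟨C, W, hWf, hCcov, hCW⟩ := A.exists_cover hU hbU
  choose hC hCb hWo hCW hWU p hp using hCW
  have hεn : ∀ n : ℕ, 0 < ε / 2 ^ (n + 2) ∧ ε / 2 ^ (n + 2) < 1 := by
    intro n
    refine ⟨by positivity, (div_lt_one (by positivity)).2 (hε1.trans_le ?_)⟩
    exact one_le_pow₀ (by norm_num)
  choose F hF1 hF2 hF3 hF4 hF5 hF6 using fun (n : ℕ) (h : {g : Metric S // A.IsGeodesic g}) =>
    exists_step h.2 (p n) (hC n) (hCb n) (hp n) (hWo n) (hCW n) (hεn n).1 (hεn n).2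
  let G : ℕ → {g : Metric S // A.IsGeodesic g} := fun n =>
    Nat.rec ⟨g, hg⟩ (fun n h => ⟨F n h, hF1 n h⟩) n
  have hstep : ∀ n, (G (n + 1)).1 = F n (G n) := fun n => rfl
  have hoff : ∀ n z, z ∉ W n → (G (n + 1)).1.inner z = (G n).1.inner z := by
    intro n z hz
    obtain ⟨Q, -, hQW, hQ⟩ := hF2 n (G n)
    exact hQ z fun h => hz (hQW h)
  obtain ⟨g', hg'⟩ := exists_limit_metric (G := fun n => (G n).1) hWf hoff
  -- The total error after `n` steps is at most `ε - ε / 2 ^ n`; the factor `2` accounts for the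
  -- error of the step being relative to the `n`-th metric, which is at most `2 g`.
  have hpow : ∀ n : ℕ, ε / 2 ^ (n + 2) * 2 = ε / 2 ^ n - ε / 2 ^ (n + 1) := by
    intro n
    rw [pow_add, pow_add]
    field_simp
    norm_num
  have hclose : ∀ n z (X : TangentSpace (𝓡∂ 2) z),
      |g.inner z X X - (G n).1.inner z X X| ≤ (ε - ε / 2 ^ n) * g.inner z X X := by
    intro n z X
    have hX : 0 ≤ g.inner z X X := by
      by_cases hX : X = 0
      · simp [hX]
      · exact (g.pos z X hX).le
    induction n with
    | zero => simp [G]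
    | succ n ih =>
      have h1 := hF3 n (G n) z X
      rw [← hstep n] at h1
      have hp0 : 0 < ε / 2 ^ n := by positivity
      have h2 : (G n).1.inner z X X ≤ 2 * g.inner z X X := by
        have := (abs_le.1 ih).1
        nlinarith
      have h3 : ε / 2 ^ (n + 2) * (G n).1.inner z X X
          ≤ (ε / 2 ^ n - ε / 2 ^ (n + 1)) * g.inner z X X := by
        rw [← hpow n, mul_assoc]
        exact mul_le_mul_of_nonneg_left h2 (hεn n).1.le
      calc |g.inner z X X - (G (n + 1)).1.inner z X X|
          ≤ |g.inner z X X - (G n).1.inner z X X|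
            + |(G n).1.inner z X X - (G (n + 1)).1.inner z X X| := abs_sub_le _ _ _
        _ ≤ _ := by nlinarith
  have hcurv : ∀ n z, |gaussCurvature (G n).1 z - gaussCurvature g z| ≤ ε - ε / 2 ^ n := by
    intro n z
    induction n with
    | zero => simp [G]
    | succ n ih =>
      have h1 := hF4 n (G n) z
      rw [← hstep n] at h1
      have h2 := hpow n
      have h3 := (hεn n).1
      calc |gaussCurvature (G (n + 1)).1 z - gaussCurvature g z|
          ≤ |gaussCurvature (G (n + 1)).1 z - gaussCurvature (G n).1 z|
            + |gaussCurvature (G n).1 z - gaussCurvature g z| := abs_sub_le _ _ _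
        _ ≤ _ := by linarith
  -- Once the metric is even at a point, the following steps keep it so.
  have heven : ∀ n, ∀ z ∈ C n, ∀ m, A.IsEvenAt (G (n + 1 + m)).1 z := by
    intro n z hz m
    induction m with
    | zero => exact hF5 n (G n) z hz
    | succ m ih => exact hF6 _ (G (n + 1 + m)) z (hCb n hz) ih
  refine ⟨g', A.lifts ?_ ?_, ?_, ?_, ?_⟩
  · intro q x hx
    obtain ⟨N, hN⟩ := hg' (((A.chart q).extend (𝓡∂ 2)).symm (pt 0 x))
    rw [← (((G N).2 q).bdry x hx).1]
    ext i j
    change g'.inner _ _ _ = (G N).1.inner _ _ _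
    rw [(hN N le_rfl).self_of_nhds]
  · intro q x hx
    have hm : pt 0 x ∈ ℍ₂ ∩ chartDomain (A.chart q) := ⟨pt_zero_mem x, hx⟩
    have hzb := symm_mem_boundary (A.mem_maximal q) hx
    have hzs := extend_symm_mem hm
    have hzx := extend_right_inv hm
    set z := ((A.chart q).extend (𝓡∂ 2)).symm (pt 0 x) with hz
    obtain ⟨n, hn⟩ := mem_iUnion.1 (hCcov hzb)
    obtain ⟨N, hN⟩ := hg' z
    have h1 := (heven n z hn N).congr hzb (hN _ (Nat.le_add_left N (n + 1))) q hzs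
    rwa [hzx] at h1
  · intro z hz
    obtain ⟨N, hN⟩ := hg' z
    rw [(hN N le_rfl).self_of_nhds]
    have : ∀ n, (G n).1.inner z = g.inner z := by
      intro n
      induction n with
      | zero => rfl
      | succ n ih => rw [hoff n z fun h => hz (hWU n h), ih]
    exact this N
  · intro z X
    obtain ⟨N, hN⟩ := hg' z
    rw [(hN N le_rfl).self_of_nhds]
    refine (hclose N z X).trans ?_
    have hX : 0 ≤ g.inner z X X := by
      by_cases hX : X = 0
      · simp [hX]
      · exact (g.pos z X hX).le
    have hp0 : 0 < ε / 2 ^ N := by positivity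
    nlinarith
  · intro z
    obtain ⟨N, hN⟩ := hg' z
    rw [gaussCurvature_congr (hN N le_rfl)]
    have hp0 : 0 < ε / 2 ^ N := by positivity
    linarith [hcurv N z]

end Limit

end RiemSurf

end

theorem mainTheorem9 {S : Type*} [TopologicalSpace S] [T2Space S] [SecondCountableTopology S]
    [ConnectedSpace S] [ChartedSpace (EuclideanHalfSpace 2) S] [IsManifold (𝓡∂ 2) ∞ S]
    (hS : ((𝓡∂ 2).boundary S).Nonempty)
    (g : RiemSurf.Metric S) (hg : RiemSurf.HasGeodesicBoundary g) :
    ∃ D : RiemSurf.SmoothDouble S, ∀ ε : ℝ, 0 < ε →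
      ((∀ x, RiemSurf.gaussCurvature g x ≤ -1) →
        ∃ g' : RiemSurf.Metric S, RiemSurf.IsDoublingApprox D g ε g' ∧
          ∀ x, RiemSurf.gaussCurvature g' x ≤ -1 + ε) ∧
      ((∀ x, -1 ≤ RiemSurf.gaussCurvature g x) →
        ∃ g' : RiemSurf.Metric S, RiemSurf.IsDoublingApprox D g ε g' ∧
          ∀ x, -1 - ε ≤ RiemSurf.gaussCurvature g' x) ∧
      ((∀ x, RiemSurf.gaussCurvature g x ≤ 1) →
        ∃ g' : RiemSurf.Metric S, RiemSurf.IsDoublingApprox D g ε g' ∧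
          ∀ x, RiemSurf.gaussCurvature g' x ≤ 1 + ε) := by
  have : LocallyCompactSpace S := Manifold.locallyCompact_of_finiteDimensional (𝓡∂ 2)
  obtain ⟨A, hA⟩ := RiemSurf.exists_flatAtlas g
  have hgeo : A.IsGeodesic g := fun q =>
    RiemSurf.geodesicChart_coeffs hg (A.mem_maximal q) (hA q)
  refine ⟨A.double, fun ε hε => ?_⟩
  -- The minimum with `1 / 2` ensures that the corrected forms are positive definite.
  have hδ : 0 < min ε (1 / 2) := lt_min hε (by norm_num)
  obtain ⟨g', hlift, hoff, hclose, hK⟩ := RiemSurf.FlatAtlas.exists_even_metric hgeo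
    (isOpen_interior (s := RiemSurf.boundaryNhd g ε))
    (fun y hy => mem_interior_iff_mem_nhds.2 (RiemSurf.boundaryNhd_mem_nhds g hε hy))
    hδ ((min_le_right _ _).trans_lt (by norm_num))
  have happ : RiemSurf.IsDoublingApprox A.double g ε g' := by
    refine ⟨hlift, fun x hx => hoff x fun h => hx (interior_subset h), fun x _ v hv => ?_⟩
    have h1 := hclose x v
    rw [hv, mul_one] at h1
    rw [hv]
    exact h1.trans (min_le_left _ _)
  have hK' : ∀ x, |RiemSurf.gaussCurvature g' x - RiemSurf.gaussCurvature g x| ≤ ε := fun x =>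
    (hK x).trans (min_le_left _ _)
  refine ⟨fun h => ⟨g', happ, fun x => ?_⟩, fun h => ⟨g', happ, fun x => ?_⟩,
    fun h => ⟨g', happ, fun x => ?_⟩⟩
  · linarith [(abs_le.1 (hK' x)).2, h x]
  · linarith [(abs_le.1 (hK' x)).1, h x]
  · linarith [(abs_le.1 (hK' x)).2, h x]
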